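/- Let $d\ge 1$, equip $\mathbb R^d$ with the sup norm, and write $B(x,a)$ for the closed cube centred at $x$ with side length $a$ and $V(B(x,a))=a^d$ for its volume. Let $S\subset\mathbb R^d$ be compact, $A>0$, and $D=\bigcup_{x\in S}B(x,A)$. For a set $E$ let $\mathcal P(E,a)$ be its packing number: the maximal number of points of $E$ such that the cubes of side $a$ centred at them are disjoint. Cost functions are measurable functions $f:D\to\mathbb R$ with a minimiser $x^*$ over $D$ that lies in $S$. Fix $M>0$, $0<\alpha\le 2$ and $0\le\beta\le d/\alpha$. For a constant $C_0$, a cost function $f$ is called admissible with constant $C_0$ if (a) $f(x)-f(x^*)\le M$ for all $x\in S$; (b) for all $x\in S$ and $a\in(0,A)$, $f$ is integrable on $B(x,a)$ and $\left|\frac1{V(B(x,a))}\int_{B(x,a)}f(u)\,du-f(x)\right|\le M a^\alpha$; (c) $\mathcal P(\{x\in S: f(x)-f(x^*)<\epsilon\},a)\le C_0(1+\epsilon^\beta/a^d)$ for all $a,\epsilon>0$. A strategy $\sigma$ chooses queries $X_1,X_2,\dots\in D$ successively; after each query it receives $Y_t=f(X_t)+W_t$ with $W_t$ i.i.d. $\mathcal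 N(0,1)$, and $X_t$ is a measurable function of $X_1,Y_1,\dots,X_{t-1},Y_{t-1}$ (and possibly of an internal random seed independent of the noise). Its expected cumulative regret is $R=R(\sigma,f,T)=\mathbb E\sum_{t=1}^T\big(f(X_t)-f(x^*)\big)$. **Theorem.** Let the reference cost function $f_0$, with minimiser $x_0^*\in S$, satisfy (a$'$) $f_0(x)-f_0(x_0^*)\le M/2$ for all $x\in S$; (b$'$) for all $x\in S$ and $a\in(0,A)$, $f_0$ is integrable on $B(x,a)$ and $\left|\frac1{V(B(x,a))}\int_{B(x,a)}f_0(u)\,du-f_0(x)\right|\le \frac12 M a^\alpha$; (c$'$) there is $c_0>0$ such that, for all sufficiently small $\epsilon>0$ and all sufficiently small $r>0$ (where "sufficiently small" for $r$ may depend on $\epsilon$), $\mathcal P(\{x\in S: f_0(x)-f_0(x_0^*)<\epsilon\},r)\ge c_0\,\epsilon^\beta/r^d$; (d$'$) near its minimisers in $S$ the function $f_0$ is regular also across the boundary of $S$: there are $\delta\in(0,A/2]$ and $K$ such that for every minimiser $x_0\in S$ of $f_0$, every $y\in B(x_0,\delta)$ and every $a\in(0,\delta)$, $f_0$ is integrable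 on $B(y,a)$ and $\left|\frac1{V(B(y,a))}\int_{B(y,a)}f_0(u)\,du-f_0(y)\right|\le K a^\alpha$. Then there is a nonincreasing sequence of positive numbers $\epsilon_T\to0$ such that, with $\Sigma_{f_0}$ the set of all cost functions $f$ with $\sup_{D}|f-f_0|<\epsilon_T$ that are admissible with some constant $C_0$, $$\inf_\sigma\ \sup_{f\in\Sigma_{f_0}}\ \frac RT=\Omega\!\left(T^{-\frac{\alpha}{d+2\alpha-\alpha\beta}}\right)\qquad(T\to\infty).$$ If moreover $f_0$ itself satisfies (c) with some constant, then, for the same sequence $\epsilon_T$, there is one constant $C_0$, not depending on $T$ or $f$, such that the same bound holds when $\Sigma_{f_0}$ is restricted to the functions admissible with this $C_0$. -/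

import Mathlib

open MeasureTheory Set Filter Topology
open scoped NNReal ENNReal

noncomputable section

namespace Bandit

/-- The space `ℝᵈ` with the sup norm, so that closed balls are closed cubes. -/
abbrev Pt (d : ℕ) : Type := Fin d → ℝ

/-- The closed cube centred at `x` whose side has length `a`. -/
def cube {d : ℕ} (x : Pt d) (a : ℝ) : Set (Pt d) := Metric.closedBall x (a / 2)

/-- The set on which the cost function lives and may be queried: all points of the cubes of side
`A` centred in the decision space `S`. -/
def domain {d : ℕ} (S : Set (Pt d)) (A : ℝ) : Set (Pt d) := ⋃ x ∈ S, cube x A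

/-- The optimal value `f(x*)`; it is a genuine minimum whenever `HasOptimizer S A f` holds. -/
def minValue {d : ℕ} (S : Set (Pt d)) (A : ℝ) (f : Pt d → ℝ) : ℝ := sInf (f '' domain S A)

/-- `f` has a global minimiser `x*`, and it lies in the decision space `S`. -/
def HasOptimizer {d : ℕ} (S : Set (Pt d)) (A : ℝ) (f : Pt d → ℝ) : Prop :=
  ∃ xs ∈ S, ∀ x ∈ domain S A, f xs ≤ f x

/-- The mean of `f` over the cube of side `a` centred at `x` exists and differs from `f x` by at
most `K * a ^ α`. -/
def MeanClose {d : ℕ} (f : Pt d → ℝ) (K α : ℝ) (x : Pt d) (a : ℝ) : Prop :=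
  IntegrableOn f (cube x a) volume ∧ |(⨍ u in cube x a, f u) - f x| ≤ K * a ^ α

/-- Boundedness: `f x - f(x*) ≤ M` on the decision space. -/
def BoundedGap {d : ℕ} (S : Set (Pt d)) (A : ℝ) (f : Pt d → ℝ) (M : ℝ) : Prop :=
  ∀ x ∈ S, f x - minValue S A f ≤ M

/-- Smoothness: cube means of side `a < A` are within `M * a ^ α` of the value at the centre. -/
def MeanSmooth {d : ℕ} (S : Set (Pt d)) (A : ℝ) (f : Pt d → ℝ) (M α : ℝ) : Prop :=
  ∀ x ∈ S, ∀ a ∈ Ioo 0 A, MeanClose f M α x a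

/-- The sublevel set `{x ∈ S | f x - f(x*) < ε}`. -/
def sublevel {d : ℕ} (S : Set (Pt d)) (A : ℝ) (f : Pt d → ℝ) (ε : ℝ) : Set (Pt d) :=
  {x ∈ S | f x - minValue S A f < ε}

/-- The packing number of `E` with cubes of side `a`: the largest number of points of `E` such that
the closed cubes of side `a` centred at them are pairwise disjoint, that is, such that the points
have mutual sup-norm distances larger than `a`. -/
def packing {d : ℕ} (E : Set (Pt d)) (a : ℝ) : ℝ≥0∞ :=
  ((Metric.packingNumber a.toNNReal E : ℕ∞) : ℝ≥0∞)

/-- Upper packing bound for the sublevel sets. -/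
def SublevelUpper {d : ℕ} (S : Set (Pt d)) (A : ℝ) (f : Pt d → ℝ) (C₀ β : ℝ) : Prop :=
  ∀ a > 0, ∀ ε > 0, packing (sublevel S A f ε) a ≤ ENNReal.ofReal (C₀ * (1 + ε ^ β / a ^ d))

/-- Reverse packing bound for the sublevel sets: there is `c₀ > 0` such that the bound holds for all
small `ε`, and for all `r` that are sufficiently small (possibly depending on `ε`). -/
def SublevelLower {d : ℕ} (S : Set (Pt d)) (A : ℝ) (f : Pt d → ℝ) (β : ℝ) : Prop :=
  ∃ c₀ > 0, ∃ ε₀ > 0, ∀ ε ∈ Ioo 0 ε₀, ∃ r₀ > 0, ∀ r ∈ Ioo 0 r₀,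
    ENNReal.ofReal (c₀ * (ε ^ β / r ^ d)) ≤ packing (sublevel S A f ε) r

/-- The standing assumptions on a cost function, with constants `A, M, C₀, α, β`. Only the values of
`f` on `domain S A` matter. -/
structure Admissible {d : ℕ} (S : Set (Pt d)) (A M C₀ α β : ℝ) (f : Pt d → ℝ) : Prop where
  measurable : Measurable f
  optimizer : HasOptimizer S A f
  bounded : BoundedGap S A f M
  smooth : MeanSmooth S A f M α
  upper : SublevelUpper S A f C₀ β

/-- `‖f - f₀‖_∞ < ε`, the supremum being taken over the domain. -/
def SupDistLT {d : ℕ} (S : Set (Pt d)) (A : ℝ) (f f₀ : Pt d → ℝ) (ε : ℝ) : Prop :=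
  ∃ η < ε, ∀ x ∈ domain S A, |f x - f₀ x| ≤ η

/-- The neighbourhood of `f₀` within the admissible functions with the given constants. -/
def nbhd {d : ℕ} (S : Set (Pt d)) (A M C₀ α β : ℝ) (f₀ : Pt d → ℝ) (ε : ℝ) : Set (Pt d → ℝ) :=
  {f | Admissible S A M C₀ α β f ∧ SupDistLT S A f f₀ ε}

/-- A (possibly randomised) query strategy on the set `D`: the `t`-th query (`t = 0, 1, …`) is a
measurable function of the previous queries and responses, and of an internal random seed that is
independent of the noise. Deterministic strategies are those that ignore the seed. -/
structure Strategy {d : ℕ} (D : Set (Pt d)) where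
  /-- law of the internal seed -/
  seedLaw : Measure ℝ
  isProb : IsProbabilityMeasure seedLaw
  /-- the query made at time `t`, given the seed and the history -/
  query : (t : ℕ) → ℝ → (Fin t → Pt d × ℝ) → Pt d
  measurable_query : ∀ t, Measurable (Function.uncurry (query t))
  query_mem : ∀ t u h, query t u h ∈ D

/-- The first `t` pairs (query, response) for the cost `f`, the seed `u` and the noise `w`: the
response to a query `x` at time `t` is `f x + w t`. -/
def history {d : ℕ} {D : Set (Pt d)} (σ : Strategy D) (f : Pt d → ℝ) (u : ℝ) (w : ℕ → ℝ) :
    (t : ℕ) → Fin t → Pt d × ℝ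
  | 0 => fun i => i.elim0
  | t + 1 => Fin.snoc (α := fun _ => Pt d × ℝ) (history σ f u w t)
      (σ.query t u (history σ f u w t), f (σ.query t u (history σ f u w t)) + w t)

/-- The query made at time `t`. -/
def queryAt {d : ℕ} {D : Set (Pt d)} (σ : Strategy D) (f : Pt d → ℝ) (u : ℝ) (w : ℕ → ℝ)
    (t : ℕ) : Pt d :=
  σ.query t u (history σ f u w t)

/-- The law of the noise: i.i.d. standard Gaussian variables. -/
def noiseLaw : Measure (ℕ → ℝ) :=
  Measure.infinitePi fun _ => ProbabilityTheory.gaussianReal 0 1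

/-- The expected cumulative regret of `σ` over the first `T` queries. For functions with an
optimizer every summand `f(X_t) - f(x*)` is nonnegative. -/
def regret {d : ℕ} (S : Set (Pt d)) (A : ℝ) (σ : Strategy (domain S A)) (f : Pt d → ℝ)
    (T : ℕ) : ℝ≥0∞ :=
  ∫⁻ p, ∑ t ∈ Finset.range T, ENNReal.ofReal (f (queryAt σ f p.1 p.2 t) - minValue S A f)
    ∂(σ.seedLaw.prod noiseLaw)

/-- The minimax average regret at horizon `T` over a class `F` of cost functions. -/
def minimaxAvgRegret {d : ℕ} (S : Set (Pt d)) (A : ℝ) (F : Set (Pt d → ℝ)) (T : ℕ) : ℝ≥0∞ :=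
  ⨅ σ : Strategy (domain S A), ⨆ f ∈ F, regret S A σ f T / (T : ℝ≥0∞)

/-- `u T = Ω(T ^ (-γ))`. -/
def IsOmegaRate (u : ℕ → ℝ≥0∞) (γ : ℝ) : Prop :=
  ∃ c : ℝ, 0 < c ∧ ∀ᶠ T : ℕ in atTop, ENNReal.ofReal (c * (T : ℝ) ^ (-γ)) ≤ u T

end Bandit

end

noncomputable section

namespace Bandit

variable {d : ℕ}

/-! ### Histories and the noise -/

/-! Fix a small scale `r` and write `m₀` for the minimum of `f₀`. By the reverse packing bound, the
sublevel set of `f₀` at level `r ^ α` contains a set `Z` of about `r ^ (α * β - d)` points with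
mutual distances above `4 * c' * r`. Each `z ∈ Z` gives a cost function `F z` with `|F z - f₀| = O(r
^ α)`, equal to `f₀` outside a ball of radius `O(r)` around `z`, with its minimum at `z`, and such
that every query outside a small ball around `z` costs at least a constant times `r ^ α`. The small
balls are disjoint.

A strategy run under `f₀` must avoid most of the small balls most of the time. It can behave
differently under `F z` only if it collects information, measured by the sum of `(F z - f₀) ^ 2`
over its queries. Each query informs about boundedly many `z`, so the total information is `O(r ^ (2
* α) * T)`. While this is a small multiple of the cardinality of `Z`, that is for `T` up to order `r
^ (-(d + 2 * α - α * β))`, some `F z` has average regret of order `r ^ α`. Taking `r` as a power of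
`T` gives the rate. The argument uses second moments of the log-likelihood ratio
(`lintegral_awayCount_le`, `exists_le_regret`, `le_minimaxAvgRegret`).

The delicate point is to keep `F z` admissible with the same `M`. The value `f₀ z` may exceed `m₀`
by nearly `r ^ α`, and a dip shallow enough to respect the smoothness constant need not reach below
`m₀`. Hence `f₀ - m₀` is first flattened at `z` by cutoffs. One cutoff costs a fixed multiple of `a
^ α` in the mean condition, which may exceed the available slack. Averaging cutoffs over `n`
separated scales `8 ^ k * r` divides that cost by `n`, since at a given point at most one scale at
least `a` has a nonzero commutator with the mean, while the scales below `a` sum geometrically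
(`abs_sum_cutoff_sub_le`, `PertSetup.meanSmooth`). The commutator bound at one scale rests on the
oscillation estimate `oscillation_le`; regularity across the boundary of `S` is needed there.

The dip carries a cusp, so that low sublevel sets of `F z` lie in balls of radius `O(ε ^ (1 / α))`,
and `α * β ≤ d` then yields the packing bound (`PertSetup.sublevelUpper`). -/

lemma history_succ {D : Set (Pt d)} (σ : Strategy D) (f : Pt d → ℝ) (u : ℝ) (w : ℕ → ℝ) (t : ℕ) :
    history σ f u w (t + 1) = Fin.snoc (α := fun _ => Pt d × ℝ) (history σ f u w t)
      (σ.query t u (history σ f u w t), f (σ.query t u (history σ f u w t)) + w t) := rfl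

/-- Strategies do not anticipate: only noise strictly before round `t` enters. This is the source of
the independence of the noise of round `t`. -/
lemma history_congr {D : Set (Pt d)} (σ : Strategy D) (f : Pt d → ℝ) (u : ℝ) {w w' : ℕ → ℝ}
    (t : ℕ) (h : ∀ i < t, w i = w' i) : history σ f u w t = history σ f u w' t := by
  induction t with
  | zero => rfl
  | succ t ih =>
    rw [history_succ, history_succ, ih fun i hi => h i (by omega), h t (by omega)]

lemma history_fst {D : Set (Pt d)} (σ : Strategy D) (f : Pt d → ℝ) (u : ℝ) (w : ℕ → ℝ) (t : ℕ)
    (i : Fin t) : (history σ f u w t i).1 = queryAt σ f u w i := by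
  induction t with
  | zero => exact i.elim0
  | succ t ih =>
    rw [history_succ]
    refine Fin.lastCases ?_ (fun j => ?_) i
    · simp [queryAt]
    · simp [ih j]

lemma measurable_snoc {α : Type*} [MeasurableSpace α] (t : ℕ) :
    Measurable fun p : (Fin t → α) × α => (Fin.snoc (α := fun _ => α) p.1 p.2 : Fin (t + 1) → α) := by
  refine measurable_pi_iff.2 fun i => ?_
  refine Fin.lastCases ?_ (fun j => ?_) i
  · simpa using measurable_snd
  · simpa [Function.comp_def] using (measurable_pi_apply j).comp (measurable_fst (α := Fin t → α) (β := α))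

/-- The history after one more round, as a function of seed, past and fresh noise. -/
def extend {D : Set (Pt d)} (σ : Strategy D) (f : Pt d → ℝ) (t : ℕ)
    (p : (ℝ × (Fin t → Pt d × ℝ)) × ℝ) : Fin (t + 1) → Pt d × ℝ :=
  Fin.snoc (α := fun _ => Pt d × ℝ) p.1.2
    (σ.query t p.1.1 p.1.2, f (σ.query t p.1.1 p.1.2) + p.2)

lemma measurable_query {D : Set (Pt d)} (σ : Strategy D) (t : ℕ) :
    Measurable fun p : ℝ × (Fin t → Pt d × ℝ) => σ.query t p.1 p.2 := σ.measurable_query t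

lemma measurable_extend {D : Set (Pt d)} (σ : Strategy D) {f : Pt d → ℝ} (hf : Measurable f)
    (t : ℕ) : Measurable (extend σ f t) := by
  have hq := (measurable_query σ t).comp
    (measurable_fst : Measurable (Prod.fst : (ℝ × (Fin t → Pt d × ℝ)) × ℝ → _))
  exact (measurable_snoc t).comp ((measurable_snd.comp measurable_fst).prodMk
    (hq.prodMk ((hf.comp hq).add measurable_snd)))

lemma measurable_history {D : Set (Pt d)} (σ : Strategy D) {f : Pt d → ℝ} (hf : Measurable f)
    (t : ℕ) : Measurable fun p : ℝ × (ℕ → ℝ) => history σ f p.1 p.2 t := by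
  induction t with
  | zero => exact measurable_pi_iff.2 fun i => i.elim0
  | succ t ih =>
    exact (measurable_extend σ hf t).comp ((measurable_fst.prodMk ih).prodMk
      ((measurable_pi_apply t).comp measurable_snd))

instance : IsProbabilityMeasure noiseLaw := by unfold noiseLaw; infer_instance

/-- Under the noise law, the noise of round `t` is independent of the history. -/
lemma indepFun_history {D : Set (Pt d)} (σ : Strategy D) {f : Pt d → ℝ} (hf : Measurable f)
    (u : ℝ) (t : ℕ) :
    ProbabilityTheory.IndepFun (fun w : ℕ → ℝ => history σ f u w t) (fun w => w t) noiseLaw := by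
  have h0 : ProbabilityTheory.iIndepFun (fun (i : ℕ) (w : ℕ → ℝ) => w i) noiseLaw :=
    ProbabilityTheory.iIndepFun_infinitePi (X := fun _ => id) (fun _ => measurable_id)
  have h1 := h0.indepFun_finset (Finset.range t) {t} (by simp) (fun i => measurable_pi_apply i)
  -- `e` pads the first `t` noise values by zeros. The padding is invisible to the history, which
  -- thereby becomes a function of finitely many coordinates, disjoint from coordinate `t`.
  let e : (Finset.range t → ℝ) → ℕ → ℝ := fun v i =>
    if h : i ∈ Finset.range t then v ⟨i, h⟩ else 0
  have he : Measurable e := by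
    refine measurable_pi_iff.2 fun i => ?_
    by_cases h : i ∈ Finset.range t
    · simp only [e, dif_pos h]
      exact measurable_pi_apply _
    · simp only [e, dif_neg h]
      exact measurable_const
  have h2 := h1.comp (φ := fun v => history σ f u (e v) t)
    (ψ := fun v : ({t} : Finset ℕ) → ℝ => v ⟨t, Finset.mem_singleton_self t⟩)
    ((measurable_history σ hf t).comp ((measurable_const (a := u)).prodMk he))
    (measurable_pi_apply (X := fun _ : ({t} : Finset ℕ) => ℝ) ⟨t, Finset.mem_singleton_self t⟩)
  have h3 : (fun w : ℕ → ℝ => history σ f u w t) =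
      (fun v => history σ f u (e v) t) ∘ fun (w : ℕ → ℝ) (i : Finset.range t) => w i := by
    funext w
    refine history_congr σ f u t fun i hi => ?_
    simp [e, hi]
  rw [h3]
  exact h2

/-- The noise of round `t` may be integrated out, given the history. -/
lemma lintegral_fresh_noise {D : Set (Pt d)} (σ : Strategy D) {f : Pt d → ℝ} (hf : Measurable f)
    (t : ℕ) {φ : (ℝ × (Fin t → Pt d × ℝ)) × ℝ → ℝ≥0∞} (hφ : Measurable φ) :
    ∫⁻ p, φ ((p.1, history σ f p.1 p.2 t), p.2 t) ∂(σ.seedLaw.prod noiseLaw) =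
      ∫⁻ p, ∫⁻ y, φ ((p.1, history σ f p.1 p.2 t), y) ∂(ProbabilityTheory.gaussianReal 0 1)
        ∂(σ.seedLaw.prod noiseLaw) := by
  have := σ.isProb
  have hH := measurable_history σ hf t
  have hψ : Measurable fun q : ℝ × (Fin t → Pt d × ℝ) =>
      ∫⁻ y, φ (q, y) ∂(ProbabilityTheory.gaussianReal 0 1) := hφ.lintegral_prod_right'
  have hl : Measurable fun p : ℝ × (ℕ → ℝ) => φ ((p.1, history σ f p.1 p.2 t), p.2 t) :=
    hφ.comp ((measurable_fst.prodMk hH).prodMk ((measurable_pi_apply t).comp measurable_snd))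
  have hr : Measurable fun p : ℝ × (ℕ → ℝ) => ∫⁻ y, φ ((p.1, history σ f p.1 p.2 t), y)
      ∂(ProbabilityTheory.gaussianReal 0 1) := hψ.comp (measurable_fst.prodMk hH)
  rw [lintegral_prod _ hl.aemeasurable, lintegral_prod _ hr.aemeasurable]
  refine lintegral_congr fun u => ?_
  have hHu : Measurable fun w : ℕ → ℝ => history σ f u w t :=
    hH.comp (measurable_const.prodMk measurable_id)
  have hmap := (ProbabilityTheory.indepFun_iff_map_prod_eq_prod_map_map hHu.aemeasurable
    (measurable_pi_apply t).aemeasurable).1 (indepFun_history σ hf u t)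
  have hmt : Measure.map (fun w : ℕ → ℝ => w t) noiseLaw =
      ProbabilityTheory.gaussianReal 0 1 := by
    simpa [noiseLaw] using Measure.infinitePi_map_eval
      (fun _ : ℕ => ProbabilityTheory.gaussianReal 0 1) t
  have hφu : Measurable fun q : (Fin t → Pt d × ℝ) × ℝ => φ ((u, q.1), q.2) :=
    hφ.comp ((measurable_const.prodMk measurable_fst).prodMk measurable_snd)
  have hpr : IsProbabilityMeasure (Measure.map (fun w : ℕ → ℝ => history σ f u w t) noiseLaw) :=
    Measure.isProbabilityMeasure_map hHu.aemeasurable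
  calc ∫⁻ w, φ ((u, history σ f u w t), w t) ∂noiseLaw
      = ∫⁻ q, φ ((u, q.1), q.2) ∂(Measure.map (fun w : ℕ → ℝ => (history σ f u w t, w t))
          noiseLaw) := (lintegral_map hφu (hHu.prodMk (measurable_pi_apply t))).symm
    _ = ∫⁻ H, ∫⁻ y, φ ((u, H), y) ∂(ProbabilityTheory.gaussianReal 0 1)
          ∂(Measure.map (fun w : ℕ → ℝ => history σ f u w t) noiseLaw) := by
        rw [hmap, hmt, lintegral_prod _ hφu.aemeasurable]
    _ = _ := by
        exact lintegral_map (f := fun H => ∫⁻ y, φ ((u, H), y)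
          ∂(ProbabilityTheory.gaussianReal 0 1))
          (hψ.comp (measurable_const.prodMk measurable_id)) hHu

/-- Change of measure between two translates of the standard Gaussian law. -/
lemma lintegral_gaussian_shift (a b : ℝ) {φ : ℝ → ℝ≥0∞} (hφ : Measurable φ) :
    ∫⁻ y, φ (b + y) ∂(ProbabilityTheory.gaussianReal 0 1) =
      ∫⁻ y, φ (a + y) * ENNReal.ofReal (Real.exp ((b - a) * y - (b - a) ^ 2 / 2))
        ∂(ProbabilityTheory.gaussianReal 0 1) := by
  have hpdf : Measurable (ProbabilityTheory.gaussianPDF 0 1) :=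
    ProbabilityTheory.measurable_gaussianPDF 0 1
  have hexp : Measurable fun y : ℝ =>
      ENNReal.ofReal (Real.exp ((b - a) * y - (b - a) ^ 2 / 2)) := by fun_prop
  have ha : Measurable fun y : ℝ => φ (a + y) := hφ.comp (measurable_const_add a)
  have hb : Measurable fun y : ℝ => φ (b + y) := hφ.comp (measurable_const_add b)
  have hab : Measurable fun y : ℝ => φ (a + y) *
      ENNReal.ofReal (Real.exp ((b - a) * y - (b - a) ^ 2 / 2)) := ha.mul hexp
  -- Translating the Lebesgue integral by `a - b` aligns the arguments of `φ`; what remains is an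
  -- identity between exponents.
  rw [ProbabilityTheory.gaussianReal_of_var_ne_zero 0 one_ne_zero,
    lintegral_withDensity_eq_lintegral_mul _ hpdf hb,
    lintegral_withDensity_eq_lintegral_mul _ hpdf hab,
    ← lintegral_add_right_eq_self _ (a - b)]
  refine lintegral_congr fun y => ?_
  simp only [Pi.mul_apply]
  rw [show b + (y + (a - b)) = a + y by ring, mul_comm (φ (a + y)) _, ← mul_assoc]
  congr 1
  simp only [ProbabilityTheory.gaussianPDF, ProbabilityTheory.gaussianPDFReal]
  rw [← ENNReal.ofReal_mul (by positivity), mul_assoc (√_)⁻¹, ← Real.exp_add]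
  congr 3
  simp
  ring

lemma lintegral_gaussian_sq (m c : ℝ) :
    ∫⁻ y, ENNReal.ofReal ((m + c * y) ^ 2) ∂(ProbabilityTheory.gaussianReal 0 1) =
      ENNReal.ofReal (m ^ 2 + c ^ 2) := by
  have h2 : MemLp (fun y : ℝ => y) 2 (ProbabilityTheory.gaussianReal 0 1) :=
    ProbabilityTheory.memLp_id_gaussianReal 2
  have h1 : Integrable (fun y : ℝ => y) (ProbabilityTheory.gaussianReal 0 1) :=
    h2.integrable (by norm_num)
  have hsq : Integrable (fun y : ℝ => y ^ 2) (ProbabilityTheory.gaussianReal 0 1) :=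
    h2.integrable_sq
  have hmean : ∫ y : ℝ, y ∂(ProbabilityTheory.gaussianReal 0 1) = 0 := by
    simp
  have hvar : ∫ y : ℝ, y ^ 2 ∂(ProbabilityTheory.gaussianReal 0 1) = 1 := by
    have := ProbabilityTheory.variance_fun_id_gaussianReal (μ := 0) (v := 1)
    rw [ProbabilityTheory.variance_eq_integral (by fun_prop)] at this
    simpa [hmean] using this
  have hexp : (fun y : ℝ => (m + c * y) ^ 2) = fun y => (m ^ 2 + 2 * m * c * y) + c ^ 2 * y ^ 2 := by
    funext y; ring
  have ha : Integrable (fun y : ℝ => m ^ 2 + 2 * m * c * y) (ProbabilityTheory.gaussianReal 0 1) :=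
    (integrable_const _).add (h1.const_mul _)
  rw [← ofReal_integral_eq_lintegral_ofReal (by rw [hexp]; exact ha.add (hsq.const_mul _))
    (ae_of_all _ fun y => sq_nonneg _), hexp, integral_add ha (hsq.const_mul _),
    integral_add (integrable_const _) (h1.const_mul _), integral_const_mul, integral_const_mul,
    hmean, hvar]
  simp

/-! ### Likelihood ratios -/

/-- Martingale part of the log-likelihood ratio of `f` against `f₀`. -/
def llMart (f₀ f : Pt d → ℝ) (t : ℕ) (H : Fin t → Pt d × ℝ) : ℝ :=
  ∑ i, (f (H i).1 - f₀ (H i).1) * ((H i).2 - f₀ (H i).1)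

/-- Quadratic variation of the log-likelihood ratio of `f` against `f₀`. -/
def llQuad (f₀ f : Pt d → ℝ) (t : ℕ) (H : Fin t → Pt d × ℝ) : ℝ :=
  ∑ i, (f (H i).1 - f₀ (H i).1) ^ 2

lemma measurable_llMart {f₀ f : Pt d → ℝ} (h₀ : Measurable f₀) (h : Measurable f) (t : ℕ) :
    Measurable (llMart f₀ f t) := by
  unfold llMart; fun_prop

lemma measurable_llQuad {f₀ f : Pt d → ℝ} (h₀ : Measurable f₀) (h : Measurable f) (t : ℕ) :
    Measurable (llQuad f₀ f t) := by
  unfold llQuad; fun_prop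

lemma llQuad_nonneg (f₀ f : Pt d → ℝ) (t : ℕ) (H : Fin t → Pt d × ℝ) : 0 ≤ llQuad f₀ f t H :=
  Finset.sum_nonneg fun _ _ => sq_nonneg _

lemma llMart_extend {D : Set (Pt d)} (σ : Strategy D) (f₀ f : Pt d → ℝ) (t : ℕ)
    (q : ℝ × (Fin t → Pt d × ℝ)) (y : ℝ) :
    llMart f₀ f (t + 1) (extend σ f₀ t (q, y)) =
      llMart f₀ f t q.2 + (f (σ.query t q.1 q.2) - f₀ (σ.query t q.1 q.2)) * y := by
  simp [llMart, extend, Fin.sum_univ_castSucc]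

lemma llQuad_extend {D : Set (Pt d)} (σ : Strategy D) (f₀ f : Pt d → ℝ) (t : ℕ)
    (q : ℝ × (Fin t → Pt d × ℝ)) (y : ℝ) :
    llQuad f₀ f (t + 1) (extend σ f₀ t (q, y)) =
      llQuad f₀ f t q.2 + (f (σ.query t q.1 q.2) - f₀ (σ.query t q.1 q.2)) ^ 2 := by
  simp [llQuad, extend, Fin.sum_univ_castSucc]

/-- The law of the history under `f` has density `exp (M - Q / 2)` against the law under `f₀`. -/
lemma lintegral_history_change {D : Set (Pt d)} (σ : Strategy D) {f₀ f : Pt d → ℝ}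
    (h₀ : Measurable f₀) (h : Measurable f) (t : ℕ) :
    ∀ {ψ : ℝ × (Fin t → Pt d × ℝ) → ℝ≥0∞}, Measurable ψ →
    ∫⁻ p, ψ (p.1, history σ f p.1 p.2 t) ∂(σ.seedLaw.prod noiseLaw) =
      ∫⁻ p, ψ (p.1, history σ f₀ p.1 p.2 t) *
        ENNReal.ofReal (Real.exp (llMart f₀ f t (history σ f₀ p.1 p.2 t) -
          llQuad f₀ f t (history σ f₀ p.1 p.2 t) / 2)) ∂(σ.seedLaw.prod noiseLaw) := by
  induction t with
  | zero =>
    intro ψ _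
    refine lintegral_congr fun p => ?_
    simp [llMart, llQuad, history]
  | succ t ih =>
    intro ψ hψ
    have hq := measurable_query σ t
    have hM := measurable_llMart h₀ h t
    have hQ := measurable_llQuad h₀ h t
    have hM' := measurable_llMart h₀ h (t + 1)
    have hQ' := measurable_llQuad h₀ h (t + 1)
    have hext : ∀ {k : Pt d → ℝ}, Measurable k → Measurable
        fun q : (ℝ × (Fin t → Pt d × ℝ)) × ℝ => (q.1.1, extend σ k t q) := fun hk =>
      (measurable_fst.comp measurable_fst).prodMk (measurable_extend σ hk t)
    -- `Ψ` is the conditional expectation of `ψ` given the past under `f`. The induction hypothesis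
    -- changes the measure of the past, and the Gaussian shift then changes that of the last
    -- response.
    let Ψ : ℝ × (Fin t → Pt d × ℝ) → ℝ≥0∞ := fun q =>
      ∫⁻ y, ψ (q.1, extend σ f t (q, y)) ∂(ProbabilityTheory.gaussianReal 0 1)
    have hΨ : Measurable Ψ := (hψ.comp (hext h)).lintegral_prod_right'
    have e1 : ∫⁻ p, ψ (p.1, history σ f p.1 p.2 (t + 1)) ∂(σ.seedLaw.prod noiseLaw) =
        ∫⁻ p, Ψ (p.1, history σ f p.1 p.2 t) ∂(σ.seedLaw.prod noiseLaw) :=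
      lintegral_fresh_noise σ h t (φ := fun q => ψ (q.1.1, extend σ f t q)) (hψ.comp (hext h))
    rw [e1, ih hΨ]
    have hφ : Measurable fun q : (ℝ × (Fin t → Pt d × ℝ)) × ℝ =>
        ψ (q.1.1, extend σ f₀ t q) * ENNReal.ofReal (Real.exp
          (llMart f₀ f (t + 1) (extend σ f₀ t q) - llQuad f₀ f (t + 1) (extend σ f₀ t q) / 2)) := by
      refine (hψ.comp (hext h₀)).mul ?_
      have := measurable_extend σ h₀ t
      exact ((Real.measurable_exp.comp ((hM'.comp this).sub
        ((hQ'.comp this).div_const 2))).ennreal_ofReal)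
    refine Eq.trans ?_ (lintegral_fresh_noise σ h₀ t hφ).symm
    refine lintegral_congr fun p => ?_
    set H := history σ f₀ p.1 p.2 t
    have hφH : Measurable fun y : ℝ => ψ (p.1, Fin.snoc (α := fun _ => Pt d × ℝ) H
        (σ.query t p.1 H, y)) :=
      hψ.comp (measurable_const.prodMk ((measurable_snoc t).comp
        (measurable_const.prodMk (measurable_const.prodMk measurable_id))))
    have e2 : Ψ (p.1, H) = _ :=
      lintegral_gaussian_shift (f₀ (σ.query t p.1 H)) (f (σ.query t p.1 H)) hφH
    rw [e2, ← lintegral_mul_const _ (by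
      exact (hφH.comp (measurable_const_add _)).mul (by fun_prop))]
    refine lintegral_congr fun y => ?_
    rw [llMart_extend, llQuad_extend, mul_assoc, ← ENNReal.ofReal_mul (Real.exp_pos _).le,
      ← Real.exp_add]
    congr 3
    ring

/-- The increments are predictable factors times centred noise of unit variance, so they are
orthogonal and the second moment equals the expected quadratic variation. -/
lemma lintegral_llMart_sq {D : Set (Pt d)} (σ : Strategy D) {f₀ f : Pt d → ℝ}
    (h₀ : Measurable f₀) (h : Measurable f) (t : ℕ) :
    ∫⁻ p, ENNReal.ofReal (llMart f₀ f t (history σ f₀ p.1 p.2 t) ^ 2)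
        ∂(σ.seedLaw.prod noiseLaw) =
      ∫⁻ p, ENNReal.ofReal (llQuad f₀ f t (history σ f₀ p.1 p.2 t))
        ∂(σ.seedLaw.prod noiseLaw) := by
  have := σ.isProb
  induction t with
  | zero => refine lintegral_congr fun p => ?_; simp [llMart, llQuad]
  | succ t ih =>
    have hq := measurable_query σ t
    have hH := measurable_history σ h₀ t
    have hM := measurable_llMart h₀ h t
    have hQ := measurable_llQuad h₀ h t
    have hqH : Measurable fun p : ℝ × (ℕ → ℝ) => σ.query t p.1 (history σ f₀ p.1 p.2 t) :=
      hq.comp (measurable_fst.prodMk hH)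
    have hmeas : Measurable fun q : (ℝ × (Fin t → Pt d × ℝ)) × ℝ =>
        ENNReal.ofReal (llMart f₀ f (t + 1) (extend σ f₀ t q) ^ 2) :=
      (((measurable_llMart h₀ h (t + 1)).comp (measurable_extend σ h₀ t)).pow_const 2).ennreal_ofReal
    have hΔ : Measurable fun p : ℝ × (ℕ → ℝ) => ENNReal.ofReal
        ((f (σ.query t p.1 (history σ f₀ p.1 p.2 t)) -
          f₀ (σ.query t p.1 (history σ f₀ p.1 p.2 t))) ^ 2) :=
      (((h.comp hqH).sub (h₀.comp hqH)).pow_const 2).ennreal_ofReal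
    calc _ = ∫⁻ p, ∫⁻ y, ENNReal.ofReal (llMart f₀ f (t + 1)
            (extend σ f₀ t ((p.1, history σ f₀ p.1 p.2 t), y)) ^ 2)
            ∂(ProbabilityTheory.gaussianReal 0 1) ∂(σ.seedLaw.prod noiseLaw) :=
          lintegral_fresh_noise σ h₀ t hmeas
      _ = ∫⁻ p, (ENNReal.ofReal (llMart f₀ f t (history σ f₀ p.1 p.2 t) ^ 2) +
            ENNReal.ofReal ((f (σ.query t p.1 (history σ f₀ p.1 p.2 t)) -
              f₀ (σ.query t p.1 (history σ f₀ p.1 p.2 t))) ^ 2)) ∂(σ.seedLaw.prod noiseLaw) := by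
          refine lintegral_congr fun p => ?_
          simp only [llMart_extend]
          rw [lintegral_gaussian_sq, ENNReal.ofReal_add (sq_nonneg _) (sq_nonneg _)]
      _ = ∫⁻ p, (ENNReal.ofReal (llQuad f₀ f t (history σ f₀ p.1 p.2 t)) +
            ENNReal.ofReal ((f (σ.query t p.1 (history σ f₀ p.1 p.2 t)) -
              f₀ (σ.query t p.1 (history σ f₀ p.1 p.2 t))) ^ 2)) ∂(σ.seedLaw.prod noiseLaw) := by
          rw [lintegral_add_right _ hΔ, ih, ← lintegral_add_right _ hΔ]
      _ = _ := by
          refine lintegral_congr fun p => ?_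
          rw [← ENNReal.ofReal_add (llQuad_nonneg _ _ _ _) (sq_nonneg _)]
          congr 1
          exact (llQuad_extend σ f₀ f t (p.1, history σ f₀ p.1 p.2 t) (p.2 t)).symm

/-- The number of queries of a history outside of `B`. -/
def awayCount (B : Set (Pt d)) (t : ℕ) (H : Fin t → Pt d × ℝ) : ℝ≥0∞ :=
  ∑ i, Bᶜ.indicator 1 (H i).1

lemma measurable_awayCount {B : Set (Pt d)} (hB : MeasurableSet B) (t : ℕ) :
    Measurable (awayCount B t) := by
  unfold awayCount
  refine Finset.measurable_sum _ fun i _ => ?_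
  exact (measurable_one.indicator hB.compl).comp (measurable_fst.comp (measurable_pi_apply i))

lemma awayCount_le (B : Set (Pt d)) (t : ℕ) (H : Fin t → Pt d × ℝ) : awayCount B t H ≤ t := by
  calc awayCount B t H ≤ ∑ _i : Fin t, (1 : ℝ≥0∞) :=
        Finset.sum_le_sum fun i _ => indicator_le_self' (fun _ _ => zero_le) _
    _ = t := by simp

/-- If `f` is close to `f₀` where the strategy looks under `f₀`, then it cannot avoid `B` much less
often under `f` than under `f₀`. -/
lemma lintegral_awayCount_le {D : Set (Pt d)} (σ : Strategy D) {f₀ f : Pt d → ℝ}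
    (h₀ : Measurable f₀) (h : Measurable f) {B : Set (Pt d)} (hB : MeasurableSet B) (T : ℕ) :
    ∫⁻ p, awayCount B T (history σ f₀ p.1 p.2 T) ∂(σ.seedLaw.prod noiseLaw) ≤
      ENNReal.ofReal (Real.exp 1) *
        ∫⁻ p, awayCount B T (history σ f p.1 p.2 T) ∂(σ.seedLaw.prod noiseLaw) +
      T * (5 * ∫⁻ p, ENNReal.ofReal (llQuad f₀ f T (history σ f₀ p.1 p.2 T))
        ∂(σ.seedLaw.prod noiseLaw)) := by
  have hH := measurable_history σ h₀ T
  have hM : Measurable fun p : ℝ × (ℕ → ℝ) => llMart f₀ f T (history σ f₀ p.1 p.2 T) :=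
    (measurable_llMart h₀ h T).comp hH
  have hQ : Measurable fun p : ℝ × (ℕ → ℝ) => llQuad f₀ f T (history σ f₀ p.1 p.2 T) :=
    (measurable_llQuad h₀ h T).comp hH
  have hV : Measurable fun p : ℝ × (ℕ → ℝ) => awayCount B T (history σ f₀ p.1 p.2 T) :=
    (measurable_awayCount hB T).comp hH
  rw [lintegral_history_change σ h₀ h T (ψ := fun q => awayCount B T q.2)
    ((measurable_awayCount hB T).comp measurable_snd)]
  set P := σ.seedLaw.prod noiseLaw
  have key : ∀ p : ℝ × (ℕ → ℝ), awayCount B T (history σ f₀ p.1 p.2 T) ≤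
      ENNReal.ofReal (Real.exp 1) * (awayCount B T (history σ f₀ p.1 p.2 T) *
        ENNReal.ofReal (Real.exp (llMart f₀ f T (history σ f₀ p.1 p.2 T) -
          llQuad f₀ f T (history σ f₀ p.1 p.2 T) / 2))) +
      T * (4 * ENNReal.ofReal (llMart f₀ f T (history σ f₀ p.1 p.2 T) ^ 2) +
        ENNReal.ofReal (llQuad f₀ f T (history σ f₀ p.1 p.2 T))) := by
    intro p
    set H := history σ f₀ p.1 p.2 T
    set m := llMart f₀ f T H
    set q := llQuad f₀ f T H with hq
    have hq0 : 0 ≤ q := llQuad_nonneg _ _ _ _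
    -- If the log-likelihood ratio is at least `-1`, the density is at least `1 / e`. Otherwise `m <
    -- -1/2` or `q > 1`, hence `4 * m ^ 2 + q ≥ 1`, and the trivial bound `T` on the count suffices.
    rcases le_or_gt (-1) (m - q / 2) with hc | hc
    · refine le_add_right ?_
      rw [mul_left_comm, ← ENNReal.ofReal_mul (Real.exp_pos _).le, ← Real.exp_add]
      refine le_mul_of_one_le_right zero_le ?_
      rw [ENNReal.one_le_ofReal]
      exact Real.one_le_exp (by linarith)
    · refine le_add_left ((awayCount_le B T H).trans (le_mul_of_one_le_right zero_le ?_))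
      have h4 : (4 : ℝ≥0∞) = ENNReal.ofReal 4 := by simp
      rw [h4, ← ENNReal.ofReal_mul (by norm_num), ← ENNReal.ofReal_add (by positivity) hq0,
        ENNReal.one_le_ofReal]
      rcases le_or_gt (-1 / 2) m with hm | hm
      · nlinarith [sq_nonneg m]
      · nlinarith
  refine (lintegral_mono key).trans ?_
  rw [lintegral_add_right _ (by fun_prop), lintegral_const_mul _ (by fun_prop),
    lintegral_const_mul _ (by fun_prop), lintegral_add_right _ (by fun_prop),
    lintegral_const_mul _ (by fun_prop), lintegral_llMart_sq σ h₀ h T]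
  refine le_of_eq ?_
  congr 2
  ring

/-- Lower bound for the worst regret over finitely many perturbations `F z` of `f₀`, where `F z` is
only good on `B z`, and differs from `f₀` only on `U z`. -/
lemma exists_le_regret {S : Set (Pt d)} {A : ℝ} (σ : Strategy (domain S A)) {ι : Type*}
    (Z : Finset ι) {f₀ : Pt d → ℝ} (h₀ : Measurable f₀) (F : ι → Pt d → ℝ)
    (hF : ∀ z ∈ Z, Measurable (F z)) (B : ι → Set (Pt d)) (hB : ∀ z ∈ Z, MeasurableSet (B z))
    (hdisj : ∀ x, ∀ z ∈ Z, ∀ z' ∈ Z, x ∈ B z → x ∈ B z' → z = z')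
    {h Γ m : ℝ} (hm : 0 ≤ m)
    (hgap : ∀ z ∈ Z, ∀ x ∈ domain S A, x ∉ B z → h ≤ F z x - minValue S A (F z))
    (hΔ : ∀ z ∈ Z, ∀ x ∈ domain S A, |F z x - f₀ x| ≤ Γ)
    (U : ι → Set (Pt d)) (hU : ∀ z ∈ Z, ∀ x ∈ domain S A, x ∉ U z → F z x = f₀ x)
    (hmult : ∀ x ∈ domain S A, ∀ Z' ⊆ Z, (∀ z ∈ Z', x ∈ U z) → (Z'.card : ℝ) ≤ m)
    (T : ℕ) (hZ : 2 ≤ Z.card) (hsmall : 20 * (Γ ^ 2 * m * T) ≤ Z.card) :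
    ∃ z ∈ Z, ENNReal.ofReal (h / (8 * Real.exp 1)) * T ≤ regret S A σ (F z) T := by
  classical
  have := σ.isProb
  set P := σ.seedLaw.prod noiseLaw with hP
  -- the regret dominates the number of queries away from the good set
  have hreg : ∀ z ∈ Z, ENNReal.ofReal h * ∫⁻ p, awayCount (B z) T (history σ (F z) p.1 p.2 T) ∂P
      ≤ regret S A σ (F z) T := by
    intro z hz
    have hV : Measurable fun p : ℝ × (ℕ → ℝ) => awayCount (B z) T (history σ (F z) p.1 p.2 T) :=
      (measurable_awayCount (hB z hz) T).comp (measurable_history σ (hF z hz) T)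
    rw [← lintegral_const_mul _ hV]
    refine lintegral_mono fun p => ?_
    rw [awayCount, Finset.mul_sum, ← Fin.sum_univ_eq_sum_range
      (fun t => ENNReal.ofReal (F z (queryAt σ (F z) p.1 p.2 t) - minValue S A (F z)))]
    refine Finset.sum_le_sum fun i _ => ?_
    rw [history_fst]
    by_cases hx : queryAt σ (F z) p.1 p.2 i ∈ B z
    · simp [hx]
    · have : queryAt σ (F z) p.1 p.2 i ∈ (B z)ᶜ := hx
      simp only [indicator_of_mem this, Pi.one_apply, mul_one]
      exact ENNReal.ofReal_le_ofReal (hgap z hz _ (σ.query_mem _ _ _) hx)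
  -- under `f₀` most good sets are avoided most of the time
  have haway : ((Z.card : ℝ≥0∞) - 1) * T ≤
      ∑ z ∈ Z, ∫⁻ p, awayCount (B z) T (history σ f₀ p.1 p.2 T) ∂P := by
    have hV : ∀ z ∈ Z, AEMeasurable (fun p : ℝ × (ℕ → ℝ) =>
        awayCount (B z) T (history σ f₀ p.1 p.2 T)) P := fun z hz =>
      ((measurable_awayCount (hB z hz) T).comp (measurable_history σ h₀ T)).aemeasurable
    rw [← lintegral_finsetSum' _ hV]
    have : ∀ p : ℝ × (ℕ → ℝ), ((Z.card : ℝ≥0∞) - 1) * T ≤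
        ∑ z ∈ Z, awayCount (B z) T (history σ f₀ p.1 p.2 T) := by
      intro p
      simp only [awayCount]
      rw [Finset.sum_comm]
      have : ∀ i : Fin T, ((Z.card : ℝ≥0∞) - 1) ≤
          ∑ z ∈ Z, (B z)ᶜ.indicator 1 (history σ f₀ p.1 p.2 T i).1 := by
        intro i
        set x := (history σ f₀ p.1 p.2 T i).1
        have h1 : ∑ z ∈ Z, (B z)ᶜ.indicator (1 : Pt d → ℝ≥0∞) x =
            ((Z.filter fun z => x ∉ B z).card : ℝ≥0∞) := by
          rw [Finset.card_filter]
          push_cast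
          refine Finset.sum_congr rfl fun z _ => ?_
          by_cases hx : x ∈ B z <;> simp [hx]
        have h2 : (Z.filter fun z => x ∈ B z).card ≤ 1 := by
          rw [Finset.card_le_one]
          intro a ha b hb
          simp only [Finset.mem_filter] at ha hb
          exact hdisj x a ha.1 b hb.1 ha.2 hb.2
        have h3 := Finset.card_filter_add_card_filter_not (s := Z) (fun z => x ∈ B z)
        rw [h1, tsub_le_iff_right]
        exact_mod_cast (by omega)
      calc ((Z.card : ℝ≥0∞) - 1) * T = ∑ _i : Fin T, ((Z.card : ℝ≥0∞) - 1) := by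
            simp [mul_comm]
        _ ≤ _ := Finset.sum_le_sum fun i _ => this i
    calc ((Z.card : ℝ≥0∞) - 1) * T = ∫⁻ _p, ((Z.card : ℝ≥0∞) - 1) * T ∂P := by simp
      _ ≤ _ := lintegral_mono this
  -- the total information
  have hinfo : ∑ z ∈ Z, ∫⁻ p, ENNReal.ofReal (llQuad f₀ (F z) T (history σ f₀ p.1 p.2 T)) ∂P ≤
      ENNReal.ofReal (Γ ^ 2 * m * T) := by
    have hV : ∀ z ∈ Z, AEMeasurable (fun p : ℝ × (ℕ → ℝ) =>
        ENNReal.ofReal (llQuad f₀ (F z) T (history σ f₀ p.1 p.2 T))) P := fun z hz =>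
      (((measurable_llQuad h₀ (hF z hz) T).comp
        (measurable_history σ h₀ T)).ennreal_ofReal).aemeasurable
    rw [← lintegral_finsetSum' _ hV]
    have : ∀ p : ℝ × (ℕ → ℝ), ∑ z ∈ Z, ENNReal.ofReal
        (llQuad f₀ (F z) T (history σ f₀ p.1 p.2 T)) ≤ ENNReal.ofReal (Γ ^ 2 * m * T) := by
      intro p
      rw [← ENNReal.ofReal_sum_of_nonneg fun z _ => llQuad_nonneg _ _ _ _]
      refine ENNReal.ofReal_le_ofReal ?_
      simp only [llQuad]
      rw [Finset.sum_comm]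
      have : ∀ i : Fin T, ∑ z ∈ Z, (F z (history σ f₀ p.1 p.2 T i).1 -
          f₀ (history σ f₀ p.1 p.2 T i).1) ^ 2 ≤ Γ ^ 2 * m := by
        intro i
        have hxD : (history σ f₀ p.1 p.2 T i).1 ∈ domain S A := by
          rw [history_fst]; exact σ.query_mem _ _ _
        set x := (history σ f₀ p.1 p.2 T i).1
        have h1 : ∑ z ∈ Z, (F z x - f₀ x) ^ 2 =
            ∑ z ∈ Z.filter (fun z => x ∈ U z), (F z x - f₀ x) ^ 2 := by
          rw [Finset.sum_filter]
          refine Finset.sum_congr rfl fun z hz => ?_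
          by_cases hx : x ∈ U z
          · simp [hx]
          · simp [hx, hU z hz x hxD hx]
        have h2 := hmult x hxD (Z.filter fun z => x ∈ U z) (Finset.filter_subset _ _)
          (fun z hz => (Finset.mem_filter.1 hz).2)
        rw [h1]
        calc _ ≤ ∑ _z ∈ Z.filter (fun z => x ∈ U z), Γ ^ 2 := by
              refine Finset.sum_le_sum fun z hz => ?_
              exact sq_le_sq' (abs_le.1 (hΔ z (Finset.mem_filter.1 hz).1 x hxD)).1
                (abs_le.1 (hΔ z (Finset.mem_filter.1 hz).1 x hxD)).2
          _ = ((Z.filter fun z => x ∈ U z).card : ℝ) * Γ ^ 2 := by simp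
          _ ≤ Γ ^ 2 * m := by nlinarith [sq_nonneg Γ]
      calc _ ≤ ∑ _i : Fin T, Γ ^ 2 * m := Finset.sum_le_sum fun i _ => this i
        _ = Γ ^ 2 * m * T := by simp [mul_comm]
    calc _ ≤ ∫⁻ _p, ENNReal.ofReal (Γ ^ 2 * m * T) ∂P := lintegral_mono this
      _ = _ := by simp
  have hsum : ((Z.card : ℝ≥0∞) - 1) * T ≤ ENNReal.ofReal (Real.exp 1) *
      ∑ z ∈ Z, ∫⁻ p, awayCount (B z) T (history σ (F z) p.1 p.2 T) ∂P +
      T * (5 * ENNReal.ofReal (Γ ^ 2 * m * T)) := by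
    refine haway.trans ((Finset.sum_le_sum fun z hz =>
      lintegral_awayCount_le σ h₀ (hF z hz) (hB z hz) T).trans ?_)
    rw [Finset.sum_add_distrib, ← Finset.mul_sum, ← Finset.mul_sum, ← Finset.mul_sum]
    gcongr
  -- If every regret is too small, each ball is avoided at most `T / (8 * e)` times on average under
  -- its own `F z`. The cases `T = 0` and `h ≤ 0` make the claimed bound zero and contradict the
  -- strict inequality.
  by_contra! hcon
  rcases Nat.eq_zero_or_pos T with hT | hT
  · obtain ⟨z, hz⟩ : Z.Nonempty := Finset.card_pos.1 (by omega)
    have := hcon z hz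
    simp [hT] at this
  have hTr : (0 : ℝ) < T := by exact_mod_cast hT
  have he := Real.exp_pos 1
  have hh : 0 < h := by
    obtain ⟨z, hz⟩ : Z.Nonempty := Finset.card_pos.1 (by omega)
    by_contra hh
    have := hcon z hz
    rw [ENNReal.ofReal_of_nonpos (div_nonpos_of_nonpos_of_nonneg (not_lt.1 hh) (by positivity))]
      at this
    simp at this
  have hlt : ∀ z ∈ Z, ∫⁻ p, awayCount (B z) T (history σ (F z) p.1 p.2 T) ∂P ≤
      ENNReal.ofReal (T / (8 * Real.exp 1)) := by
    intro z hz
    have h1 := (hreg z hz).trans (hcon z hz).le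
    have h2 : ENNReal.ofReal (h / (8 * Real.exp 1)) * T =
        ENNReal.ofReal h * ENNReal.ofReal (T / (8 * Real.exp 1)) := by
      rw [← ENNReal.ofReal_natCast T, ← ENNReal.ofReal_mul (by positivity),
        ← ENNReal.ofReal_mul hh.le]
      congr 1
      ring
    rw [h2] at h1
    exact (ENNReal.mul_le_mul_iff_right (by simpa using hh) ENNReal.ofReal_ne_top).1 h1
  have hN : (2 : ℝ) ≤ Z.card := by exact_mod_cast hZ
  have h5 : (5 : ℝ≥0∞) = ENNReal.ofReal 5 := by simp
  -- The counts contribute `1/8` and, by `hsmall`, the information `1/4` of `Z.card * T`. The total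
  -- `3/8` is incompatible with `Z.card - 1 ≥ Z.card / 2`.
  have hsum' : ENNReal.ofReal (((Z.card : ℝ) - 1) * T) ≤ ENNReal.ofReal (Z.card * T * (3 / 8)) := by
    calc ENNReal.ofReal (((Z.card : ℝ) - 1) * T) = ((Z.card : ℝ≥0∞) - 1) * T := by
          rw [ENNReal.ofReal_mul (by linarith), ENNReal.ofReal_sub _ zero_le_one]
          simp
      _ ≤ _ := hsum
      _ ≤ ENNReal.ofReal (Real.exp 1) * ∑ _z ∈ Z, ENNReal.ofReal (T / (8 * Real.exp 1)) +
          T * (5 * ENNReal.ofReal (Γ ^ 2 * m * T)) := by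
          gcongr with z hz
          exact hlt z hz
      _ = ENNReal.ofReal (Real.exp 1 * (Z.card * (T / (8 * Real.exp 1))) +
          T * (5 * (Γ ^ 2 * m * T))) := by
          rw [ENNReal.ofReal_add (by positivity) (by positivity), ENNReal.ofReal_mul he.le,
            ENNReal.ofReal_mul (Nat.cast_nonneg Z.card), ENNReal.ofReal_mul hTr.le,
            ENNReal.ofReal_mul (p := 5) (by norm_num), ENNReal.ofReal_natCast,
            ENNReal.ofReal_natCast, ← h5]
          simp
      _ ≤ _ := by
          refine ENNReal.ofReal_le_ofReal ?_
          have : Real.exp 1 * (Z.card * (T / (8 * Real.exp 1))) = Z.card * T / 8 := by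
            field_simp
          rw [this]
          nlinarith
  rw [ENNReal.ofReal_le_ofReal_iff (by positivity)] at hsum'
  nlinarith

/-! ### Cubes and means over cubes -/

lemma mem_cube {x u : Pt d} {a : ℝ} : u ∈ cube x a ↔ dist u x ≤ a / 2 := Metric.mem_closedBall

lemma self_mem_cube (x : Pt d) {a : ℝ} (ha : 0 ≤ a) : x ∈ cube x a :=
  Metric.mem_closedBall_self (by linarith)

lemma measurableSet_cube (x : Pt d) (a : ℝ) : MeasurableSet (cube x a) :=
  Metric.isClosed_closedBall.measurableSet

lemma volume_cube (x : Pt d) {a : ℝ} (ha : 0 ≤ a) :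
    volume (cube x a) = ENNReal.ofReal (a ^ d) := by
  rw [cube, Real.volume_pi_closedBall _ (by linarith)]
  simp [mul_div_cancel₀]

lemma volume_real_cube (x : Pt d) {a : ℝ} (ha : 0 ≤ a) : volume.real (cube x a) = a ^ d := by
  rw [Measure.real, volume_cube x ha, ENNReal.toReal_ofReal (by positivity)]

lemma volume_cube_ne_top (x : Pt d) (a : ℝ) : volume (cube x a) ≠ ⊤ :=
  (isCompact_closedBall x (a / 2)).measure_ne_top

lemma volume_cube_ne_zero (x : Pt d) {a : ℝ} (ha : 0 < a) : volume (cube x a) ≠ 0 := by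
  rw [volume_cube x ha.le]
  simpa using pow_pos ha d

lemma avg_eq (g : Pt d → ℝ) (x : Pt d) {a : ℝ} (ha : 0 ≤ a) :
    ⨍ u in cube x a, g u = (a ^ d)⁻¹ * ∫ u in cube x a, g u := by
  rw [setAverage_eq, volume_real_cube x ha, smul_eq_mul]

lemma avg_const (x : Pt d) {a : ℝ} (ha : 0 < a) (c : ℝ) : ⨍ _u in cube x a, c = c :=
  setAverage_const (volume_cube_ne_zero x ha) (volume_cube_ne_top x a) c

lemma avg_add {g h : Pt d → ℝ} {x : Pt d} {a : ℝ} (hg : IntegrableOn g (cube x a))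
    (hh : IntegrableOn h (cube x a)) :
    ⨍ u in cube x a, (g u + h u) = (⨍ u in cube x a, g u) + ⨍ u in cube x a, h u := by
  rw [setAverage_eq, setAverage_eq, setAverage_eq, integral_add hg hh, smul_add]

lemma avg_sub {g h : Pt d → ℝ} {x : Pt d} {a : ℝ} (hg : IntegrableOn g (cube x a))
    (hh : IntegrableOn h (cube x a)) :
    ⨍ u in cube x a, (g u - h u) = (⨍ u in cube x a, g u) - ⨍ u in cube x a, h u := by
  rw [setAverage_eq, setAverage_eq, setAverage_eq, integral_sub hg hh, smul_sub]

lemma avg_const_mul (g : Pt d → ℝ) (x : Pt d) (a c : ℝ) :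
    ⨍ u in cube x a, c * g u = c * ⨍ u in cube x a, g u := by
  rw [setAverage_eq, setAverage_eq, integral_const_mul, smul_eq_mul, smul_eq_mul, mul_left_comm]

lemma avg_congr {g h : Pt d → ℝ} {x : Pt d} {a : ℝ} (hgh : ∀ u ∈ cube x a, g u = h u) :
    ⨍ u in cube x a, g u = ⨍ u in cube x a, h u := by
  rw [setAverage_eq, setAverage_eq, setIntegral_congr_fun (measurableSet_cube x a) hgh]

lemma abs_avg_le {g : Pt d → ℝ} {x : Pt d} {a B : ℝ} (ha : 0 < a)
    (hB : ∀ u ∈ cube x a, |g u| ≤ B) : |⨍ u in cube x a, g u| ≤ B := by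
  have h : ‖∫ u in cube x a, g u‖ ≤ B * volume.real (cube x a) :=
    norm_setIntegral_le_of_norm_le_const (volume_cube_ne_top x a).lt_top hB
  rw [volume_real_cube x ha.le, Real.norm_eq_abs] at h
  have : (0 : ℝ) < a ^ d := by positivity
  rw [avg_eq g x ha.le, abs_mul, abs_of_pos (inv_pos.2 this), inv_mul_le_iff₀ this]
  linarith

lemma integrableOn_cube_of_bounded {g : Pt d → ℝ} (hg : Measurable g) {x : Pt d} {a B : ℝ}
    (hB : ∀ u ∈ cube x a, |g u| ≤ B) : IntegrableOn g (cube x a) :=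
  Measure.integrableOn_of_bounded (volume_cube_ne_top x a) hg.aestronglyMeasurable
    (M := B) ((ae_restrict_iff' (measurableSet_cube x a)).2 (ae_of_all _ hB))

lemma setIntegral_cube_shift (g : Pt d → ℝ) (x : Pt d) (a : ℝ) :
    ∫ u in cube x a, g u = ∫ v in cube 0 a, g (x + v) := by
  have h := (measurePreserving_add_left (volume : Measure (Pt d)) x).setIntegral_preimage_emb
    (MeasurableEquiv.addLeft x).measurableEmbedding g (cube x a)
  rw [← h]
  congr 2
  ext v
  simp [cube]

/-- Moving the domain to a fixed cube exhibits the mean as a convolution, which gives measurability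
in the centre and access to Fubini. -/
lemma avg_shift (g : Pt d → ℝ) (x : Pt d) {a : ℝ} (ha : 0 ≤ a) :
    ⨍ u in cube x a, g u = (a ^ d)⁻¹ * ∫ v in cube 0 a, g (x + v) := by
  rw [avg_eq g x ha, setIntegral_cube_shift]

lemma measurable_avg {g : Pt d → ℝ} (hg : Measurable g) {a : ℝ} (ha : 0 ≤ a) :
    Measurable fun x => ⨍ u in cube x a, g u := by
  simp_rw [fun x => avg_shift g x ha]
  refine Measurable.const_mul ?_ _
  have : Measurable fun p : Pt d × Pt d => g (p.1 + p.2) := by fun_prop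
  exact (this.stronglyMeasurable.integral_prod_right
    (ν := (volume : Measure (Pt d)).restrict (cube 0 a))).measurable

/-- Averaging operators are convolutions and therefore commute. This drives the decomposition over
scales in `oscillation_le`. -/
lemma avg_comm {g : Pt d → ℝ} (hg : Measurable g) {B : ℝ} (hB : ∀ u, |g u| ≤ B) (x : Pt d)
    {b c : ℝ} (hb : 0 < b) (hc : 0 < c) :
    ⨍ y in cube x b, (⨍ u in cube y c, g u) = ⨍ y in cube x c, (⨍ u in cube y b, g u) := by
  rw [avg_shift _ x hb.le, avg_shift _ x hc.le]
  simp_rw [fun y => avg_shift g y hb.le, fun y => avg_shift g y hc.le]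
  rw [integral_const_mul, integral_const_mul, integral_integral_swap]
  · rw [mul_left_comm]
    simp_rw [add_right_comm]
  · have hfin : ∀ a : ℝ, IsFiniteMeasure ((volume : Measure (Pt d)).restrict (cube 0 a)) :=
      fun a => ⟨by simpa using (volume_cube_ne_top (0 : Pt d) a).lt_top⟩
    have := hfin b
    have := hfin c
    have hm : Measurable (Function.uncurry fun v w : Pt d => g (x + v + w)) := by
      unfold Function.uncurry
      fun_prop
    exact Integrable.of_bound hm.aestronglyMeasurable B (ae_of_all _ fun p => hB _)

/-- Means over cubes vary slowly with the centre. -/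
lemma abs_avg_sub_avg_le {h : Pt d → ℝ} (hm : Measurable h) {B b : ℝ} {x y : Pt d} (hb : 0 < b)
    (hxy : dist x y ≤ b) (hx : ∀ u ∈ cube x b, |h u| ≤ B) (hy : ∀ u ∈ cube y b, |h u| ≤ B) :
    |(⨍ u in cube x b, h u) - ⨍ u in cube y b, h u| ≤ 2 * d * (dist x y / b) * B := by
  set v := dist x y with hv
  have hv0 : 0 ≤ v := dist_nonneg
  have hB : 0 ≤ B := (abs_nonneg _).trans (hx x (self_mem_cube x hb.le))
  have hbd : (0 : ℝ) < b ^ d := by positivity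
  have hix := integrableOn_cube_of_bounded hm hx
  have hiy := integrableOn_cube_of_bounded hm hy
  -- Both cubes contain a cube of side `b - v` around the midpoint, so by Bernoulli's inequality
  -- each loses at most the fraction `d * v / b` of its volume outside the other.
  have hsub : cube (midpoint ℝ x y) (b - v) ⊆ cube x b ∩ cube y b := by
    intro u hu
    rw [mem_cube] at hu
    have h1 : dist (midpoint ℝ x y) x = v / 2 := by
      rw [dist_midpoint_left]; simp; ring
    have h2 : dist (midpoint ℝ x y) y = v / 2 := by
      rw [dist_midpoint_right]; simp; ring
    constructor
    · rw [mem_cube]; linarith [dist_triangle u (midpoint ℝ x y) x]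
    · rw [mem_cube]; linarith [dist_triangle u (midpoint ℝ x y) y]
  have hinter : b ^ d - d * (v / b) * b ^ d ≤ volume.real (cube x b ∩ cube y b) := by
    have h1 : (b - v) ^ d ≤ volume.real (cube x b ∩ cube y b) := by
      rw [← volume_real_cube (midpoint ℝ x y) (by linarith : 0 ≤ b - v)]
      exact measureReal_mono hsub
        (measure_ne_top_of_subset inter_subset_left (volume_cube_ne_top x b))
    have h2 : 1 + (d : ℝ) * (-(v / b)) ≤ (1 + -(v / b)) ^ d := by
      refine one_add_mul_le_pow ?_ d
      have : v / b ≤ 1 := (div_le_one hb).2 hxy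
      linarith
    have h3 : (b - v) ^ d = (1 + -(v / b)) ^ d * b ^ d := by
      rw [← mul_pow]; congr 1; field_simp; ring
    nlinarith
  have hd : ∀ p q : Pt d, volume.real (cube p b ∩ cube q b) = volume.real (cube x b ∩ cube y b) →
      volume.real (cube p b \ cube q b) ≤ d * (v / b) * b ^ d := by
    intro p q hpq
    have := measureReal_inter_add_sdiff (μ := volume) (s := cube p b) (measurableSet_cube q b)
      (volume_cube_ne_top p b)
    rw [volume_real_cube p hb.le, hpq] at this
    linarith
  have hdx := hd x y rfl
  have hdy := hd y x (by rw [inter_comm])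
  have e1 := integral_inter_add_sdiff (measurableSet_cube y b) hix
  have e2 := integral_inter_add_sdiff (measurableSet_cube x b) hiy
  rw [inter_comm] at e2
  have n1 : ‖∫ u in cube x b \ cube y b, h u‖ ≤ B * volume.real (cube x b \ cube y b) :=
    norm_setIntegral_le_of_norm_le_const
      ((measure_ne_top_of_subset sdiff_subset (volume_cube_ne_top x b)).lt_top) fun u hu => hx u hu.1
  have n2 : ‖∫ u in cube y b \ cube x b, h u‖ ≤ B * volume.real (cube y b \ cube x b) :=
    norm_setIntegral_le_of_norm_le_const
      ((measure_ne_top_of_subset sdiff_subset (volume_cube_ne_top y b)).lt_top) fun u hu => hy u hu.1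
  rw [avg_eq h x hb.le, avg_eq h y hb.le, ← mul_sub, abs_mul, abs_of_pos (inv_pos.2 hbd),
    inv_mul_le_iff₀ hbd, ← e1, ← e2, add_sub_add_left_eq_sub]
  calc _ ≤ B * volume.real (cube x b \ cube y b) + B * volume.real (cube y b \ cube x b) :=
        (abs_sub _ _).trans (add_le_add n1 n2)
    _ ≤ B * (d * (v / b) * b ^ d) + B * (d * (v / b) * b ^ d) := by gcongr
    _ = _ := by ring

/-- A second-order gain `(a / s) ^ 2` at scale `s` is worth a bound of order `a ^ α` precisely
because `α ≤ 2`. -/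
lemma sq_mul_rpow_le {a s α : ℝ} (ha : 0 < a) (has : a ≤ s) (hα2 : α ≤ 2) :
    (a / s) ^ 2 * s ^ α ≤ a ^ α := by
  have hs : 0 < s := ha.trans_le has
  have h1 : (a / s) ^ (2 : ℝ) ≤ (a / s) ^ α :=
    Real.rpow_le_rpow_of_exponent_ge (by positivity) ((div_le_one hs).2 has) hα2
  rw [Real.rpow_two] at h1
  calc (a / s) ^ 2 * s ^ α ≤ (a / s) ^ α * s ^ α := by gcongr
    _ = a ^ α := by
      rw [← Real.mul_rpow (by positivity) hs.le, div_mul_cancel₀ _ hs.ne']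

/-- A function whose means are `α`-close to its values oscillates little: the bound loses a factor
`s / a`, but holds up to `α = 2`. -/
lemma oscillation_le {g : Pt d → ℝ} (hg : Measurable g) {z : Pt d} {s G α : ℝ} (hs : 0 < s)
    (hG : 0 ≤ G) (hα2 : α ≤ 2) (hbd : ∀ u, |g u| ≤ G * s ^ α)
    (hmean : ∀ y ∈ Metric.closedBall z (5 * s), ∀ a, 0 < a → a ≤ s →
      |(⨍ u in cube y a, g u) - g y| ≤ G * a ^ α)
    {x u : Pt d} {a : ℝ} (ha : 0 < a) (has : a ≤ s) (hx : x ∈ Metric.closedBall z (4 * s))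
    (hu : u ∈ Metric.closedBall z (4 * s)) (hux : dist u x ≤ a) :
    |g u - g x| * (a / s) ≤ (2 + 13 * d) * G * a ^ α := by
  rw [Metric.mem_closedBall] at hx hu
  set v := dist u x with hv
  have hv0 : 0 ≤ v := dist_nonneg
  have hP : ∀ b, 0 < b → Measurable fun y => ⨍ w in cube y b, g w :=
    fun b hb => measurable_avg hg hb.le
  have hPb : ∀ b, 0 < b → ∀ y, |⨍ w in cube y b, g w| ≤ G * s ^ α :=
    fun b hb y => abs_avg_le hb fun w _ => hbd w
  -- Passing from means at scale `b` to means at scale `2 * b` costs only means of functions of size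
  -- `b ^ α`, and these are Lipschitz in the centre with constant of order `b ^ α / b`.
  have step : ∀ b, 0 < b → 2 * b ≤ s → v ≤ b →
      |(⨍ w in cube u b, g w) - ⨍ w in cube x b, g w| ≤
        |(⨍ w in cube u (2 * b), g w) - ⨍ w in cube x (2 * b), g w| +
          9 * d * G * v * (b ^ α / b) := by
    intro b hb hbs hvb
    -- With `P b` the averaging operator, this reads `P b g = P b (g - P (2b) g) + P (2b) (P b g -
    -- g) + P (2b) g`, which holds since `P b` and `P (2b)` commute.
    have hdec : ∀ y, ⨍ w in cube y b, g w = (⨍ w in cube y b, (g w - ⨍ p in cube w (2 * b), g p)) +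
        (⨍ w in cube y (2 * b), ((⨍ p in cube w b, g p) - g w)) + ⨍ w in cube y (2 * b), g w := by
      intro y
      have hgi : ∀ c, IntegrableOn g (cube y c) :=
        fun c => integrableOn_cube_of_bounded hg fun w _ => hbd w
      have hPi : ∀ b', 0 < b' → ∀ c, IntegrableOn (fun w => ⨍ p in cube w b', g p) (cube y c) :=
        fun b' hb' c => integrableOn_cube_of_bounded (hP b' hb') fun w _ => hPb b' hb' w
      rw [avg_sub (hgi _) (hPi _ (by linarith) _), avg_sub (hPi _ hb _) (hgi _),
        avg_comm hg hbd y hb (by linarith : 0 < 2 * b)]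
      ring
    have h2b : (2 * b) ^ α ≤ 4 * b ^ α := by
      rw [Real.mul_rpow (by norm_num) hb.le]
      have : (2 : ℝ) ^ α ≤ 2 ^ (2 : ℝ) := Real.rpow_le_rpow_of_exponent_le (by norm_num) hα2
      have h4 : (2 : ℝ) ^ (2 : ℝ) = 4 := by norm_num
      have := Real.rpow_nonneg hb.le α
      nlinarith
    have hnear : ∀ y, dist y z ≤ 4 * s → ∀ w ∈ cube y b,
        |g w - ⨍ p in cube w (2 * b), g p| ≤ G * (4 * b ^ α) := by
      intro y hy w hw
      rw [mem_cube] at hw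
      rw [abs_sub_comm]
      refine (hmean w ?_ (2 * b) (by linarith) hbs).trans (by gcongr)
      rw [Metric.mem_closedBall]
      linarith [dist_triangle w y z]
    have hnear' : ∀ y, dist y z ≤ 4 * s → ∀ w ∈ cube y (2 * b),
        |(⨍ p in cube w b, g p) - g w| ≤ G * b ^ α := by
      intro y hy w hw
      rw [mem_cube] at hw
      refine hmean w ?_ b hb (by linarith)
      rw [Metric.mem_closedBall]
      linarith [dist_triangle w y z]
    have l1 := abs_avg_sub_avg_le (hg.sub (hP (2 * b) (by linarith))) hb hvb (hnear u hu)
      (hnear x hx)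
    have l2 := abs_avg_sub_avg_le ((hP b hb).sub hg) (by linarith : 0 < 2 * b)
      (by linarith : dist u x ≤ 2 * b) (hnear' u hu) (hnear' x hx)
    simp only [Pi.sub_apply] at l1 l2
    rw [hdec u, hdec x, add_sub_add_comm, add_sub_add_comm]
    refine (abs_add_le _ _).trans ?_
    refine (add_le_add_left (abs_add_le _ _) _).trans ?_
    have : 2 * (d : ℝ) * (dist u x / b) * (G * (4 * b ^ α)) +
        2 * d * (dist u x / (2 * b)) * (G * b ^ α) = 9 * d * G * v * (b ^ α / b) := by
      rw [← hv]; field_simp; ring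
    linarith
  have iter : ∀ k : ℕ, 2 ^ k * a ≤ s →
      |(⨍ w in cube u a, g w) - ⨍ w in cube x a, g w| ≤
        |(⨍ w in cube u (2 ^ k * a), g w) - ⨍ w in cube x (2 ^ k * a), g w| +
          9 * d * G * v * (2 ^ k * (a ^ α / a)) := by
    intro k
    induction k with
    | zero =>
      intro _
      have : 0 ≤ 9 * d * G * v * (2 ^ 0 * (a ^ α / a)) := by positivity
      simpa using this
    | succ k ih =>
      intro hk
      have h2k : (1 : ℝ) ≤ 2 ^ k := one_le_pow₀ (by norm_num)
      have hpos : 0 < 2 ^ k * a := by positivity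
      have e : (2 : ℝ) ^ (k + 1) * a = 2 * (2 ^ k * a) := by ring
      rw [e] at hk ⊢
      have h1 := ih (by linarith)
      have h2 := step (2 ^ k * a) hpos hk (by nlinarith)
      -- By `α ≤ 2` the costs grow at most like `2 ^ k`, so the sum over the doublings is controlled
      -- by the last scale, about `s / a`. This is the loss in the statement.
      have h3 : (2 ^ k * a) ^ α / (2 ^ k * a) ≤ 2 ^ k * (a ^ α / a) := by
        rw [Real.mul_rpow (by positivity) ha.le]
        have : ((2 : ℝ) ^ k) ^ α ≤ (2 ^ k) ^ (2 : ℝ) :=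
          Real.rpow_le_rpow_of_exponent_le h2k hα2
        rw [Real.rpow_two] at this
        calc ((2 : ℝ) ^ k) ^ α * a ^ α / (2 ^ k * a) ≤ (2 ^ k) ^ 2 * a ^ α / (2 ^ k * a) := by
              gcongr
          _ = _ := by field_simp
      have h4 : 9 * d * G * v * ((2 ^ k * a) ^ α / (2 ^ k * a)) ≤
          9 * d * G * v * (2 ^ k * (a ^ α / a)) := by gcongr
      have h5 : 9 * d * G * v * (2 ^ (k + 1) * (a ^ α / a)) =
          9 * d * G * v * (2 ^ k * (a ^ α / a)) + 9 * d * G * v * (2 ^ k * (a ^ α / a)) := by ring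
      linarith
  -- The doubling stops at a scale in `(s / 2, s]`, where the sup bound `G * s ^ α` takes over.
  obtain ⟨k, hk1, hk2⟩ := exists_nat_pow_near ((one_le_div ha).2 has) (by norm_num : (1 : ℝ) < 2)
  rw [le_div_iff₀ ha] at hk1
  rw [div_lt_iff₀ ha] at hk2
  have h2k : (1 : ℝ) ≤ 2 ^ k := one_le_pow₀ (by norm_num)
  have htop := abs_avg_sub_avg_le hg (by positivity : 0 < 2 ^ k * a)
    (by nlinarith : dist u x ≤ 2 ^ k * a) (fun w _ => hbd w) (fun w _ => hbd w)
  have hit := iter k hk1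
  have m1 := hmean x (Metric.mem_closedBall.2 (by linarith)) a ha has
  have m2 := hmean u (Metric.mem_closedBall.2 (by linarith)) a ha has
  have t1 : 2 * d * (dist u x / (2 ^ k * a)) * (G * s ^ α) ≤ 4 * d * G * ((a / s) * s ^ α) := by
    have : dist u x / (2 ^ k * a) ≤ 2 * (a / s) := by
      rw [div_le_iff₀ (by positivity)]
      have : 2 * (a / s) * (2 ^ k * a) = a * (2 ^ (k + 1) * a / s) := by ring
      rw [this]
      have : 1 ≤ 2 ^ (k + 1) * a / s := (one_le_div hs).2 hk2.le
      nlinarith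
    have h0 : 0 ≤ G * s ^ α := by positivity
    calc _ ≤ 2 * d * (2 * (a / s)) * (G * s ^ α) := by gcongr
      _ = _ := by ring
  have t2 : 9 * d * G * v * (2 ^ k * (a ^ α / a)) ≤ 9 * d * G * ((s / a) * a ^ α) := by
    have h1 : (2 : ℝ) ^ k ≤ s / a := by rwa [le_div_iff₀ ha]
    calc 9 * d * G * v * (2 ^ k * (a ^ α / a)) ≤ 9 * d * G * a * (s / a * (a ^ α / a)) := by
          gcongr
      _ = _ := by field_simp
  have hfin : |g u - g x| ≤ 2 * (G * a ^ α) + 4 * d * G * ((a / s) * s ^ α) +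
      9 * d * G * ((s / a) * a ^ α) := by
    rw [abs_le] at m1 m2 ⊢
    have hit' := abs_le.1 (hit.trans (add_le_add_left (htop.trans t1) _))
    constructor <;> linarith [hit'.1, hit'.2, m1.1, m1.2, m2.1, m2.2]
  have q1 := sq_mul_rpow_le ha has hα2
  have q2 : a / s ≤ 1 := (div_le_one hs).2 has
  have q0 : 0 < a / s := by positivity
  have haα : 0 ≤ a ^ α := Real.rpow_nonneg ha.le α
  calc |g u - g x| * (a / s) ≤ (2 * (G * a ^ α) + 4 * d * G * ((a / s) * s ^ α) +
      9 * d * G * ((s / a) * a ^ α)) * (a / s) := by gcongr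
    _ = 2 * (G * a ^ α) * (a / s) + 4 * d * G * ((a / s) ^ 2 * s ^ α) + 9 * d * G * a ^ α := by
        field_simp
    _ ≤ 2 * (G * a ^ α) * 1 + 4 * d * G * a ^ α + 9 * d * G * a ^ α := by gcongr
    _ = _ := by ring

/-! ### Growth near almost-minimisers -/

lemma MeanClose.sub_const {f : Pt d → ℝ} {K α : ℝ} {x : Pt d} {a : ℝ} (ha : 0 < a)
    (h : MeanClose f K α x a) (c : ℝ) : MeanClose (fun u => f u - c) K α x a := by
  have hc : IntegrableOn (fun _ : Pt d => c) (cube x a) :=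
    integrableOn_const (volume_cube_ne_top x a)
  refine ⟨h.1.sub hc, ?_⟩
  rw [avg_sub h.1 hc, avg_const x ha]
  convert h.2 using 2
  ring

lemma avg_le_of_cube_subset {g : Pt d → ℝ} {x z : Pt d} {a b : ℝ} (ha : 0 < a) (hb : 0 < b)
    (hg : IntegrableOn g (cube z b)) (hg0 : ∀ u ∈ cube z b, 0 ≤ g u)
    (hsub : cube x a ⊆ cube z b) :
    ⨍ u in cube x a, g u ≤ (b / a) ^ d * ⨍ u in cube z b, g u := by
  have h := setIntegral_mono_set hg
    ((ae_restrict_iff' (measurableSet_cube z b)).2 (ae_of_all _ hg0)) hsub.eventuallyLE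
  rw [avg_eq g x ha.le, avg_eq g z hb.le, div_pow, ← mul_assoc]
  have : b ^ d / a ^ d * (b ^ d)⁻¹ = (a ^ d)⁻¹ := by
    have := pow_pos hb d
    field_simp
  rw [this]
  have := pow_pos ha d
  gcongr

/-- A Harnack-type comparison: for nonnegative `g`, the mean over a smaller cube is at most the
volume ratio times the mean over a cube containing it. It turns closeness to the minimum at one
point into an upper bound at nearby points. -/
lemma le_of_meanClose {g : Pt d → ℝ} {x z : Pt d} {a b K K' α : ℝ} (ha : 0 < a) (hb : 0 < b)
    (hg0 : ∀ u ∈ cube z b, 0 ≤ g u) (hsub : cube x a ⊆ cube z b)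
    (hx : MeanClose g K α x a) (hz : MeanClose g K' α z b) :
    g x ≤ K * a ^ α + (b / a) ^ d * (g z + K' * b ^ α) := by
  have h1 := avg_le_of_cube_subset ha hb hz.1 hg0 hsub
  have h2 := (abs_le.1 hx.2).1
  have h3 := (abs_le.1 hz.2).2
  have h4 : (b / a) ^ d * ⨍ u in cube z b, g u ≤ (b / a) ^ d * (g z + K' * b ^ α) := by
    gcongr
    linarith
  linarith

/-! ### Symmetric second differences -/

/-- A cube is symmetric about its centre, so first-order terms cancel in the mean and only symmetric
second differences count. -/
lemma abs_avg_sub_le_of_symm {φ : Pt d → ℝ} {x : Pt d} {a E : ℝ} (ha : 0 < a)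
    (hφ : IntegrableOn φ (cube x a))
    (hE : ∀ v, ‖v‖ ≤ a / 2 → |φ (x + v) + φ (x - v) - 2 * φ x| ≤ E) :
    |(⨍ u in cube x a, φ u) - φ x| ≤ E / 2 := by
  have hmem : ∀ v : Pt d, v ∈ cube 0 a ↔ ‖v‖ ≤ a / 2 := fun v => by rw [mem_cube, dist_zero_right]
  have hadd : IntegrableOn (fun v => φ (x + v)) (cube 0 a) := by
    have := (measurePreserving_add_left (volume : Measure (Pt d)) x).integrableOn_comp_preimage
      (MeasurableEquiv.addLeft x).measurableEmbedding (f := φ) (s := cube x a)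
    have hpre : (fun v => x + v) ⁻¹' cube x a = cube 0 a := by ext v; simp [cube]
    rw [hpre] at this
    exact this.2 hφ
  have hpre : (fun v : Pt d => -v) ⁻¹' cube 0 a = cube 0 a := by ext v; simp [cube]
  have hneg : IntegrableOn (fun v => φ (x - v)) (cube 0 a) := by
    have := (Measure.measurePreserving_neg (volume : Measure (Pt d))).integrableOn_comp_preimage
      (MeasurableEquiv.neg (Pt d)).measurableEmbedding (f := fun v => φ (x + v)) (s := cube 0 a)
    rw [hpre] at this
    simpa [Function.comp_def, sub_eq_add_neg] using this.2 hadd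
  have e1 : ⨍ u in cube x a, φ u = ⨍ v in cube (0 : Pt d) a, φ (x + v) := by
    rw [avg_shift φ x ha.le, avg_eq _ 0 ha.le]
  have e2 : ⨍ u in cube x a, φ u = ⨍ v in cube (0 : Pt d) a, φ (x - v) := by
    rw [e1, avg_eq _ 0 ha.le, avg_eq _ 0 ha.le]
    congr 1
    have := (Measure.measurePreserving_neg (volume : Measure (Pt d))).setIntegral_preimage_emb
      (MeasurableEquiv.neg (Pt d)).measurableEmbedding (fun v => φ (x + v)) (cube 0 a)
    rw [hpre] at this
    rw [← this]
    simp [sub_eq_add_neg]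
  have hc : IntegrableOn (fun _ : Pt d => 2 * φ x) (cube 0 a) :=
    integrableOn_const (volume_cube_ne_top 0 a)
  have e3 : 2 * ((⨍ u in cube x a, φ u) - φ x) =
      ⨍ v in cube (0 : Pt d) a, (φ (x + v) + φ (x - v) - 2 * φ x) := by
    rw [avg_sub (g := fun v => φ (x + v) + φ (x - v)) (hadd.add hneg) hc, avg_add hadd hneg,
      avg_const 0 ha, ← e1, ← e2]
    ring
  have h := abs_avg_le (g := fun v => φ (x + v) + φ (x - v) - 2 * φ x) ha
    fun v hv => hE v ((hmem v).1 hv)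
  rw [← e3, abs_mul, abs_two] at h
  linarith

/-- Above: the squares of `t ± v` average to `t ^ 2 + v ^ 2`, and the power `α / 2` is concave and
subadditive. Below: subadditivity for `α ≤ 1`, and convexity, which even gives nonnegativity, for `α
≥ 1`. -/
lemma abs_rpow_symm_le {α : ℝ} (hα : 0 < α) (hα2 : α ≤ 2) (t v : ℝ) :
    |(|t + v| ^ α + |t - v| ^ α - 2 * |t| ^ α)| ≤ 2 * |v| ^ α := by
  have hv := Real.rpow_nonneg (abs_nonneg v) α
  rw [abs_le]
  constructor
  · rcases le_total α 1 with h1 | h1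
    · have k : ∀ a b : ℝ, |a + b| ^ α ≤ |a| ^ α + |b| ^ α := fun a b =>
        (Real.rpow_le_rpow (abs_nonneg _) (abs_add_le a b) hα.le).trans
          (Real.rpow_add_le_add_rpow (abs_nonneg _) (abs_nonneg _) hα.le h1)
      have k1 := k (t + v) (-v)
      have k2 := k (t - v) v
      rw [abs_neg, add_neg_cancel_right] at k1
      rw [sub_add_cancel] at k2
      linarith
    · have hc := (convexOn_rpow h1).2 (abs_nonneg (t + v)) (abs_nonneg (t - v))
        (by norm_num : (0 : ℝ) ≤ 1 / 2) (by norm_num : (0 : ℝ) ≤ 1 / 2) (by norm_num)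
      simp only [smul_eq_mul] at hc
      have : |t| ≤ 1 / 2 * |t + v| + 1 / 2 * |t - v| := by
        have := abs_add_le (t + v) (t - v)
        rw [show t + v + (t - v) = 2 * t by ring, abs_mul, abs_two] at this
        linarith
      have := Real.rpow_le_rpow (abs_nonneg _) this hα.le
      linarith
  · have hp : ∀ a : ℝ, |a| ^ α = (a ^ 2) ^ (α / 2) := fun a => by
      rw [← sq_abs, ← Real.rpow_natCast_mul (abs_nonneg a)]
      congr 1
      push_cast
      ring
    have hc := (Real.concaveOn_rpow (by linarith : 0 ≤ α / 2) (by linarith : α / 2 ≤ 1)).2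
      (sq_nonneg (t + v)) (sq_nonneg (t - v))
      (by norm_num : (0 : ℝ) ≤ 1 / 2) (by norm_num : (0 : ℝ) ≤ 1 / 2) (by norm_num)
    simp only [smul_eq_mul] at hc
    have h2 := Real.rpow_add_le_add_rpow (sq_nonneg t) (sq_nonneg v)
      (by linarith : 0 ≤ α / 2) (by linarith : α / 2 ≤ 1)
    rw [show 1 / 2 * (t + v) ^ 2 + 1 / 2 * (t - v) ^ 2 = t ^ 2 + v ^ 2 by ring] at hc
    rw [hp, hp, hp, hp]
    linarith

/-- The cusp `∑ |xᵢ - zᵢ| ^ α`. -/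
def cusp (α : ℝ) (z x : Pt d) : ℝ := ∑ i, |x i - z i| ^ α

lemma measurable_cusp (α : ℝ) (z : Pt d) : Measurable (cusp α z) := by
  unfold cusp
  fun_prop

lemma cusp_nonneg (α : ℝ) (z x : Pt d) : 0 ≤ cusp α z x :=
  Finset.sum_nonneg fun _ _ => Real.rpow_nonneg (abs_nonneg _) _

lemma cusp_self {α : ℝ} (hα : 0 < α) (z : Pt d) : cusp α z z = 0 := by
  simp [cusp, Real.zero_rpow hα.ne']

lemma cusp_le {α : ℝ} (hα : 0 < α) {z x : Pt d} {ρ : ℝ} (h : dist x z ≤ ρ) :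
    cusp α z x ≤ d * ρ ^ α := by
  calc cusp α z x ≤ ∑ _i : Fin d, ρ ^ α := by
        refine Finset.sum_le_sum fun i _ => Real.rpow_le_rpow (abs_nonneg _) ?_ hα.le
        rw [← Real.dist_eq]
        exact (dist_le_pi_dist x z i).trans h
    _ = _ := by simp

/-- This is what confines the low sublevel sets of a dip to small balls. -/
lemma dist_le_of_cusp_le {α : ℝ} (hα : 0 < α) {z x : Pt d} {ρ : ℝ}
    (h : cusp α z x ≤ ρ) : dist x z ≤ ρ ^ (1 / α) := by
  have hρ : 0 ≤ ρ := (cusp_nonneg _ _ _).trans h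
  rw [dist_pi_le_iff (Real.rpow_nonneg hρ _)]
  intro i
  have h1 : |x i - z i| ^ α ≤ ρ := (Finset.single_le_sum (f := fun i => |x i - z i| ^ α)
    (fun _ _ => Real.rpow_nonneg (abs_nonneg _) _) (Finset.mem_univ i)).trans h
  have h2 := Real.rpow_le_rpow (Real.rpow_nonneg (abs_nonneg _) _) h1
    (by positivity : 0 ≤ 1 / α)
  rwa [← Real.rpow_mul (abs_nonneg _), mul_one_div_cancel hα.ne', Real.rpow_one,
    ← Real.dist_eq] at h2

lemma abs_avg_cusp_sub_le {α : ℝ} (hα : 0 < α) (hα2 : α ≤ 2) (z x : Pt d) {a : ℝ} (ha : 0 < a) :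
    |(⨍ u in cube x a, cusp α z u) - cusp α z x| ≤ d * a ^ α := by
  have hint : IntegrableOn (cusp α z) (cube x a) := by
    refine integrableOn_cube_of_bounded (measurable_cusp α z)
      (B := d * (a / 2 + dist x z) ^ α) fun u hu => ?_
    rw [abs_of_nonneg (cusp_nonneg _ _ _)]
    refine cusp_le hα ?_
    linarith [dist_triangle u x z, mem_cube.1 hu]
  have h := abs_avg_sub_le_of_symm (E := d * (2 * a ^ α)) ha hint ?_
  · linarith
  intro v hv
  have e : cusp α z (x + v) + cusp α z (x - v) - 2 * cusp α z x =
      ∑ i, (|x i - z i + v i| ^ α + |x i - z i - v i| ^ α - 2 * |x i - z i| ^ α) := by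
    simp only [cusp, Finset.mul_sum, ← Finset.sum_add_distrib, ← Finset.sum_sub_distrib]
    refine Finset.sum_congr rfl fun i _ => ?_
    simp only [Pi.add_apply, Pi.sub_apply]
    rw [add_sub_right_comm (x i), sub_right_comm (x i)]
  rw [e]
  refine (Finset.abs_sum_le_sum_abs _ _).trans ?_
  calc _ ≤ ∑ _i : Fin d, 2 * a ^ α := by
        refine Finset.sum_le_sum fun i _ => (abs_rpow_symm_le hα hα2 _ _).trans ?_
        have : |v i| ≤ a := by
          have := norm_le_pi_norm v i
          rw [Real.norm_eq_abs] at this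
          linarith
        gcongr
    _ = _ := by simp

/-! ### Cutoff functions -/

/-- A cutoff function with plateau radius `1` and support radius `2`, with bounds for first and
symmetric second differences. -/
structure IsCutoff (χ : Pt d → ℝ) (L : ℝ) : Prop where
  measurable : Measurable χ
  nonneg : ∀ x, 0 ≤ χ x
  le_one : ∀ x, χ x ≤ 1
  one : ∀ x, ‖x‖ ≤ 1 → χ x = 1
  zero : ∀ x, 2 ≤ ‖x‖ → χ x = 0
  lip : ∀ x y, |χ x - χ y| ≤ L * ‖x - y‖
  symm : ∀ x v, |χ (x + v) + χ (x - v) - 2 * χ x| ≤ L * ‖v‖ ^ 2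

/-- A smooth bump of compact support has bounded first and second derivatives; the symmetric second
difference is the mean value inequality for `y ↦ f (y + v) - f y`. -/
lemma exists_isCutoff (d : ℕ) : ∃ (χ : Pt d → ℝ) (L : ℝ), 0 ≤ L ∧ IsCutoff χ L := by
  let f : ContDiffBump (0 : Pt d) := ⟨1, 2, by norm_num, by norm_num⟩
  have hf : ContDiff ℝ 2 f := f.contDiff
  obtain ⟨L₁, hL₁⟩ := ContDiff.lipschitzWith_of_hasCompactSupport f.hasCompactSupport hf (by simp)
  obtain ⟨L₂, hL₂⟩ := ContDiff.lipschitzWith_of_hasCompactSupport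
    (f.hasCompactSupport.fderiv (𝕜 := ℝ)) (hf.fderiv_right (m := 1) (by norm_num)) (by simp)
  have hdf : Differentiable ℝ f := hf.differentiable (by simp)
  refine ⟨f, max L₁ L₂, by positivity, ?_, fun x => f.nonneg, fun x => f.le_one, ?_, ?_, ?_, ?_⟩
  · exact f.continuous.measurable
  · intro x hx
    exact f.one_of_mem_closedBall (by simpa [f] using hx)
  · intro x hx
    exact f.zero_of_le_dist (by simpa [f] using hx)
  · intro x y
    have := hL₁.dist_le_mul x y
    rw [Real.dist_eq, dist_eq_norm] at this
    exact this.trans (by gcongr; exact le_max_left _ _)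
  · intro x v
    have hd : ∀ y ∈ (univ : Set (Pt d)), DifferentiableAt ℝ (fun y => f (y + v) - f y) y :=
      fun y _ => ((hdf _).comp y (differentiableAt_id.add_const v)).sub (hdf y)
    have hb : ∀ y ∈ (univ : Set (Pt d)), ‖fderiv ℝ (fun y => f (y + v) - f y) y‖ ≤ L₂ * ‖v‖ := by
      intro y _
      have e : fderiv ℝ (fun y => f (y + v) - f y) y = fderiv ℝ f (y + v) - fderiv ℝ f y := by
        have h1 : DifferentiableAt ℝ (fun y => f (y + v)) y :=
          (hdf _).comp y (differentiableAt_id.add_const v)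
        rw [fderiv_fun_sub h1 (hdf y), fderiv_comp_add_right]
      rw [e, ← dist_eq_norm]
      simpa using hL₂.dist_le_mul (y + v) y
    have := convex_univ.norm_image_sub_le_of_norm_fderiv_le hd hb (mem_univ (x - v)) (mem_univ x)
    rw [Real.norm_eq_abs, sub_sub_cancel, sub_add_cancel] at this
    calc |f (x + v) + f (x - v) - 2 * f x| = |f (x + v) - f x - (f x - f (x - v))| := by
          congr 1; ring
      _ ≤ L₂ * ‖v‖ * ‖v‖ := this
      _ = L₂ * ‖v‖ ^ 2 := by ring
      _ ≤ _ := by gcongr; exact le_max_right _ _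

/-- The cutoff function rescaled to the ball of radius `s` around `z`. -/
def scaled (χ : Pt d → ℝ) (z : Pt d) (s : ℝ) (x : Pt d) : ℝ := χ (s⁻¹ • (x - z))

lemma norm_scaling {s : ℝ} (hs : 0 < s) (y : Pt d) : ‖s⁻¹ • y‖ = ‖y‖ / s := by
  rw [norm_smul, Real.norm_eq_abs, abs_of_pos (inv_pos.2 hs), div_eq_inv_mul]

lemma IsCutoff.measurable_scaled {χ : Pt d → ℝ} {L : ℝ} (hχ : IsCutoff χ L) (z : Pt d) (s : ℝ) :
    Measurable (scaled χ z s) :=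
  hχ.measurable.comp (by fun_prop)

lemma IsCutoff.abs_scaled_le {χ : Pt d → ℝ} {L : ℝ} (hχ : IsCutoff χ L) (z : Pt d) (s : ℝ) (x : Pt d) :
    |scaled χ z s x| ≤ 1 :=
  abs_le.2 ⟨neg_one_lt_zero.le.trans (hχ.nonneg _), hχ.le_one _⟩

lemma IsCutoff.scaled_one {χ : Pt d → ℝ} {L : ℝ} (hχ : IsCutoff χ L) (z : Pt d) {s : ℝ}
    (hs : 0 < s) {x : Pt d} (hx : dist x z ≤ s) : scaled χ z s x = 1 := by
  refine hχ.one _ ?_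
  rwa [norm_scaling hs, div_le_one hs, ← dist_eq_norm]

lemma IsCutoff.scaled_zero {χ : Pt d → ℝ} {L : ℝ} (hχ : IsCutoff χ L) (z : Pt d) {s : ℝ}
    (hs : 0 < s) {x : Pt d} (hx : 2 * s ≤ dist x z) : scaled χ z s x = 0 := by
  refine hχ.zero _ ?_
  rwa [norm_scaling hs, le_div_iff₀ hs, ← dist_eq_norm]

lemma IsCutoff.scaled_lip {χ : Pt d → ℝ} {L : ℝ} (hχ : IsCutoff χ L) (z : Pt d) {s : ℝ}
    (hs : 0 < s) (x y : Pt d) :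
    |scaled χ z s x - scaled χ z s y| ≤ L * (dist x y / s) := by
  have := hχ.lip (s⁻¹ • (x - z)) (s⁻¹ • (y - z))
  rwa [← smul_sub, sub_sub_sub_cancel_right, norm_scaling hs, ← dist_eq_norm] at this

lemma IsCutoff.abs_avg_scaled_sub_le {χ : Pt d → ℝ} {L : ℝ} (hχ : IsCutoff χ L) (z : Pt d) {s : ℝ}
    (hs : 0 < s) (hL : 0 ≤ L) (x : Pt d) {a : ℝ} (ha : 0 < a) :
    |(⨍ u in cube x a, scaled χ z s u) - scaled χ z s x| ≤ L * (a / s) ^ 2 := by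
  have h := abs_avg_sub_le_of_symm (x := x) (E := L * (a / s) ^ 2) ha
    (integrableOn_cube_of_bounded (hχ.measurable_scaled z s)
      fun u _ => hχ.abs_scaled_le z s u) ?_
  · have : 0 ≤ L * (a / s) ^ 2 := by positivity
    linarith
  intro v hv
  have := hχ.symm (s⁻¹ • (x - z)) (s⁻¹ • v)
  rw [← smul_add, ← smul_sub, norm_scaling hs, sub_add_eq_add_sub, sub_right_comm] at this
  refine this.trans ?_
  have : ‖v‖ ≤ a := by linarith
  gcongr

/-- Regularity of `g` at scale `s` around `z`: it has size `s ^ α` on the ball of radius `6 s`, and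
its means over small cubes are `α`-close to its values. -/
structure RegularAt (g : Pt d → ℝ) (z : Pt d) (G α s : ℝ) : Prop where
  bound : ∀ u ∈ Metric.closedBall z (6 * s), |g u| ≤ G * s ^ α
  mean : ∀ y ∈ Metric.closedBall z (5 * s), ∀ a, 0 < a → a ≤ s →
    |(⨍ u in cube y a, g u) - g y| ≤ G * a ^ α

/-- At scales below `s`, multiplication by a cutoff at scale `s` almost commutes with means. -/
lemma abs_avg_cutoff_mul_sub_le {χ : Pt d → ℝ} {L : ℝ} (hχ : IsCutoff χ L) (hL : 0 ≤ L)
    {g : Pt d → ℝ} (hg : Measurable g) {z : Pt d} {s G α : ℝ} (hs : 0 < s) (hG : 0 ≤ G)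
    (hα2 : α ≤ 2) (hr : RegularAt g z G α s) (x : Pt d) {a : ℝ} (ha : 0 < a) (has : a ≤ s) :
    |(⨍ u in cube x a, scaled χ z s u * g u) - scaled χ z s x * ⨍ u in cube x a, g u| ≤
      L * (3 + 13 * d) * G * a ^ α := by
  have haα : 0 ≤ a ^ α := Real.rpow_nonneg ha.le α
  rcases le_or_gt (3 * s) (dist x z) with hx | hx
  · have h0 : ∀ u ∈ cube x a, scaled χ z s u * g u = 0 := by
      intro u hu
      rw [hχ.scaled_zero z hs, zero_mul]
      have := dist_triangle_left x z u
      linarith [mem_cube.1 hu]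
    rw [avg_congr h0, avg_const x ha, hχ.scaled_zero z hs (by linarith)]
    simp
    positivity
  -- replace `g` by a globally bounded function
  have hin : ∀ u, dist u z ≤ 6 * s → (Metric.closedBall z (6 * s)).indicator g u = g u :=
    fun u hu => indicator_of_mem (Metric.mem_closedBall.2 hu) g
  set g' := (Metric.closedBall z (6 * s)).indicator g with hg'
  have hg'm : Measurable g' := hg.indicator Metric.isClosed_closedBall.measurableSet
  have hbd : ∀ u, |g' u| ≤ G * s ^ α := by
    intro u
    by_cases hu : u ∈ Metric.closedBall z (6 * s)
    · rw [hg', indicator_of_mem hu]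
      exact hr.bound u hu
    · rw [hg', indicator_of_notMem hu, abs_zero]
      positivity
  have hcube : ∀ y, dist y z ≤ 5 * s → ∀ b ≤ s, ∀ u ∈ cube y b, g' u = g u := by
    intro y hy b hb u hu
    refine hin u ?_
    linarith [dist_triangle u y z, mem_cube.1 hu]
  have hmean : ∀ y ∈ Metric.closedBall z (5 * s), ∀ b, 0 < b → b ≤ s →
      |(⨍ u in cube y b, g' u) - g' y| ≤ G * b ^ α := by
    intro y hy b hb hbs
    have hy' := Metric.mem_closedBall.1 hy
    rw [avg_congr (hcube y hy' b hbs), hin y (by linarith)]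
    exact hr.mean y hy b hb hbs
  have hxc := hcube x (by linarith) a has
  rw [← avg_congr hxc, ← avg_congr (g := fun u => scaled χ z s u * g' u)
    fun u hu => by rw [hxc u hu]]
  set φ := scaled χ z s with hφ
  have hφm : Measurable φ := hχ.measurable_scaled z s
  have hφ1 : ∀ u, |φ u| ≤ 1 := hχ.abs_scaled_le z s
  have hφi : IntegrableOn φ (cube x a) := integrableOn_cube_of_bounded hφm fun u _ => hφ1 u
  have hgi : IntegrableOn g' (cube x a) := integrableOn_cube_of_bounded hg'm fun u _ => hbd u
  have hci : ∀ c : ℝ, IntegrableOn (fun _ : Pt d => c) (cube x a) := fun c =>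
    integrableOn_const (volume_cube_ne_top x a)
  have hφgi : IntegrableOn (fun u => φ u * g' u) (cube x a) :=
    integrableOn_cube_of_bounded (hφm.mul hg'm) (B := 1 * (G * s ^ α)) fun u _ => by
      rw [Pi.mul_apply, abs_mul]
      exact mul_le_mul (hφ1 u) (hbd u) (abs_nonneg _) zero_le_one
  have hrem : ∀ u, (φ u - φ x) * (g' u - g' x) =
      φ u * g' u - (φ x * g' u + g' x * (φ u - φ x)) := fun u => by ring
  -- In the product of increments, the Lipschitz factor `a / s` of the cutoff compensates the factor
  -- `s / a` lost in `oscillation_le`. In the other term, the cutoff has second-order mean error `(a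
  -- / s) ^ 2` against `g' x` of size `s ^ α`.
  have hdec : (⨍ u in cube x a, φ u * g' u) - φ x * ⨍ u in cube x a, g' u =
      (⨍ u in cube x a, (φ u - φ x) * (g' u - g' x)) +
        g' x * ((⨍ u in cube x a, φ u) - φ x) := by
    have i1 : IntegrableOn (fun u => φ x * g' u) (cube x a) := hgi.const_mul _
    have i2 : IntegrableOn (fun u => g' x * (φ u - φ x)) (cube x a) :=
      (hφi.sub (hci _)).const_mul _
    simp_rw [hrem]
    rw [avg_sub hφgi (h := fun u => φ x * g' u + g' x * (φ u - φ x)) (i1.add i2),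
      avg_add i1 i2, avg_const_mul, avg_const_mul, avg_sub hφi (hci _), avg_const x ha]
    ring
  have hmain : |⨍ u in cube x a, (φ u - φ x) * (g' u - g' x)| ≤
      L * ((2 + 13 * d) * G * a ^ α) := by
    refine abs_avg_le ha fun u hu => ?_
    have hu' := mem_cube.1 hu
    rw [abs_mul]
    have o := oscillation_le hg'm hs hG hα2 hbd hmean ha has
      (Metric.mem_closedBall.2 (by linarith : dist x z ≤ 4 * s))
      (Metric.mem_closedBall.2 (by linarith [dist_triangle u x z] : dist u z ≤ 4 * s))
      (by linarith : dist u x ≤ a)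
    have l := hχ.scaled_lip z hs u x
    calc |φ u - φ x| * |g' u - g' x| ≤ L * (a / s) * |g' u - g' x| := by
          refine mul_le_mul_of_nonneg_right (l.trans ?_) (abs_nonneg _)
          have : dist u x ≤ a := by linarith
          gcongr
      _ = L * (|g' u - g' x| * (a / s)) := by ring
      _ ≤ _ := by gcongr
  have hside : |g' x * ((⨍ u in cube x a, φ u) - φ x)| ≤ L * (G * a ^ α) := by
    rw [abs_mul]
    calc |g' x| * |(⨍ u in cube x a, φ u) - φ x| ≤ G * s ^ α * (L * (a / s) ^ 2) :=
          mul_le_mul (hbd x) (hχ.abs_avg_scaled_sub_le z hs hL x ha) (abs_nonneg _)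
            (by positivity)
      _ = L * (G * ((a / s) ^ 2 * s ^ α)) := by ring
      _ ≤ _ := by
          have := sq_mul_rpow_le ha has hα2
          gcongr
  rw [hdec]
  refine (abs_add_le _ _).trans ((add_le_add hmain hside).trans (le_of_eq ?_))
  ring

/-- The cutoff is constant on the whole cube in both cases, so the commutator at scale `s` lives
only on an annulus of radius comparable to `s`. -/
lemma avg_cutoff_mul_eq {χ : Pt d → ℝ} {L : ℝ} (hχ : IsCutoff χ L) (g : Pt d → ℝ) {z : Pt d}
    {s : ℝ} (hs : 0 < s) (x : Pt d) {a : ℝ} (ha : 0 < a) (has : a ≤ s)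
    (hx : dist x z ≤ s / 2 ∨ 3 * s ≤ dist x z) :
    ⨍ u in cube x a, scaled χ z s u * g u = scaled χ z s x * ⨍ u in cube x a, g u := by
  rcases hx with hx | hx
  · have h1 : ∀ u ∈ cube x a, scaled χ z s u * g u = g u := by
      intro u hu
      rw [hχ.scaled_one z hs, one_mul]
      linarith [dist_triangle u x z, mem_cube.1 hu]
    rw [avg_congr h1, hχ.scaled_one z hs (by linarith), one_mul]
  · have h0 : ∀ u ∈ cube x a, scaled χ z s u * g u = 0 := by
      intro u hu
      rw [hχ.scaled_zero z hs, zero_mul]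
      linarith [dist_triangle_left x z u, mem_cube.1 hu]
    rw [avg_congr h0, avg_const x ha, hχ.scaled_zero z hs (by linarith), zero_mul]

lemma abs_cutoff_mul_le {χ : Pt d → ℝ} {L : ℝ} (hχ : IsCutoff χ L)
    {g : Pt d → ℝ} {z : Pt d} {s G α : ℝ} (hs : 0 < s) (hG : 0 ≤ G)
    (hbd : ∀ u ∈ Metric.closedBall z (6 * s), |g u| ≤ G * s ^ α) (u : Pt d) :
    |scaled χ z s u * g u| ≤ G * s ^ α := by
  have h0 : 0 ≤ G * s ^ α := by positivity
  rcases le_or_gt (2 * s) (dist u z) with hu | hu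
  · rw [hχ.scaled_zero z hs hu, zero_mul, abs_zero]
    exact h0
  · rw [abs_mul]
    calc _ ≤ 1 * (G * s ^ α) := mul_le_mul (hχ.abs_scaled_le z s u)
          (hbd u (Metric.mem_closedBall.2 (by linarith))) (abs_nonneg _) zero_le_one
      _ = _ := one_mul _

/-- A crude bound for cubes larger than the cutoff scale: there `s ^ α` is already smaller than `a ^
α`. -/
lemma abs_avg_cutoff_mul_le {χ : Pt d → ℝ} {L : ℝ} (hχ : IsCutoff χ L)
    {g : Pt d → ℝ} {z : Pt d} {s G α : ℝ} (hs : 0 < s) (hG : 0 ≤ G)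
    (hbd : ∀ u ∈ Metric.closedBall z (6 * s), |g u| ≤ G * s ^ α) (x : Pt d) {a : ℝ} (ha : 0 < a) :
    |(⨍ u in cube x a, scaled χ z s u * g u) - scaled χ z s x * g x| ≤ 2 * (G * s ^ α) := by
  have h1 := abs_avg_le (g := fun u => scaled χ z s u * g u) (x := x) ha
    fun u _ => abs_cutoff_mul_le hχ hs hG hbd u
  have h2 := abs_cutoff_mul_le hχ hs hG hbd x
  refine (abs_sub _ _).trans ?_
  linarith

/-- The product of a cutoff at scale `s` and a function regular at that scale is `α`-close to its
means at all scales. -/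
lemma abs_avg_cutoff_mul_sub_self_le {χ : Pt d → ℝ} {L : ℝ} (hχ : IsCutoff χ L) (hL : 0 ≤ L)
    {g : Pt d → ℝ} (hg : Measurable g) {z : Pt d} {s G α : ℝ} (hs : 0 < s) (hG : 0 ≤ G)
    (hα : 0 < α) (hα2 : α ≤ 2) (hr : RegularAt g z G α s) (x : Pt d) {a : ℝ} (ha : 0 < a) :
    |(⨍ u in cube x a, scaled χ z s u * g u) - scaled χ z s x * g x| ≤
      (L * (3 + 13 * d) + 2) * G * a ^ α := by
  have haα : 0 ≤ a ^ α := Real.rpow_nonneg ha.le α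
  rcases le_or_gt a s with has | has
  · have h1 := abs_avg_cutoff_mul_sub_le hχ hL hg hs hG hα2 hr x ha has
    have h2 : |scaled χ z s x * ((⨍ u in cube x a, g u) - g x)| ≤ G * a ^ α := by
      rcases le_or_gt (2 * s) (dist x z) with hx | hx
      · rw [hχ.scaled_zero z hs hx, zero_mul, abs_zero]
        positivity
      · rw [abs_mul]
        calc _ ≤ 1 * (G * a ^ α) := mul_le_mul (hχ.abs_scaled_le z s x)
              (hr.mean x (Metric.mem_closedBall.2 (by linarith)) a ha has) (abs_nonneg _)
              zero_le_one
          _ = _ := one_mul _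
    have e : (⨍ u in cube x a, scaled χ z s u * g u) - scaled χ z s x * g x =
        ((⨍ u in cube x a, scaled χ z s u * g u) - scaled χ z s x * ⨍ u in cube x a, g u) +
        scaled χ z s x * ((⨍ u in cube x a, g u) - g x) := by ring
    rw [e]
    refine (abs_add_le _ _).trans ?_
    have : 0 ≤ G * a ^ α := by positivity
    linarith
  · have h1 := abs_avg_cutoff_mul_le hχ hs hG hr.bound x ha
    have h2 : s ^ α ≤ a ^ α := Real.rpow_le_rpow hs.le has.le hα.le
    have h3 : G * s ^ α ≤ G * a ^ α := by gcongr
    have h4 : 0 ≤ L * (3 + 13 * d) * G * a ^ α := by positivity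
    linarith

/-- A geometric sum is governed by its largest term, here below `a`. Truncating with `min` turns it
into a telescoping sum whose bound does not involve `n`. -/
lemma sum_scales_rpow_le {α : ℝ} (hα : 0 < α) {r a : ℝ} (hr : 0 < r) (ha : 0 < a) (n : ℕ) :
    ∑ k ∈ Finset.range n, (if 8 ^ k * r < a then (8 ^ k * r) ^ α else 0) ≤
      8 ^ α / (8 ^ α - 1) * a ^ α := by
  have h8 : (1 : ℝ) < 8 ^ α := Real.one_lt_rpow (by norm_num) hα
  have hstep : ∀ k : ℕ, (if 8 ^ k * r < a then ((8 : ℝ) ^ k * r) ^ α else 0) ≤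
      (min (8 ^ (k + 1) * r) (8 * a) ^ α - min (8 ^ k * r) (8 * a) ^ α) / (8 ^ α - 1) := by
    intro k
    rw [le_div_iff₀ (by linarith)]
    have hp : (0 : ℝ) < 8 ^ k * r := by positivity
    have e : (8 : ℝ) ^ (k + 1) * r = 8 * (8 ^ k * r) := by ring
    rw [e]
    split_ifs with h
    · rw [min_eq_left (by linarith), min_eq_left (by linarith),
        Real.mul_rpow (by norm_num) hp.le]
      linarith
    · rw [zero_mul, sub_nonneg]
      exact Real.rpow_le_rpow (by positivity) (min_le_min_right _ (by linarith)) hα.le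
  refine (Finset.sum_le_sum fun k _ => hstep k).trans ?_
  rw [← Finset.sum_div, Finset.sum_range_sub (fun k : ℕ => min ((8 : ℝ) ^ k * r) (8 * a) ^ α)]
  rw [div_mul_eq_mul_div]
  refine div_le_div_of_nonneg_right ?_ (by linarith)
  have h1 : min (8 ^ n * r) (8 * a) ^ α ≤ (8 * a) ^ α :=
    Real.rpow_le_rpow (by positivity) (min_le_right _ _) hα.le
  have h2 : 0 ≤ min ((8 : ℝ) ^ 0 * r) (8 * a) ^ α := by positivity
  rw [Real.mul_rpow (by norm_num) ha.le] at h1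
  linarith

/-- The error made when multiplying by the sum of the cutoffs at the scales `8 ^ k * r` does not
grow with the number of scales, apart from a multiple of the error of `g` itself. -/
lemma abs_sum_cutoff_sub_le {χ : Pt d → ℝ} {L : ℝ} (hχ : IsCutoff χ L) (hL : 0 ≤ L)
    {g : Pt d → ℝ} (hg : Measurable g) {z : Pt d} {r G α : ℝ} (hr : 0 < r) (hG : 0 ≤ G)
    (hα : 0 < α) (hα2 : α ≤ 2) (n : ℕ) (hreg : ∀ k < n, RegularAt g z G α (8 ^ k * r))
    (x : Pt d) {a : ℝ} (ha : 0 < a) :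
    ∃ W : ℝ, 0 ≤ W ∧ W ≤ n ∧
      |(∑ k ∈ Finset.range n, ((⨍ u in cube x a, scaled χ z (8 ^ k * r) u * g u) -
        scaled χ z (8 ^ k * r) x * g x)) - W * ((⨍ u in cube x a, g u) - g x)| ≤
      (L * (3 + 13 * d) + 2 * (8 ^ α / (8 ^ α - 1))) * G * a ^ α := by
  have hpos : ∀ k : ℕ, (0 : ℝ) < 8 ^ k * r := fun k => by positivity
  -- Only scales of size at least `a` enter the multiple of the error of `g`; smaller cutoffs are
  -- negligible by the geometric sum.
  let w : ℕ → ℝ := fun k => if a ≤ 8 ^ k * r then scaled χ z (8 ^ k * r) x else 0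
  have hw0 : ∀ k, 0 ≤ w k := fun k => by
    simp only [w]; split_ifs
    · exact hχ.nonneg _
    · exact le_rfl
  have hw1 : ∀ k, w k ≤ 1 := fun k => by
    simp only [w]; split_ifs
    · exact hχ.le_one _
    · exact zero_le_one
  refine ⟨∑ k ∈ Finset.range n, w k, Finset.sum_nonneg fun k _ => hw0 k, ?_, ?_⟩
  · calc ∑ k ∈ Finset.range n, w k ≤ ∑ _k ∈ Finset.range n, (1 : ℝ) :=
          Finset.sum_le_sum fun k _ => hw1 k
      _ = n := by simp
  set C := L * (3 + 13 * d) * G * a ^ α with hC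
  have hC0 : 0 ≤ C := by positivity
  -- The annulus outside of which scale `k` commutes exactly with the mean.
  let P : ℕ → Prop := fun k => 8 ^ k * r / 2 < dist x z ∧ dist x z < 3 * (8 ^ k * r)
  classical
  have hterm : ∀ k ∈ Finset.range n, |((⨍ u in cube x a, scaled χ z (8 ^ k * r) u * g u) -
      scaled χ z (8 ^ k * r) x * g x) - w k * ((⨍ u in cube x a, g u) - g x)| ≤
      (if P k then C else 0) + 2 * G * (if 8 ^ k * r < a then (8 ^ k * r) ^ α else 0) := by
    intro k hk
    have hk' := hreg k (Finset.mem_range.1 hk)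
    by_cases h : a ≤ 8 ^ k * r
    · simp only [w, if_pos h, if_neg (not_lt.2 h), mul_zero, add_zero]
      have e : (⨍ u in cube x a, scaled χ z (8 ^ k * r) u * g u) - scaled χ z (8 ^ k * r) x * g x -
          scaled χ z (8 ^ k * r) x * ((⨍ u in cube x a, g u) - g x) =
          (⨍ u in cube x a, scaled χ z (8 ^ k * r) u * g u) -
            scaled χ z (8 ^ k * r) x * ⨍ u in cube x a, g u := by ring
      rw [e]
      split_ifs with hP
      · exact abs_avg_cutoff_mul_sub_le hχ hL hg (hpos k) hG hα2 hk' x ha h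
      · rw [avg_cutoff_mul_eq hχ g (hpos k) x ha h, sub_self, abs_zero]
        by_contra hcon
        push Not at hcon
        exact hP hcon
    · simp only [w, if_neg h, if_pos (not_le.1 h), zero_mul, sub_zero]
      have h1 := abs_avg_cutoff_mul_le hχ (hpos k) hG hk'.bound x ha
      have h2 : 0 ≤ (if P k then C else 0) := by split_ifs <;> simp [hC0]
      linarith
  -- The ratio `8` is chosen so that these annuli are disjoint: half of `8 ^ (i + 1) * r` exceeds `3
  -- * 8 ^ i * r`. Hence the commutator cost `C` is paid once instead of `n` times.
  have hcard : ((Finset.range n).filter P).card ≤ 1 := by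
    rw [Finset.card_le_one]
    have key : ∀ i j : ℕ, P i → P j → ¬ i < j := by
      intro i j hi hj hij
      have h8 : (8 : ℝ) ^ (i + 1) ≤ 8 ^ j := pow_le_pow_right₀ (by norm_num) hij
      have h9 : (8 : ℝ) ^ (i + 1) * r ≤ 8 ^ j * r := by gcongr
      rw [pow_succ] at h9
      have := hpos i
      nlinarith [hi.2, hj.1]
    intro i hi j hj
    have hi' := (Finset.mem_filter.1 hi).2
    have hj' := (Finset.mem_filter.1 hj).2
    have := key i j hi' hj'
    have := key j i hj' hi'
    omega
  rw [Finset.sum_mul, ← Finset.sum_sub_distrib]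
  refine (Finset.abs_sum_le_sum_abs _ _).trans ((Finset.sum_le_sum hterm).trans ?_)
  rw [Finset.sum_add_distrib, ← Finset.mul_sum, ← Finset.sum_filter, Finset.sum_const,
    nsmul_eq_mul]
  have h1 : (((Finset.range n).filter P).card : ℝ) * C ≤ C := by
    have : (((Finset.range n).filter P).card : ℝ) ≤ 1 := by exact_mod_cast hcard
    nlinarith
  have h2 := sum_scales_rpow_le hα hr ha n
  have h3 : 2 * G * ∑ k ∈ Finset.range n, (if 8 ^ k * r < a then ((8 : ℝ) ^ k * r) ^ α else 0) ≤
      2 * G * (8 ^ α / (8 ^ α - 1) * a ^ α) := by gcongr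
  calc _ ≤ C + 2 * G * (8 ^ α / (8 ^ α - 1) * a ^ α) := add_le_add h1 h3
    _ = _ := by rw [hC]; ring

/-! ### The perturbed cost functions -/

/-- A dip at `z` of depth `η * r ^ α`, with a cusp at `z`, supported in the ball of radius `2 r`. -/
def dip (χ : Pt d → ℝ) (α η : ℝ) (z : Pt d) (r : ℝ) (x : Pt d) : ℝ :=
  scaled χ z r x * (η * r ^ α - η / (4 * d) * cusp α z x)

section dip

variable {χ : Pt d → ℝ} {L α η r : ℝ} {z : Pt d}

lemma measurable_dip (hχ : IsCutoff χ L) (α η : ℝ) (z : Pt d) (r : ℝ) :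
    Measurable (dip χ α η z r) :=
  (hχ.measurable_scaled z r).mul (measurable_const.sub ((measurable_cusp α z).const_mul _))

lemma dip_eq_zero (hχ : IsCutoff χ L) (α η : ℝ) (hr : 0 < r) {x : Pt d}
    (hx : 2 * r ≤ dist x z) : dip χ α η z r x = 0 := by
  rw [dip, hχ.scaled_zero z hr hx, zero_mul]

lemma dip_self (hχ : IsCutoff χ L) (hα : 0 < α) (η : ℝ) (hr : 0 < r) :
    dip χ α η z r z = η * r ^ α := by
  rw [dip, hχ.scaled_one z hr (by simpa using hr.le), cusp_self hα]
  ring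

/-- With the weight `η / (4 * d)` the cusp uses up at most the full depth at radius `2 * r` (`m =
2`), so the dip stays nonnegative on its support; `m = 6` gives the sup bound needed for regularity.
-/
lemma cusp_mul_le (hd : 0 < d) (hα : 0 < α) (hα2 : α ≤ 2) (hη : 0 ≤ η) (hr : 0 < r) {x : Pt d}
    {m : ℝ} (hm : 1 ≤ m) (hx : dist x z ≤ m * r) :
    η / (4 * d) * cusp α z x ≤ m ^ 2 / 4 * (η * r ^ α) := by
  have hd' : (0 : ℝ) < d := by exact_mod_cast hd
  have h1 := cusp_le hα hx
  rw [Real.mul_rpow (by linarith) hr.le] at h1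
  have h2 : m ^ α ≤ m ^ (2 : ℝ) := Real.rpow_le_rpow_of_exponent_le hm hα2
  rw [Real.rpow_two] at h2
  calc η / (4 * d) * cusp α z x ≤ η / (4 * d) * (d * (m ^ 2 * r ^ α)) := by
        refine mul_le_mul_of_nonneg_left (h1.trans ?_) (by positivity)
        gcongr
    _ = _ := by field_simp

lemma dip_nonneg (hχ : IsCutoff χ L) (hd : 0 < d) (hα : 0 < α) (hα2 : α ≤ 2) (hη : 0 ≤ η)
    (hr : 0 < r) (x : Pt d) : 0 ≤ dip χ α η z r x := by
  rcases le_or_gt (2 * r) (dist x z) with hx | hx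
  · rw [dip_eq_zero hχ α η hr hx]
  · have := cusp_mul_le hd hα hα2 hη hr one_le_two hx.le
    refine mul_nonneg (hχ.nonneg _) ?_
    linarith

/-- The dip falls off at least as fast as the cusp. -/
lemma cusp_mul_le_sub_dip (hχ : IsCutoff χ L) (hd : 0 < d) (hα : 0 < α) (hα2 : α ≤ 2)
    (hη : 0 ≤ η) (hr : 0 < r) {x : Pt d} (hx : dist x z < 2 * r) :
    η / (4 * d) * cusp α z x ≤ η * r ^ α - dip χ α η z r x := by
  have h1 := cusp_mul_le hd hα hα2 hη hr one_le_two hx.le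
  have h2 : scaled χ z r x ≤ 1 := hχ.le_one _
  have : dip χ α η z r x ≤ 1 * (η * r ^ α - η / (4 * d) * cusp α z x) :=
    mul_le_mul_of_nonneg_right h2 (by linarith)
  linarith

lemma dip_le (hχ : IsCutoff χ L) (hd : 0 < d) (hα : 0 < α) (hα2 : α ≤ 2)
    (hη : 0 ≤ η) (hr : 0 < r) (x : Pt d) : dip χ α η z r x ≤ η * r ^ α := by
  rcases le_or_gt (2 * r) (dist x z) with hx | hx
  · rw [dip_eq_zero hχ α η hr hx]
    positivity
  · have := cusp_mul_le_sub_dip hχ hd hα hα2 hη hr hx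
    have : 0 ≤ η / (4 * d) * cusp α z x := mul_nonneg (by positivity) (cusp_nonneg _ _ _)
    linarith

/-- The factor multiplying the cutoff is regular at scale `r`: up to radius `6 * r` the cusp term is
at most `9 * η * r ^ α`, whence the generous constant `10 * η`. -/
lemma abs_avg_dip_sub_le (hχ : IsCutoff χ L) (hL : 0 ≤ L) (hd : 0 < d) (hα : 0 < α) (hα2 : α ≤ 2)
    (hη : 0 ≤ η) (hr : 0 < r) (x : Pt d) {a : ℝ} (ha : 0 < a) :
    |(⨍ u in cube x a, dip χ α η z r u) - dip χ α η z r x| ≤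
      (L * (3 + 13 * d) + 2) * (10 * η) * a ^ α := by
  have hd' : (0 : ℝ) < d := by exact_mod_cast hd
  refine abs_avg_cutoff_mul_sub_self_le hχ hL (g := fun u => η * r ^ α - η / (4 * d) * cusp α z u)
    (measurable_const.sub ((measurable_cusp α z).const_mul _)) hr (by positivity) hα hα2
    ⟨fun u hu => ?_, fun y _ b hb _ => ?_⟩ x ha
  · have h1 := cusp_mul_le hd hα hα2 hη hr (by norm_num : (1 : ℝ) ≤ 6)
      (Metric.mem_closedBall.1 hu)
    have h2 : 0 ≤ η / (4 * d) * cusp α z u := mul_nonneg (by positivity) (cusp_nonneg _ _ _)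
    have h3 : 0 ≤ η * r ^ α := by positivity
    rw [abs_le]
    constructor <;> linarith
  · have hi : IntegrableOn (cusp α z) (cube y b) := by
      refine integrableOn_cube_of_bounded (measurable_cusp α z)
        (B := d * (b / 2 + dist y z) ^ α) fun u hu => ?_
      rw [abs_of_nonneg (cusp_nonneg _ _ _)]
      refine cusp_le hα ?_
      linarith [dist_triangle u y z, mem_cube.1 hu]
    have h1 := abs_avg_cusp_sub_le hα hα2 z y hb
    rw [avg_sub (integrableOn_const (volume_cube_ne_top y b))
      (h := fun u => η / (4 * d) * cusp α z u) (hi.const_mul _), avg_const y hb, avg_const_mul,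
      sub_sub_sub_cancel_left, ← mul_sub, abs_mul, abs_sub_comm, abs_of_nonneg (by positivity)]
    have : 0 ≤ η * b ^ α := by positivity
    calc _ ≤ η / (4 * d) * (d * b ^ α) := by gcongr
      _ = η * b ^ α / 4 := by field_simp
      _ ≤ _ := by linarith

end dip

/-- The function `f₀` (with minimum `m₀`), flattened around `z` over the scales `8 ^ k * r`, `k < n`,
with a dip of radius `r'` at `z`. -/
def perturbed (χ f₀ : Pt d → ℝ) (α η m₀ : ℝ) (n : ℕ) (r r' : ℝ) (z x : Pt d) : ℝ :=
  f₀ x - (n : ℝ)⁻¹ * ∑ k ∈ Finset.range n, scaled χ z (8 ^ k * r) x * (f₀ x - m₀) -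
    dip χ α η z r' x

/-- The situation in which `perturbed` is used. -/
structure PertSetup (S : Set (Pt d)) (A M α L G η m₀ : ℝ) (n : ℕ) (r r' : ℝ) (χ f₀ : Pt d → ℝ)
    (z : Pt d) : Prop where
  hd : 0 < d
  hα : 0 < α
  hα2 : α ≤ 2
  hL : 0 ≤ L
  hχ : IsCutoff χ L
  hG : 0 ≤ G
  hη : 0 < η
  hn : 0 < n
  hr' : 0 < r'
  hrr' : r' ≤ r
  meas : Measurable f₀
  memS : z ∈ S
  nonneg : ∀ x ∈ domain S A, m₀ ≤ f₀ x
  gap : ∀ x ∈ S, f₀ x - m₀ ≤ M / 2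
  smooth : MeanSmooth S A f₀ (M / 2) α
  regular : ∀ k < n, RegularAt (fun x => f₀ x - m₀) z G α (8 ^ k * r)
  small_flat : (L * (3 + 13 * d) + 2 * (8 ^ α / (8 ^ α - 1))) * G ≤ n * (M / 4)
  small_dip : (L * (3 + 13 * d) + 2) * (10 * η) ≤ M / 4
  small_depth : η * r' ^ α ≤ M / 2

lemma subset_domain {S : Set (Pt d)} {A : ℝ} (hA : 0 ≤ A) : S ⊆ domain S A :=
  fun x hx => mem_iUnion₂.2 ⟨x, hx, self_mem_cube x hA⟩

lemma cube_subset_domain {S : Set (Pt d)} {A : ℝ} {x : Pt d} (hx : x ∈ S) {a : ℝ} (ha : a ≤ A) :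
    cube x a ⊆ domain S A :=
  fun u hu => mem_iUnion₂.2 ⟨x, hx, mem_cube.2 ((mem_cube.1 hu).trans (by linarith))⟩

namespace PertSetup

variable {S : Set (Pt d)} {A M α L G η m₀ : ℝ} {n : ℕ} {r r' : ℝ} {χ f₀ : Pt d → ℝ} {z : Pt d}

lemma r_pos (h : PertSetup S A M α L G η m₀ n r r' χ f₀ z) : 0 < r := h.hr'.trans_le h.hrr'

lemma measurable (h : PertSetup S A M α L G η m₀ n r r' χ f₀ z) :
    Measurable (perturbed χ f₀ α η m₀ n r r' z) :=
  (h.meas.sub (measurable_const.mul (Finset.measurable_sum _ fun k _ =>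
    (h.hχ.measurable_scaled z (8 ^ k * r)).mul (h.meas.sub_const m₀)))).sub
    (measurable_dip h.hχ α η z r')

/-- The fraction of `f₀ - m₀` which is left after flattening. -/
lemma eq_weight (χ f₀ : Pt d → ℝ) (α η m₀ : ℝ) (n : ℕ) (r r' : ℝ) (z x : Pt d) :
    perturbed χ f₀ α η m₀ n r r' z x = m₀ +
      (1 - (n : ℝ)⁻¹ * ∑ k ∈ Finset.range n, scaled χ z (8 ^ k * r) x) * (f₀ x - m₀) -
      dip χ α η z r' x := by
  rw [perturbed, ← Finset.sum_mul]
  ring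

lemma weight_mem (h : PertSetup S A M α L G η m₀ n r r' χ f₀ z) (x : Pt d) :
    0 ≤ (n : ℝ)⁻¹ * ∑ k ∈ Finset.range n, scaled χ z (8 ^ k * r) x ∧
      (n : ℝ)⁻¹ * ∑ k ∈ Finset.range n, scaled χ z (8 ^ k * r) x ≤ 1 := by
  have hn : (0 : ℝ) < n := by exact_mod_cast h.hn
  constructor
  · exact mul_nonneg (by positivity) (Finset.sum_nonneg fun k _ => h.hχ.nonneg _)
  · rw [inv_mul_le_iff₀ hn, mul_one]
    calc _ ≤ ∑ _k ∈ Finset.range n, (1 : ℝ) := Finset.sum_le_sum fun k _ => h.hχ.le_one _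
      _ = n := by simp

/-- Flattening retains a nonnegative fraction of `f₀ - m₀`, so only the dip can push values below
`m₀`. -/
lemma le_perturbed (h : PertSetup S A M α L G η m₀ n r r' χ f₀ z) {x : Pt d}
    (hx : x ∈ domain S A) : m₀ - dip χ α η z r' x ≤ perturbed χ f₀ α η m₀ n r r' z x := by
  rw [eq_weight]
  have h1 := h.weight_mem x
  have h2 := h.nonneg x hx
  have : 0 ≤ (1 - (n : ℝ)⁻¹ * ∑ k ∈ Finset.range n, scaled χ z (8 ^ k * r) x) * (f₀ x - m₀) :=
    mul_nonneg (by linarith) (by linarith)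
  linarith

lemma perturbed_self (h : PertSetup S A M α L G η m₀ n r r' χ f₀ z) :
    perturbed χ f₀ α η m₀ n r r' z z = m₀ - η * r' ^ α := by
  have hr := h.r_pos
  have hn : (0 : ℝ) < n := by exact_mod_cast h.hn
  have : ∑ k ∈ Finset.range n, scaled χ z (8 ^ k * r) z = n := by
    rw [Finset.sum_congr rfl fun k _ => h.hχ.scaled_one z (by positivity : 0 < 8 ^ k * r)
      (by rw [dist_self]; positivity)]
    simp
  rw [eq_weight, this, dip_self h.hχ h.hα η h.hr', inv_mul_cancel₀ hn.ne']
  ring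

lemma isLeast (h : PertSetup S A M α L G η m₀ n r r' χ f₀ z) {x : Pt d} (hx : x ∈ domain S A) :
    m₀ - η * r' ^ α ≤ perturbed χ f₀ α η m₀ n r r' z x := by
  have h1 := h.le_perturbed hx
  have h2 := dip_le h.hχ (z := z) h.hd h.hα h.hα2 h.hη.le h.hr' x
  linarith

lemma hasOptimizer (h : PertSetup S A M α L G η m₀ n r r' χ f₀ z) :
    HasOptimizer S A (perturbed χ f₀ α η m₀ n r r' z) :=
  ⟨z, h.memS, fun _ hx => h.perturbed_self ▸ h.isLeast hx⟩

lemma minValue_eq (h : PertSetup S A M α L G η m₀ n r r' χ f₀ z) (hA : 0 < A) :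
    minValue S A (perturbed χ f₀ α η m₀ n r r' z) = m₀ - η * r' ^ α := by
  refine IsLeast.csInf_eq ⟨⟨z, subset_domain hA.le h.memS, h.perturbed_self⟩, ?_⟩
  rintro _ ⟨x, hx, rfl⟩
  exact h.isLeast hx

lemma boundedGap (h : PertSetup S A M α L G η m₀ n r r' χ f₀ z) (hA : 0 < A) :
    BoundedGap S A (perturbed χ f₀ α η m₀ n r r' z) M := by
  intro x hx
  rw [h.minValue_eq hA, eq_weight]
  have h1 := h.weight_mem x
  have h2 := h.nonneg x (subset_domain hA.le hx)
  have h3 := h.gap x hx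
  have h4 := h.small_depth
  have h5 := dip_nonneg h.hχ (z := z) h.hd h.hα h.hα2 h.hη.le h.hr' x
  have : (1 - (n : ℝ)⁻¹ * ∑ k ∈ Finset.range n, scaled χ z (8 ^ k * r) x) * (f₀ x - m₀) ≤
      1 * (f₀ x - m₀) := mul_le_mul_of_nonneg_right (by linarith) (by linarith)
  linarith

/-- The budget is `M = M/2 + M/4 + M/4`: the inherited error of `f₀`, the flattening error divided
by `n`, and the dip. -/
lemma meanSmooth (h : PertSetup S A M α L G η m₀ n r r' χ f₀ z) :
    MeanSmooth S A (perturbed χ f₀ α η m₀ n r r' z) M α := by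
  intro x hx a ha
  have hn : (0 : ℝ) < n := by exact_mod_cast h.hn
  have haα : 0 ≤ a ^ α := Real.rpow_nonneg ha.1.le α
  set g : Pt d → ℝ := fun x => f₀ x - m₀ with hg
  have hgm : Measurable g := h.meas.sub_const m₀
  obtain ⟨hgi, hge⟩ := (h.smooth x hx a ha).sub_const ha.1 m₀
  have hki : ∀ k, IntegrableOn (fun u => scaled χ z (8 ^ k * r) u * g u) (cube x a) := fun k =>
    Integrable.bdd_mul (c := 1) hgi (h.hχ.measurable_scaled z _).aestronglyMeasurable
      (ae_of_all _ fun u => h.hχ.abs_scaled_le z _ u)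
  have hsi : IntegrableOn (fun u => ∑ k ∈ Finset.range n, scaled χ z (8 ^ k * r) u * g u)
      (cube x a) := integrable_finsetSum _ fun k _ => hki k
  have hdi : IntegrableOn (dip χ α η z r') (cube x a) :=
    integrableOn_cube_of_bounded (measurable_dip h.hχ α η z r') (B := η * r' ^ α) fun u _ => by
      rw [abs_of_nonneg (dip_nonneg h.hχ h.hd h.hα h.hα2 h.hη.le h.hr' u)]
      exact dip_le h.hχ h.hd h.hα h.hα2 h.hη.le h.hr' u
  have hfi := (h.smooth x hx a ha).1
  have hFi : IntegrableOn (perturbed χ f₀ α η m₀ n r r' z) (cube x a) :=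
    (hfi.sub (hsi.const_mul _)).sub hdi
  refine ⟨hFi, ?_⟩
  have hsum : ⨍ u in cube x a, ∑ k ∈ Finset.range n, scaled χ z (8 ^ k * r) u * g u =
      ∑ k ∈ Finset.range n, ⨍ u in cube x a, scaled χ z (8 ^ k * r) u * g u := by
    simp only [setAverage_eq]
    rw [integral_finsetSum _ fun k _ => hki k, Finset.smul_sum]
  have havg : ⨍ u in cube x a, perturbed χ f₀ α η m₀ n r r' z u =
      (⨍ u in cube x a, g u) + m₀ -
        (n : ℝ)⁻¹ * ∑ k ∈ Finset.range n, (⨍ u in cube x a, scaled χ z (8 ^ k * r) u * g u) -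
        ⨍ u in cube x a, dip χ α η z r' u := by
    have hcm : IntegrableOn (fun _ : Pt d => m₀) (cube x a) :=
      integrableOn_const (volume_cube_ne_top x a)
    have e1 : ⨍ u in cube x a, g u = (⨍ u in cube x a, f₀ u) - m₀ := by
      rw [hg, avg_sub hfi hcm, avg_const x ha.1]
    unfold perturbed
    rw [avg_sub (g := fun u => f₀ u - (n : ℝ)⁻¹ * ∑ k ∈ Finset.range n,
      scaled χ z (8 ^ k * r) u * (f₀ u - m₀)) (hfi.sub (hsi.const_mul _)) hdi,
      avg_sub (h := fun u => (n : ℝ)⁻¹ * ∑ k ∈ Finset.range n,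
      scaled χ z (8 ^ k * r) u * (f₀ u - m₀)) hfi (hsi.const_mul _), avg_const_mul, hsum, e1]
    ring
  obtain ⟨W, hW0, hWn, hW⟩ := abs_sum_cutoff_sub_le h.hχ h.hL hgm h.r_pos h.hG h.hα h.hα2 n
    h.regular x ha.1
  have hdip := abs_avg_dip_sub_le h.hχ h.hL (z := z) h.hd h.hα h.hα2 h.hη.le h.hr' x ha.1
  rw [Finset.sum_sub_distrib] at hW
  set E := (∑ k ∈ Finset.range n, (⨍ u in cube x a, scaled χ z (8 ^ k * r) u * g u)) -
    (∑ k ∈ Finset.range n, scaled χ z (8 ^ k * r) x * g x) -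
    W * ((⨍ u in cube x a, g u) - g x) with hE
  -- Flattening multiplies the error of `g` by `1 - W / n`, which lies in `[0, 1]`, so the constant
  -- `M / 2` is preserved rather than enlarged.
  have hdec : (⨍ u in cube x a, perturbed χ f₀ α η m₀ n r r' z u) -
      perturbed χ f₀ α η m₀ n r r' z x =
      (1 - W / n) * ((⨍ u in cube x a, g u) - g x) + (-((n : ℝ)⁻¹ * E)) +
        (-((⨍ u in cube x a, dip χ α η z r' u) - dip χ α η z r' x)) := by
    have e2 : perturbed χ f₀ α η m₀ n r r' z x = g x + m₀ -
        (n : ℝ)⁻¹ * (∑ k ∈ Finset.range n, scaled χ z (8 ^ k * r) x * g x) -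
        dip χ α η z r' x := by rw [perturbed, hg]; ring
    rw [havg, e2, hE]
    ring
  have t1 : |(1 - W / n) * ((⨍ u in cube x a, g u) - g x)| ≤ M / 2 * a ^ α := by
    have hW1 : W / n ≤ 1 := (div_le_one hn).2 hWn
    have hW2 : 0 ≤ W / n := by positivity
    rw [abs_mul, abs_of_nonneg (by linarith)]
    calc _ ≤ 1 * (M / 2 * a ^ α) := mul_le_mul (by linarith) hge (abs_nonneg _) zero_le_one
      _ = _ := one_mul _
  have t2 : |(-((n : ℝ)⁻¹ * E))| ≤ M / 4 * a ^ α := by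
    rw [abs_neg, abs_mul, abs_of_pos (inv_pos.2 hn), inv_mul_le_iff₀ hn]
    calc |E| ≤ _ := hW
      _ ≤ n * (M / 4) * a ^ α := mul_le_mul_of_nonneg_right h.small_flat haα
      _ = _ := by ring
  have t3 : |(-((⨍ u in cube x a, dip χ α η z r' u) - dip χ α η z r' x))| ≤ M / 4 * a ^ α := by
    rw [abs_neg]
    exact hdip.trans (mul_le_mul_of_nonneg_right h.small_dip haα)
  rw [hdec]
  refine (abs_add_three _ _ _).trans ?_
  linarith

lemma pow_scale_le (h : PertSetup S A M α L G η m₀ n r r' χ f₀ z) {k : ℕ} (hk : k < n) :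
    2 * (8 ^ k * r) ≤ 8 ^ n * r := by
  have hr := h.r_pos
  have h8 : (8 : ℝ) ^ (k + 1) ≤ 8 ^ n := pow_le_pow_right₀ (by norm_num) hk
  have : (0 : ℝ) < 8 ^ k * r := by positivity
  calc 2 * (8 ^ k * r) ≤ 8 ^ (k + 1) * r := by rw [pow_succ]; linarith
    _ ≤ _ := by gcongr

lemma two_mul_le_scale (h : PertSetup S A M α L G η m₀ n r r' χ f₀ z) : 2 * r' ≤ 8 ^ n * r := by
  have := h.pow_scale_le h.hn
  simp only [pow_zero, one_mul] at this
  linarith [h.hrr']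

lemma perturbed_eq (h : PertSetup S A M α L G η m₀ n r r' χ f₀ z) {x : Pt d}
    (hx : 8 ^ n * r ≤ dist x z) : perturbed χ f₀ α η m₀ n r r' z x = f₀ x := by
  have hr := h.r_pos
  have : ∑ k ∈ Finset.range n, scaled χ z (8 ^ k * r) x * (f₀ x - m₀) = 0 :=
    Finset.sum_eq_zero fun k hk => by
      rw [h.hχ.scaled_zero z (by positivity) ((h.pow_scale_le (Finset.mem_range.1 hk)).trans hx),
        zero_mul]
  rw [perturbed, this, dip_eq_zero h.hχ α η h.hr' (h.two_mul_le_scale.trans hx)]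
  ring

/-- All cutoffs act inside radius `8 ^ n * r`, where `f₀ - m₀` is of order `r ^ α` because `n` is
fixed. This bounds both the information per query and the distance to `f₀`. -/
lemma abs_perturbed_sub_le (h : PertSetup S A M α L G η m₀ n r r' χ f₀ z) (x : Pt d) :
    |perturbed χ f₀ α η m₀ n r r' z x - f₀ x| ≤ (G * (8 ^ n) ^ α + η) * r ^ α := by
  have hr := h.r_pos
  have hn : (0 : ℝ) < n := by exact_mod_cast h.hn
  have h1 : |∑ k ∈ Finset.range n, scaled χ z (8 ^ k * r) x * (f₀ x - m₀)| ≤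
      n * (G * (8 ^ n * r) ^ α) := by
    refine (Finset.abs_sum_le_sum_abs _ _).trans ?_
    calc _ ≤ ∑ _k ∈ Finset.range n, G * (8 ^ n * r) ^ α := by
          refine Finset.sum_le_sum fun k hk => ?_
          have hk' := Finset.mem_range.1 hk
          have hp : (0 : ℝ) < 8 ^ k * r := by positivity
          refine (abs_cutoff_mul_le h.hχ hp h.hG (h.regular k hk').bound x).trans ?_
          have := h.pow_scale_le hk'
          exact mul_le_mul_of_nonneg_left
            (Real.rpow_le_rpow hp.le (by linarith) h.hα.le) h.hG
      _ = _ := by simp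
  have h2 : |dip χ α η z r' x| ≤ η * r ^ α := by
    rw [abs_of_nonneg (dip_nonneg h.hχ h.hd h.hα h.hα2 h.hη.le h.hr' x)]
    refine (dip_le h.hχ h.hd h.hα h.hα2 h.hη.le h.hr' x).trans ?_
    exact mul_le_mul_of_nonneg_left (Real.rpow_le_rpow h.hr'.le h.hrr' h.hα.le) h.hη.le
  have e : perturbed χ f₀ α η m₀ n r r' z x - f₀ x = -((n : ℝ)⁻¹ *
      ∑ k ∈ Finset.range n, scaled χ z (8 ^ k * r) x * (f₀ x - m₀)) + -dip χ α η z r' x := by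
    rw [perturbed]; ring
  have h3 : |(-((n : ℝ)⁻¹ * ∑ k ∈ Finset.range n, scaled χ z (8 ^ k * r) x * (f₀ x - m₀)))| ≤
      G * (8 ^ n * r) ^ α := by
    rw [abs_neg, abs_mul, abs_of_pos (inv_pos.2 hn), inv_mul_le_iff₀ hn]
    exact h1
  rw [Real.mul_rpow (by positivity) hr.le] at h3
  rw [e]
  refine (abs_add_le _ _).trans ?_
  rw [abs_neg (dip χ α η z r' x)]
  linarith

lemma gap_le (h : PertSetup S A M α L G η m₀ n r r' χ f₀ z) (hA : 0 < A) {x : Pt d}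
    (hx : x ∈ domain S A) (hxz : 2 * r' ≤ dist x z) :
    η * r' ^ α ≤ perturbed χ f₀ α η m₀ n r r' z x -
      minValue S A (perturbed χ f₀ α η m₀ n r r' z) := by
  have h1 := h.le_perturbed hx
  rw [dip_eq_zero h.hχ α η h.hr' hxz] at h1
  rw [h.minValue_eq hA]
  linarith

/-- Sublevel sets of the perturbed function: away from `z` they are those of `f₀`, and they are
contained in small balls around `z`. -/
lemma mem_sublevel (h : PertSetup S A M α L G η m₀ n r r' χ f₀ z) (hA : 0 < A)
    {ε : ℝ} {x : Pt d}
    (hx : x ∈ sublevel S A (perturbed χ f₀ α η m₀ n r r' z) ε) :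
    (η * r' ^ α ≤ ε ∧ x ∈ S ∧ f₀ x - m₀ < ε) ∨
      dist x z ≤ 8 ^ n * r ∧
        (η * r' ^ α ≤ ε ∨ dist x z ≤ (ε / (η / (4 * d))) ^ (1 / α)) := by
  obtain ⟨hxS, hxε⟩ := hx
  have hd' : (0 : ℝ) < d := by exact_mod_cast h.hd
  have hxD := subset_domain hA.le hxS
  have hh : 0 < η * r' ^ α := mul_pos h.hη (Real.rpow_pos_of_pos h.hr' α)
  rcases le_or_gt (8 ^ n * r) (dist x z) with hfar | hnear
  · left
    have h1 := h.gap_le hA hxD (h.two_mul_le_scale.trans hfar)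
    rw [h.minValue_eq hA, h.perturbed_eq hfar] at hxε
    rw [h.minValue_eq hA, h.perturbed_eq hfar] at h1
    exact ⟨by linarith, hxS, by linarith⟩
  · right
    refine ⟨hnear.le, ?_⟩
    rcases le_or_gt (η * r' ^ α) ε with hε | hε
    · exact Or.inl hε
    · right
      have h2 : dist x z < 2 * r' := by
        by_contra hcon
        have := h.gap_le hA hxD (not_lt.1 hcon)
        linarith
      have h3 := h.le_perturbed hxD
      have h4 := cusp_mul_le_sub_dip h.hχ h.hd h.hα h.hα2 h.hη.le h.hr' h2
      rw [h.minValue_eq hA] at hxε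
      refine dist_le_of_cusp_le h.hα ?_
      have hc : 0 < η / (4 * (d : ℝ)) := div_pos h.hη (by positivity)
      rw [le_div_iff₀ hc]
      linarith

end PertSetup

/-! ### Packing numbers -/

/-- Points with mutual distances larger than `a`. -/
def Spread (Z : Finset (Pt d)) (a : ℝ) : Prop := ∀ x ∈ Z, ∀ y ∈ Z, x ≠ y → a < dist x y

lemma isSeparated_iff_spread (Z : Finset (Pt d)) (a : ℝ) :
    Metric.IsSeparated (a.toNNReal : ℝ≥0∞) (Z : Set (Pt d)) ↔ Spread Z a := by
  refine forall₂_congr fun x _ => forall₂_congr fun y _ => forall_congr' fun hxy => ?_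
  change ENNReal.ofReal a < edist x y ↔ a < dist x y
  rw [edist_dist, ENNReal.ofReal_lt_ofReal_iff (dist_pos.2 hxy)]

/-- Cubes of side `a` around the points are disjoint and lie in one cube of side `2 * ρ + a`;
volumes are compared. -/
lemma Spread.card_le {Z : Finset (Pt d)} {a : ℝ} (ha : 0 < a) (hZ : Spread Z a) {z : Pt d} {ρ : ℝ}
    (hρ : 0 ≤ ρ) (hsub : ∀ x ∈ Z, dist x z ≤ ρ) : (Z.card : ℝ) ≤ (1 + 2 * ρ / a) ^ d := by
  have hdisj : Set.PairwiseDisjoint (Z : Set (Pt d)) fun x => cube x a := by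
    intro x hx y hy hxy
    refine Set.disjoint_left.2 fun u hu hu' => ?_
    have := hZ x hx y hy hxy
    linarith [dist_triangle_left x y u, mem_cube.1 hu, mem_cube.1 hu']
  have hun : volume.real (⋃ x ∈ Z, cube x a) = Z.card * a ^ d := by
    rw [measureReal_biUnion_finset hdisj (fun x _ => measurableSet_cube x a)
      fun x _ => volume_cube_ne_top x a]
    simp [volume_real_cube _ ha.le]
  have hle : volume.real (⋃ x ∈ Z, cube x a) ≤ (2 * ρ + a) ^ d := by
    rw [← volume_real_cube z (by linarith)]
    refine measureReal_mono (iUnion₂_subset fun x hx u hu => ?_) (volume_cube_ne_top _ _)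
    rw [mem_cube]
    linarith [dist_triangle u x z, mem_cube.1 hu, hsub x hx]
  have had : 0 < a ^ d := pow_pos ha d
  rw [hun, ← le_div_iff₀ had, ← div_pow] at hle
  refine hle.trans (le_of_eq ?_)
  congr 1
  field_simp
  ring

lemma packing_le_of_forall {E : Set (Pt d)} {a X : ℝ}
    (h : ∀ Z : Finset (Pt d), (Z : Set (Pt d)) ⊆ E → Spread Z a → (Z.card : ℝ) ≤ X) :
    packing E a ≤ ENNReal.ofReal X := by
  have hX : 0 ≤ X := by
    simpa using h ∅ (by simp) (fun x hx => by simp at hx)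
  have hnat : Metric.packingNumber a.toNNReal E ≤ (⌊X⌋₊ : ℕ∞) := by
    refine iSup₂_le fun C hC => iSup_le fun hsep => ?_
    have hfin : ∀ Z : Finset (Pt d), (Z : Set (Pt d)) ⊆ C → Z.card ≤ ⌊X⌋₊ := fun Z hZ =>
      Nat.le_floor (h Z (hZ.trans hC) ((isSeparated_iff_spread Z a).1 (hsep.subset hZ)))
    rcases C.finite_or_infinite with hf | hi
    · rw [hf.encard_eq_coe_toFinset_card]
      exact_mod_cast hfin hf.toFinset (by simp)
    · obtain ⟨Z, hZ, hcard⟩ := hi.exists_subset_card_eq (⌊X⌋₊ + 1)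
      have := hfin Z hZ
      omega
  calc packing E a ≤ ((⌊X⌋₊ : ℕ∞) : ℝ≥0∞) := ENat.toENNReal_mono hnat
    _ = ENNReal.ofReal (⌊X⌋₊ : ℝ) := by simp
    _ ≤ _ := ENNReal.ofReal_le_ofReal (Nat.floor_le hX)

lemma packing_le_of_subset_ball {E : Set (Pt d)} {z : Pt d} {ρ : ℝ} (hρ : 0 ≤ ρ)
    (hE : E ⊆ Metric.closedBall z ρ) {a : ℝ} (ha : 0 < a) :
    packing E a ≤ ENNReal.ofReal ((1 + 2 * ρ / a) ^ d) :=
  packing_le_of_forall fun _ hZ hs => hs.card_le ha hρ fun _ hx => hE (hZ hx)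

lemma packing_mono {E E' : Set (Pt d)} (h : E ⊆ E') (a : ℝ) : packing E a ≤ packing E' a := by
  refine ENat.toENNReal_mono (iSup₂_le fun C hC => iSup_le fun hsep => ?_)
  exact hsep.encard_le_packingNumber (hC.trans h)

lemma packing_union_le (E E' : Set (Pt d)) (a : ℝ) :
    packing (E ∪ E') a ≤ packing E a + packing E' a := by
  rw [packing, packing, packing, ← ENat.toENNReal_add]
  refine ENat.toENNReal_mono (iSup₂_le fun C hC => iSup_le fun hsep => ?_)
  have : C = (C ∩ E) ∪ (C ∩ E') := by rw [← inter_union_distrib_left, inter_eq_left.2 hC]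
  calc C.encard = ((C ∩ E) ∪ (C ∩ E')).encard := by rw [← this]
    _ ≤ (C ∩ E).encard + (C ∩ E').encard := encard_union_le _ _
    _ ≤ _ := add_le_add
      ((hsep.subset inter_subset_left).encard_le_packingNumber inter_subset_right)
      ((hsep.subset inter_subset_left).encard_le_packingNumber inter_subset_right)

/-- A packing at a small scale yields one at a larger scale, with the volumetric loss. -/
lemma exists_spread_of_le_packing {E : Set (Pt d)} (hE : Bornology.IsBounded E) {r ρ X : ℝ}
    (hr : 0 < r) (hrρ : r ≤ ρ) (hX : ENNReal.ofReal X ≤ packing E r) :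
    ∃ Z : Finset (Pt d), (Z : Set (Pt d)) ⊆ E ∧ Spread Z ρ ∧ X ≤ Z.card * (3 * ρ / r) ^ d := by
  classical
  have hρ : 0 < ρ := hr.trans_le hrρ
  obtain ⟨R, hR⟩ := hE.subset_closedBall 0
  have hR' : E ⊆ Metric.closedBall 0 (max R 0) :=
    hR.trans (Metric.closedBall_subset_closedBall (le_max_left _ _))
  have hfin : ∀ a : ℝ, 0 < a → Metric.packingNumber a.toNNReal E ≠ ⊤ := by
    intro a ha htop
    have := packing_le_of_subset_ball (le_max_right R 0) hR' ha
    rw [packing, htop] at this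
    simp at this
  obtain ⟨C, hCE, hCf, hCs, hCn⟩ := Metric.exists_set_encard_eq_packingNumber (hfin r hr)
  lift C to Finset (Pt d) using hCf
  rw [isSeparated_iff_spread C r] at hCs
  have hXC : X ≤ C.card := by
    rw [packing, ← hCn, encard_coe_eq_coe_finsetCard] at hX
    have : ENNReal.ofReal X ≤ ENNReal.ofReal (C.card : ℝ) := by simpa using hX
    exact (ENNReal.ofReal_le_ofReal_iff (Nat.cast_nonneg _)).1 this
  have hcov := Metric.isCover_maximalSeparatedSet (hfin ρ hρ)
  have hDn := Metric.encard_maximalSeparatedSet (hfin ρ hρ)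
  have hDs := Metric.isSeparated_maximalSeparatedSet (ε := ρ.toNNReal) (A := E)
  have hDE := Metric.maximalSeparatedSet_subset (ε := ρ.toNNReal) (A := E)
  have hDf : (Metric.maximalSeparatedSet ρ.toNNReal E).Finite :=
    encard_ne_top_iff.1 (hDn ▸ hfin ρ hρ)
  generalize Metric.maximalSeparatedSet ρ.toNNReal E = D at *
  lift D to Finset (Pt d) using hDf
  rw [isSeparated_iff_spread D ρ] at hDs
  refine ⟨D, hDE, hDs, hXC.trans ?_⟩
  have hsub : C ⊆ D.biUnion fun y => C.filter fun x => dist x y ≤ ρ := by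
    intro x hx
    obtain ⟨y, hy, hxy⟩ := hcov (hCE hx)
    refine Finset.mem_biUnion.2 ⟨y, hy, Finset.mem_filter.2 ⟨hx, ?_⟩⟩
    have h1 : edist x y ≤ ENNReal.ofReal ρ := hxy
    rwa [edist_dist, ENNReal.ofReal_le_ofReal_iff hρ.le] at h1
  have hone : ∀ y ∈ D, ((C.filter fun x => dist x y ≤ ρ).card : ℝ) ≤ (3 * ρ / r) ^ d := by
    intro y _
    have hs : Spread (C.filter fun x => dist x y ≤ ρ) r := fun x hx x' hx' hne =>
      hCs x (Finset.mem_filter.1 hx).1 x' (Finset.mem_filter.1 hx').1 hne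
    refine (hs.card_le hr hρ.le fun x hx => (Finset.mem_filter.1 hx).2).trans ?_
    have h1 : 1 ≤ ρ / r := (one_le_div hr).2 hrρ
    have h2 : 1 + 2 * ρ / r ≤ 3 * ρ / r := by
      rw [mul_div_assoc, mul_div_assoc]; linarith
    gcongr
  calc (C.card : ℝ) ≤ ((D.biUnion fun y => C.filter fun x => dist x y ≤ ρ).card : ℝ) := by
        exact_mod_cast Finset.card_le_card hsub
    _ ≤ ∑ y ∈ D, ((C.filter fun x => dist x y ≤ ρ).card : ℝ) := by
        exact_mod_cast Finset.card_biUnion_le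
    _ ≤ ∑ _y ∈ D, (3 * ρ / r) ^ d := Finset.sum_le_sum hone
    _ = _ := by simp

lemma one_add_pow_le {t : ℝ} (ht : 0 ≤ t) (d : ℕ) : (1 + t) ^ d ≤ 2 ^ d * (1 + t ^ d) := by
  have h1 : (1 + t) ^ d ≤ (2 * max 1 t) ^ d := by
    gcongr
    have := le_max_left 1 t
    have := le_max_right 1 t
    linarith
  rw [mul_pow] at h1
  refine h1.trans ?_
  gcongr
  rcases max_choice 1 t with h | h <;> rw [h]
  · simp; positivity
  · linarith

/-- Keeping `Q` free allows `ρ ^ d` to be replaced by a multiple of `ε ^ β` in the applications. -/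
lemma packing_ball_le {E : Set (Pt d)} {z : Pt d} {ρ : ℝ} (hρ : 0 ≤ ρ)
    (hE : E ⊆ Metric.closedBall z ρ) {a : ℝ} (ha : 0 < a) {Q : ℝ} (hQ : ρ ^ d ≤ Q) :
    packing E a ≤ ENNReal.ofReal (4 ^ d * (1 + Q / a ^ d)) := by
  refine (packing_le_of_subset_ball hρ hE ha).trans (ENNReal.ofReal_le_ofReal ?_)
  refine (one_add_pow_le (by positivity) d).trans ?_
  have h0 : (0 : ℝ) ≤ ρ ^ d := by positivity
  have had := pow_pos ha d
  have h2 : (1 : ℝ) ≤ 2 ^ d := one_le_pow₀ (by norm_num)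
  have h4 : (4 : ℝ) ^ d = 2 ^ d * 2 ^ d := by rw [← mul_pow]; norm_num
  rw [h4, mul_assoc]
  refine mul_le_mul_of_nonneg_left ?_ (by positivity)
  rw [div_pow, mul_pow, mul_add, mul_div_assoc]
  have : ρ ^ d / a ^ d ≤ Q / a ^ d := by gcongr
  have : 2 ^ d * (ρ ^ d / a ^ d) ≤ 2 ^ d * (Q / a ^ d) := by gcongr
  linarith

namespace PertSetup

variable {S : Set (Pt d)} {A M α L G η m₀ : ℝ} {n : ℕ} {r r' : ℝ} {χ f₀ : Pt d → ℝ} {z : Pt d}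

/-- The packing bound for sublevel sets is inherited by the perturbed functions; only the bound
at levels above the depth of the dip is needed. -/
lemma sublevelUpper {c' β C₁ : ℝ}
    (h : PertSetup S A M α L G η (minValue S A f₀) n r (c' * r) χ f₀ z) (hA : 0 < A)
    (hc' : 0 < c') (hβ : 0 ≤ β) (hαβ : α * β ≤ d) (hr1 : 8 ^ n * r ≤ 1)
    (hC₁ : ∀ a > 0, ∀ ε > 0, η * (c' * r) ^ α ≤ ε →
      packing (sublevel S A f₀ ε) a ≤ ENNReal.ofReal (C₁ * (1 + ε ^ β / a ^ d))) :
    SublevelUpper S A (perturbed χ f₀ α η (minValue S A f₀) n r (c' * r) z)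
      (max C₁ 0 + 4 ^ d *
        (1 + ((1 / (η / (4 * d))) ^ (1 / α) + 8 ^ n * (1 / (η * c' ^ α)) ^ (1 / α))) ^ d) β := by
  intro a ha ε hε
  have hr := h.r_pos
  have hd' : (0 : ℝ) < d := by exact_mod_cast h.hd
  have hη := h.hη
  have hα := h.hα
  set κ := η / (4 * (d : ℝ)) with hκ
  have hκ0 : 0 < κ := by positivity
  set k₁ := (1 / κ) ^ (1 / α) with hk₁
  set k₂ := 8 ^ n * (1 / (η * c' ^ α)) ^ (1 / α) with hk₂
  have hk₁0 : 0 ≤ k₁ := by positivity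
  have hk₂0 : 0 ≤ k₂ := by positivity
  have hεα : 0 ≤ ε ^ (1 / α) := by positivity
  -- The cap at `1`, available from `8 ^ n * r ≤ 1`, serves the levels `ε ≥ 1`, at which `ε ^ (d /
  -- α)` need not be bounded by `ε ^ β`.
  set ρ := min 1 ((k₁ + k₂) * ε ^ (1 / α)) with hρdef
  have hρ0 : 0 ≤ ρ := by positivity
  have hscale : η * (c' * r) ^ α ≤ ε → 8 ^ n * r ≤ k₂ * ε ^ (1 / α) := by
    intro hle
    rw [Real.mul_rpow hc'.le hr.le, ← mul_assoc] at hle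
    have hp : 0 < η * c' ^ α := by positivity
    have h1 : r ^ α ≤ 1 / (η * c' ^ α) * ε := by
      rw [one_div, ← div_eq_inv_mul, le_div_iff₀ hp]; linarith
    have h2 := Real.rpow_le_rpow (by positivity) h1 (by positivity : 0 ≤ 1 / α)
    rw [← Real.rpow_mul hr.le, mul_one_div_cancel hα.ne', Real.rpow_one,
      Real.mul_rpow (by positivity) hε.le] at h2
    rw [hk₂, mul_assoc]
    gcongr
  set B : Set (Pt d) := Metric.closedBall z ρ with hB
  have hsplit : ∀ x ∈ sublevel S A (perturbed χ f₀ α η (minValue S A f₀) n r (c' * r) z) ε,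
      (η * (c' * r) ^ α ≤ ε ∧ x ∈ sublevel S A f₀ ε) ∨ x ∈ B := by
    intro x hx
    rcases h.mem_sublevel hA hx with ⟨h1, h2, h3⟩ | ⟨h1, h2⟩
    · exact Or.inl ⟨h1, h2, h3⟩
    · right
      rw [hB, Metric.mem_closedBall, hρdef, le_min_iff]
      refine ⟨h1.trans hr1, ?_⟩
      rw [add_mul]
      have p1 : 0 ≤ k₁ * ε ^ (1 / α) := by positivity
      have p2 : 0 ≤ k₂ * ε ^ (1 / α) := by positivity
      rcases h2 with h2 | h2
      · linarith [hscale h2]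
      · rw [← hκ] at h2
        have : (ε / κ) ^ (1 / α) = k₁ * ε ^ (1 / α) := by
          rw [hk₁, ← Real.mul_rpow (by positivity) hε.le]
          congr 1
          ring
        linarith
  -- For `ε < 1` the exponents compare by `α * β ≤ d`; for `ε ≥ 1` the cap gives `ρ ^ d ≤ 1 ≤ ε ^
  -- β`.
  have hρd : ρ ^ d ≤ (1 + (k₁ + k₂)) ^ d * ε ^ β := by
    have hone : 1 ≤ (1 + (k₁ + k₂)) ^ d := one_le_pow₀ (by linarith)
    rcases le_or_gt 1 ε with h1 | h1
    · have h2 : ρ ^ d ≤ 1 := pow_le_one₀ hρ0 (min_le_left _ _)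
      have h3 : 1 ≤ ε ^ β := Real.one_le_rpow h1 hβ
      nlinarith
    · have h2 : ρ ^ d ≤ ((1 + (k₁ + k₂)) * ε ^ (1 / α)) ^ d := by
        refine pow_le_pow_left₀ hρ0 ((min_le_right _ _).trans ?_) d
        exact mul_le_mul_of_nonneg_right (by linarith) hεα
      rw [mul_pow, ← Real.rpow_natCast (ε ^ (1 / α)), ← Real.rpow_mul hε.le] at h2
      have h3 : ε ^ (1 / α * d) ≤ ε ^ β := by
        refine Real.rpow_le_rpow_of_exponent_ge hε h1.le ?_
        rw [one_div, ← div_eq_inv_mul, le_div_iff₀ hα]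
        linarith
      refine h2.trans ?_
      gcongr
  have hball : packing B a ≤ ENNReal.ofReal (4 ^ d * (1 + (k₁ + k₂)) ^ d * (1 + ε ^ β / a ^ d)) := by
    refine (packing_ball_le hρ0 subset_rfl ha hρd).trans (ENNReal.ofReal_le_ofReal ?_)
    rw [mul_assoc]
    refine mul_le_mul_of_nonneg_left ?_ (by positivity)
    rw [mul_add, mul_one, mul_div_assoc]
    have hone : 1 ≤ (1 + (k₁ + k₂)) ^ d := one_le_pow₀ (by linarith)
    linarith
  have hq : 0 ≤ 1 + ε ^ β / a ^ d := by positivity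
  rw [add_mul, ENNReal.ofReal_add (mul_nonneg (le_max_right _ _) hq) (by positivity)]
  -- Above the depth of the dip the set may contain a piece of the sublevel set of `f₀`; below it
  -- everything lies in the ball, so nothing is required of `f₀`.
  by_cases hlev : η * (c' * r) ^ α ≤ ε
  · refine (packing_mono (E' := sublevel S A f₀ ε ∪ B) (fun x hx => ?_) a).trans
      ((packing_union_le _ _ a).trans (add_le_add ?_ hball))
    · exact (hsplit x hx).imp And.right id
    · refine (hC₁ a ha ε hε hlev).trans (ENNReal.ofReal_le_ofReal ?_)
      exact mul_le_mul_of_nonneg_right (le_max_left _ _) hq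
  · refine (packing_mono (E' := B) (fun x hx => ?_) a).trans (hball.trans le_add_self)
    exact (hsplit x hx).resolve_left fun h => hlev h.1

end PertSetup

/-- At levels bounded below, the packing bound holds on any bounded set. -/
lemma exists_packing_sublevel_le {S : Set (Pt d)} (hS : Bornology.IsBounded S) (A : ℝ)
    (f : Pt d → ℝ) {β h : ℝ} (hβ : 0 ≤ β) (hh : 0 < h) :
    ∃ C₁ : ℝ, ∀ a > 0, ∀ ε > 0, h ≤ ε →
      packing (sublevel S A f ε) a ≤ ENNReal.ofReal (C₁ * (1 + ε ^ β / a ^ d)) := by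
  obtain ⟨R, hR⟩ := hS.subset_closedBall 0
  refine ⟨4 ^ d * (1 + max R 0 ^ d / h ^ β), fun a ha ε hε hle => ?_⟩
  have hsub : sublevel S A f ε ⊆ Metric.closedBall 0 (max R 0) := fun x hx =>
    Metric.closedBall_subset_closedBall (le_max_left _ _) (hR hx.1)
  have hhβ : 0 < h ^ β := Real.rpow_pos_of_pos hh β
  have hmono : h ^ β ≤ ε ^ β := Real.rpow_le_rpow hh.le hle hβ
  have hQ : max R 0 ^ d ≤ max R 0 ^ d / h ^ β * ε ^ β := by
    rw [div_mul_eq_mul_div, le_div_iff₀ hhβ]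
    gcongr
  refine (packing_ball_le (le_max_right R 0) hsub ha hQ).trans (ENNReal.ofReal_le_ofReal ?_)
  rw [mul_assoc]
  refine mul_le_mul_of_nonneg_left ?_ (by positivity)
  have h1 : 0 ≤ max R 0 ^ d / h ^ β := by positivity
  have h2 : 0 ≤ ε ^ β / a ^ d := by positivity
  rw [mul_div_assoc]
  nlinarith

/-! ### Assembly -/

lemma minValue_le {S : Set (Pt d)} {A : ℝ} {f : Pt d → ℝ} (h : HasOptimizer S A f) {x : Pt d}
    (hx : x ∈ domain S A) : minValue S A f ≤ f x := by
  obtain ⟨y, _, hy⟩ := h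
  refine csInf_le ⟨f y, ?_⟩ ⟨x, hx, rfl⟩
  rintro _ ⟨u, hu, rfl⟩
  exact hy u hu

/-- Almost-minimisers in a compact set are close to minimisers. -/
lemma exists_minimiser_near {S : Set (Pt d)} (hS : IsCompact S) {A K α : ℝ} (hA : 0 < A)
    (hα : 0 < α) {f₀ : Pt d → ℝ} (hopt : HasOptimizer S A f₀) (hb : MeanSmooth S A f₀ K α)
    {ρ : ℝ} (hρ : 0 < ρ) :
    ∃ ε₁ > 0, ∀ z ∈ S, f₀ z - minValue S A f₀ < ε₁ →
      ∃ x₀ ∈ S, f₀ x₀ = minValue S A f₀ ∧ dist z x₀ ≤ ρ := by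
  by_contra! hcon
  set m₀ := minValue S A f₀ with hm₀
  have hpos : ∀ k : ℕ, (0 : ℝ) < 1 / (k + 1) := fun k => by positivity
  choose z hzS hz hfar using fun k : ℕ => hcon (1 / (k + 1)) (hpos k)
  obtain ⟨x, hxS, φ, hφ, hlim⟩ := hS.tendsto_subseq hzS
  have hsmall : Tendsto (fun k : ℕ => f₀ (z (φ k)) - m₀) atTop (𝓝 0) := by
    refine squeeze_zero (fun k => ?_) (fun k => (hz (φ k)).le)
      (tendsto_one_div_add_atTop_nhds_zero_nat.comp hφ.tendsto_atTop)
    linarith [minValue_le hopt (subset_domain hA.le (hzS (φ k)))]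
  have hdist : Tendsto (fun k => dist (z (φ k)) x) atTop (𝓝 0) :=
    (tendsto_iff_dist_tendsto_zero).1 hlim
  -- No continuity is available. The cube of side `a` around the limit is compared with the cube of
  -- side `2 * a` around a nearby almost-minimiser; then `k → ∞` and `a → 0` show that the limit is
  -- a minimiser.
  have hbound : ∀ a ∈ Ioo 0 (A / 2),
      f₀ x - m₀ ≤ K * a ^ α + 2 ^ d * (K * (2 * a) ^ α) := by
    intro a ha
    have h1 : Tendsto (fun k : ℕ => K * a ^ α + 2 ^ d * ((f₀ (z (φ k)) - m₀) + K * (2 * a) ^ α))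
        atTop (𝓝 (K * a ^ α + 2 ^ d * (0 + K * (2 * a) ^ α))) :=
      ((hsmall.add_const _).const_mul _).const_add _
    rw [zero_add] at h1
    refine ge_of_tendsto h1 ?_
    filter_upwards [hdist.eventually_le_const (half_pos ha.1)] with k hk
    have h2a : 2 * a ∈ Ioo 0 A := ⟨by linarith [ha.1], by linarith [ha.2]⟩
    have := le_of_meanClose (g := fun u => f₀ u - m₀) ha.1 h2a.1 (fun u hu => ?_) (fun u hu => ?_)
      ((hb x hxS a ⟨ha.1, by linarith [ha.2]⟩).sub_const ha.1 m₀)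
      ((hb _ (hzS (φ k)) (2 * a) h2a).sub_const h2a.1 m₀)
    · rwa [mul_div_assoc, div_self ha.1.ne', mul_one] at this
    · exact sub_nonneg.2 (minValue_le hopt (cube_subset_domain (hzS _) h2a.2.le hu))
    · rw [mem_cube] at hu ⊢
      linarith [dist_triangle_right u (z (φ k)) x]
  have hx0 : f₀ x - m₀ ≤ 0 := by
    have hc : Tendsto (fun a : ℝ => K * a ^ α + 2 ^ d * (K * (2 * a) ^ α)) (𝓝[>] 0)
        (𝓝 (K * 0 ^ α + 2 ^ d * (K * (2 * 0) ^ α))) := by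
      have h1 : Continuous fun a : ℝ => K * a ^ α + 2 ^ d * (K * (2 * a) ^ α) := by
        have h2 : Continuous fun a : ℝ => a ^ α := Real.continuous_rpow_const hα.le
        have h3 : Continuous fun a : ℝ => (2 * a) ^ α := h2.comp (continuous_const_mul 2)
        fun_prop
      exact (h1.tendsto 0).mono_left nhdsWithin_le_nhds
    rw [mul_zero, Real.zero_rpow hα.ne', mul_zero, mul_zero, add_zero] at hc
    refine ge_of_tendsto hc ?_
    filter_upwards [Ioo_mem_nhdsGT (half_pos hA)] with a ha using hbound a ha
  have hxm : f₀ x = m₀ := by linarith [minValue_le hopt (subset_domain hA.le hxS)]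
  obtain ⟨k, hk⟩ := (hdist.eventually_lt_const hρ).exists
  exact absurd (hfar (φ k) x hxS hxm) (not_lt.2 hk.le)

/-- Regularity of `f₀` near an almost-minimiser `z`, at all scales `s` with `f₀ z - min ≤ s ^ α`. -/
lemma regularAt_of_near_minimiser {S : Set (Pt d)} {A K α δ : ℝ} (hK : 0 ≤ K) (hδA : δ ≤ A / 2)
    {f₀ : Pt d → ℝ} (hopt : HasOptimizer S A f₀) {x₀ z : Pt d} (hz : z ∈ S)
    (hloc : ∀ y ∈ cube x₀ δ, ∀ a ∈ Ioo 0 δ, MeanClose f₀ K α y a)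
    (hnear : dist z x₀ ≤ δ / 4) {s : ℝ} (hs : 0 < s) (hsδ : 26 * s ≤ δ)
    (hgz : f₀ z - minValue S A f₀ ≤ s ^ α) :
    RegularAt (fun x => f₀ x - minValue S A f₀) z (K + 13 ^ d * (1 + K * 13 ^ α)) α s := by
  have hmem : ∀ y, dist y z ≤ 6 * s → y ∈ cube x₀ δ := fun y hy => by
    rw [mem_cube]; linarith [dist_triangle y z x₀]
  have hmean : ∀ y, dist y z ≤ 6 * s → ∀ a ∈ Ioo 0 δ,
      MeanClose (fun x => f₀ x - minValue S A f₀) K α y a :=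
    fun y hy a ha => (hloc y (hmem y hy) a ha).sub_const ha.1 _
  have hdom : ∀ u ∈ cube z (13 * s), 0 ≤ f₀ u - minValue S A f₀ := fun u hu =>
    sub_nonneg.2 (minValue_le hopt (cube_subset_domain hz (by linarith) hu))
  refine ⟨fun u hu => ?_, fun y hy a ha has => ?_⟩
  · rw [Metric.mem_closedBall] at hu
    rw [abs_of_nonneg (hdom u (mem_cube.2 (by linarith)))]
    -- A cube of side `s` around a point within `6 * s` of `z` lies in the cube of side `13 * s`
    -- around `z`, hence the factor `13 ^ d`.
    have h1 := le_of_meanClose hs (by positivity : 0 < 13 * s) hdom (fun v hv => ?_)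
      (hmean u hu s ⟨hs, by linarith⟩)
      (hmean z (by rw [dist_self]; positivity) (13 * s) ⟨by positivity, by linarith⟩)
    · refine h1.trans ?_
      rw [mul_div_assoc, div_self hs.ne', mul_one, Real.mul_rpow (by norm_num) hs.le]
      have : (13 : ℝ) ^ d * (f₀ z - minValue S A f₀ + K * (13 ^ α * s ^ α)) ≤
          13 ^ d * (s ^ α + K * (13 ^ α * s ^ α)) := by gcongr
      refine (add_le_add_right this _).trans (le_of_eq ?_)
      ring
    · rw [mem_cube] at hv ⊢
      linarith [dist_triangle v u z]
  · rw [Metric.mem_closedBall] at hy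
    refine (hmean y (by linarith) a ⟨ha, by linarith⟩).2.trans ?_
    have : 0 ≤ (13 : ℝ) ^ d * (1 + K * 13 ^ α) := by positivity
    have haα : 0 ≤ a ^ α := Real.rpow_nonneg ha.le α
    nlinarith

/-- All constants are fixed before `r`, so the resulting bounds are uniform in the scale. Points at
level `r ^ α` are near minimisers, which provides regularity at every scale `8 ^ k * r` with one
common `G`. -/
lemma exists_pertSetup {S : Set (Pt d)} (hd : 0 < d) (hS : IsCompact S) {A M α β : ℝ}
    (hA : 0 < A) (hM : 0 < M) (hα : 0 < α) (hα2 : α ≤ 2) (hαβ : α * β ≤ d)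
    {f₀ : Pt d → ℝ} (hmeas : Measurable f₀) (hopt : HasOptimizer S A f₀)
    (ha : BoundedGap S A f₀ (M / 2)) (hb : MeanSmooth S A f₀ (M / 2) α)
    (hc : SublevelLower S A f₀ β)
    (hreg : ∃ δ K : ℝ, 0 < δ ∧ δ ≤ A / 2 ∧ ∀ x₀ ∈ S, f₀ x₀ = minValue S A f₀ →
      ∀ y ∈ cube x₀ δ, ∀ a ∈ Ioo 0 δ, MeanClose f₀ K α y a) :
    ∃ (χ : Pt d → ℝ) (L G η c' c₀ : ℝ) (n : ℕ), 0 ≤ G ∧ 0 < η ∧ 0 < c' ∧ c' ≤ 1 ∧ 0 < c₀ ∧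
      ∀ᶠ r in 𝓝[>] (0 : ℝ), 8 ^ n * r ≤ 1 ∧ ∃ Z : Finset (Pt d), 2 ≤ Z.card ∧
        Spread Z (4 * (c' * r)) ∧ c₀ * r ^ (α * β) ≤ Z.card * (12 * c' * r) ^ d ∧
        ∀ z ∈ Z, PertSetup S A M α L G η (minValue S A f₀) n r (c' * r) χ f₀ z := by
  obtain ⟨δ, K₀, hδ, hδA, hloc⟩ := hreg
  set K := |K₀| with hK
  have hloc' : ∀ x₀ ∈ S, f₀ x₀ = minValue S A f₀ →
      ∀ y ∈ cube x₀ δ, ∀ a ∈ Ioo 0 δ, MeanClose f₀ K α y a := fun x₀ h1 h2 y hy a ha' => by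
    obtain ⟨h3, h4⟩ := hloc x₀ h1 h2 y hy a ha'
    refine ⟨h3, h4.trans ?_⟩
    exact mul_le_mul_of_nonneg_right (le_abs_self _) (Real.rpow_nonneg ha'.1.le α)
  obtain ⟨c₀, hc₀, ε₀, hε₀, hlow⟩ := hc
  obtain ⟨ε₁, hε₁, hnear⟩ := exists_minimiser_near hS hA hα hopt hb (by positivity : 0 < δ / 4)
  obtain ⟨χ, L, hL, hχ⟩ := exists_isCutoff d
  set G := K + 13 ^ d * (1 + K * 13 ^ α) with hG
  have hG0 : 0 ≤ G := by positivity
  -- Enough scales to bring the averaged flattening error below `M / 4`.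
  obtain ⟨n, hn⟩ := exists_nat_gt
    (((L * (3 + 13 * d) + 2 * (8 ^ α / (8 ^ α - 1))) * G) / (M / 4))
  have h8 : (1 : ℝ) < 8 ^ α := Real.one_lt_rpow (by norm_num) hα
  have hcoef : 0 ≤ L * (3 + 13 * d) + 2 * (8 ^ α / (8 ^ α - 1)) := by
    have : 0 ≤ (8 : ℝ) ^ α / (8 ^ α - 1) := div_nonneg (by linarith) (by linarith)
    positivity
  have hn0 : 0 < n := by
    have : (0 : ℝ) < n := lt_of_le_of_lt (by positivity) hn
    exact_mod_cast this
  rw [div_lt_iff₀ (by positivity)] at hn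
  set C := L * (3 + 13 * d) + 2 with hC
  have hC2 : 2 ≤ C := by
    have : 0 ≤ L * (3 + 13 * d) := by positivity
    linarith
  set η := M / (40 * C) with hη
  have hη0 : 0 < η := by positivity
  -- Chosen to make `(12 * c') ^ d ≤ c₀ / 2`, which forces at least two points in `Z`. The factor
  -- `12` is `3` from coarsening a packing times `4` from the separation.
  set c' := min (c₀ / 2) 1 / 12 with hc'
  have hmin : 0 < min (c₀ / 2) 1 := by positivity
  have hc'0 : 0 < c' := by positivity
  have hc'1 : c' ≤ 1 := by
    have := min_le_right (c₀ / 2) 1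
    rw [hc']; linarith
  have hc'd : (12 * c') ^ d ≤ c₀ / 2 := by
    have e : 12 * c' = min (c₀ / 2) 1 := by rw [hc']; ring
    rw [e]
    exact (pow_le_of_le_one hmin.le (min_le_right _ _) hd.ne').trans (min_le_left _ _)
  refine ⟨χ, L, G, η, c', c₀, n, hG0, hη0, hc'0, hc'1, hc₀, ?_⟩
  have hpow : Tendsto (fun r : ℝ => r ^ α) (𝓝[>] 0) (𝓝 0) := by
    have := (Real.continuous_rpow_const hα.le).tendsto 0
    rw [Real.zero_rpow hα.ne'] at this
    exact this.mono_left nhdsWithin_le_nhds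
  have hlin : Tendsto (fun r : ℝ => 8 ^ n * r) (𝓝[>] 0) (𝓝 0) := by
    have := (continuous_const_mul ((8 : ℝ) ^ n)).tendsto 0
    rw [mul_zero] at this
    exact this.mono_left nhdsWithin_le_nhds
  filter_upwards [self_mem_nhdsWithin, hpow.eventually_lt_const hε₀, hpow.eventually_lt_const hε₁,
    hlin.eventually_le_const zero_lt_one, hlin.eventually_le_const (by positivity : 0 < δ / 26)]
    with r hr h1 h2 h3 h4
  have hr : 0 < r := hr
  have h8n : (1 : ℝ) ≤ 8 ^ n := one_le_pow₀ (by norm_num)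
  have hr1 : r ≤ 1 := (le_mul_of_one_le_left hr.le h8n).trans h3
  have hrα : 0 < r ^ α := Real.rpow_pos_of_pos hr α
  refine ⟨h3, ?_⟩
  obtain ⟨r₁, hr₁, hpack⟩ := hlow (r ^ α) ⟨hrα, h1⟩
  -- The lower packing bound is available only below a threshold depending on the level. It is used
  -- at the tiny scale `q` and transferred up to `4 * c' * r`; `q` cancels from the resulting count.
  set q := min (r₁ / 2) (4 * (c' * r)) with hq
  have hq0 : 0 < q := by positivity
  have hqr : q < r₁ := lt_of_le_of_lt (min_le_left _ _) (by linarith)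
  have hbdd : Bornology.IsBounded (sublevel S A f₀ (r ^ α)) :=
    hS.isBounded.subset fun x hx => hx.1
  obtain ⟨Z, hZE, hZs, hZc⟩ := exists_spread_of_le_packing hbdd hq0 (min_le_right _ _)
    (hpack q ⟨hq0, hqr⟩)
  have hcount : c₀ * r ^ (α * β) ≤ Z.card * (12 * c' * r) ^ d := by
    rw [← Real.rpow_mul hr.le, div_pow, ← mul_div_assoc, ← mul_div_assoc,
      div_le_div_iff_of_pos_right (pow_pos hq0 d)] at hZc
    refine hZc.trans (le_of_eq ?_)
    congr 2
    ring
  refine ⟨Z, ?_, hZs, hcount, fun z hz => ?_⟩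
  · have h5 : r ^ (d : ℝ) ≤ r ^ (α * β) := Real.rpow_le_rpow_of_exponent_ge hr hr1 hαβ
    rw [Real.rpow_natCast] at h5
    rw [mul_pow] at hcount
    have h6 : c₀ * r ^ d ≤ Z.card * (c₀ / 2) * r ^ d := by
      calc c₀ * r ^ d ≤ c₀ * r ^ (α * β) := by gcongr
        _ ≤ _ := hcount
        _ ≤ Z.card * (c₀ / 2 * r ^ d) := by gcongr
        _ = _ := by ring
    have h7 := le_of_mul_le_mul_right h6 (pow_pos hr d)
    have h8 : (2 : ℝ) ≤ Z.card :=
      le_of_mul_le_mul_right (by linarith : 2 * (c₀ / 2) ≤ Z.card * (c₀ / 2)) (half_pos hc₀)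
    exact_mod_cast h8
  · obtain ⟨hzS, hzε⟩ := hZE hz
    obtain ⟨x₀, hx₀S, hx₀, hzx⟩ := hnear z hzS (hzε.trans h2)
    refine ⟨hd, hα, hα2, hL, hχ, hG0, hη0, hn0, by positivity, ?_, hmeas, hzS,
      fun x hx => minValue_le hopt hx, fun x hx => ha x hx, hb, fun k hk => ?_, hn.le, ?_, ?_⟩
    · exact mul_le_of_le_one_left hr.le hc'1
    · have hk1 : (1 : ℝ) ≤ 8 ^ k := one_le_pow₀ (by norm_num)
      have hkn : (8 : ℝ) ^ k ≤ 8 ^ n := pow_le_pow_right₀ (by norm_num) hk.le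
      refine regularAt_of_near_minimiser (abs_nonneg _) hδA hopt hzS (hloc' x₀ hx₀S hx₀) hzx
        (by positivity) ?_ ?_
      · have : 8 ^ k * r ≤ 8 ^ n * r := by gcongr
        linarith
      · exact hzε.le.trans
          (Real.rpow_le_rpow hr.le (le_mul_of_one_le_left hr.le hk1) hα.le)
    · rw [← hC, hη]
      refine le_of_eq ?_
      field_simp
      norm_num
    · have h9 : (c' * r) ^ α ≤ 1 := Real.rpow_le_one (by positivity)
        (mul_le_one₀ hc'1 hr.le hr1) hα.le
      have h10 : η ≤ M / 2 := by
        rw [hη]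
        exact div_le_div_of_nonneg_left hM.le two_pos (by linarith)
      calc η * (c' * r) ^ α ≤ η * 1 := by gcongr
        _ ≤ _ := by linarith

/-- A class of functions which contains all the perturbed functions of scale `r` has large minimax
regret at horizons up to about `r ^ (-(d + 2 α - α β))`. -/
lemma le_minimaxAvgRegret {S : Set (Pt d)} {A M α β L G η c' c₀ : ℝ} {n : ℕ} {r : ℝ}
    {χ f₀ : Pt d → ℝ} (hA : 0 < A) (hc' : 0 < c') (hr : 0 < r) {Z : Finset (Pt d)} (hZ : 2 ≤ Z.card) (hs : Spread Z (4 * (c' * r)))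
    (hcount : c₀ * r ^ (α * β) ≤ Z.card * (12 * c' * r) ^ d)
    (hp : ∀ z ∈ Z, PertSetup S A M α L G η (minValue S A f₀) n r (c' * r) χ f₀ z)
    (hmeas : Measurable f₀) {T : ℕ} (hT : 0 < T)
    (hrT : 20 * ((G * (8 ^ n) ^ α + η) ^ 2 * (1 + 8 ^ n / (2 * c')) ^ d) * (12 * c') ^ d *
      (r ^ (d + 2 * α - α * β) * T) ≤ c₀)
    {F : Set (Pt d → ℝ)}
    (hF : ∀ z ∈ Z, perturbed χ f₀ α η (minValue S A f₀) n r (c' * r) z ∈ F) :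
    ENNReal.ofReal (η * (c' * r) ^ α / (8 * Real.exp 1)) ≤ minimaxAvgRegret S A F T := by
  refine le_iInf fun σ => ?_
  set Γ := G * (8 ^ n) ^ α + η with hΓ
  set m := (1 + (8 : ℝ) ^ n / (2 * c')) ^ d with hm
  -- Multiplying by `(12 * c' * r) ^ d` brings in the lower bound on the cardinality of `Z`; a
  -- factor `r ^ (α * β)` then splits off and leaves exactly the quantity bounded in `hrT`.
  have hpow : (Γ * r ^ α) ^ 2 * (12 * c' * r) ^ d =
      Γ ^ 2 * (12 * c') ^ d * (r ^ (d + 2 * α - α * β) * r ^ (α * β)) := by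
    rw [← Real.rpow_add hr, sub_add_cancel, Real.rpow_add hr, Real.rpow_natCast, mul_comm 2 α,
      Real.rpow_mul hr.le, Real.rpow_two]
    ring
  have hsmall : 20 * ((Γ * r ^ α) ^ 2 * m * T) ≤ Z.card := by
    have hpos : 0 < (12 * c' * r) ^ d := by positivity
    refine le_of_mul_le_mul_right ?_ hpos
    calc 20 * ((Γ * r ^ α) ^ 2 * m * T) * (12 * c' * r) ^ d =
          20 * m * T * ((Γ * r ^ α) ^ 2 * (12 * c' * r) ^ d) := by ring
      _ = (20 * (Γ ^ 2 * m) * (12 * c') ^ d * (r ^ (d + 2 * α - α * β) * T)) * r ^ (α * β) := by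
          rw [hpow]; ring
      _ ≤ c₀ * r ^ (α * β) := by gcongr
      _ ≤ _ := hcount
  obtain ⟨z, hz, hle⟩ := exists_le_regret σ Z hmeas
    (fun z => perturbed χ f₀ α η (minValue S A f₀) n r (c' * r) z) (fun z hz => (hp z hz).measurable)
    (fun z => Metric.ball z (2 * (c' * r))) (fun z _ => measurableSet_ball)
    (fun x z hz z' hz' hx hx' => by
      by_contra hne
      have := hs z hz z' hz' hne
      rw [Metric.mem_ball] at hx hx'
      linarith [dist_triangle_left z z' x])
    (h := η * (c' * r) ^ α) (Γ := Γ * r ^ α) (m := m) (by positivity)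
    (fun z hz x hx hxz => (hp z hz).gap_le hA hx (not_lt.1 hxz))
    (fun z hz x _ => (hp z hz).abs_perturbed_sub_le x)
    (fun z => Metric.ball z (8 ^ n * r))
    (fun z hz x _ hxz => (hp z hz).perturbed_eq (not_lt.1 hxz))
    -- Centres whose perturbation is visible at `x` are separated at scale `r` inside a ball of
    -- radius `8 ^ n * r`, so their number is bounded independently of `r`.
    (fun x _ Z' hZ' hx => by
      have hs' : Spread Z' (4 * (c' * r)) := fun y hy y' hy' => hs y (hZ' hy) y' (hZ' hy')
      refine (hs'.card_le (z := x) (by positivity) (by positivity : 0 ≤ 8 ^ n * r)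
        fun y hy => ?_).trans (le_of_eq ?_)
      · have := hx y hy
        rw [Metric.mem_ball, dist_comm] at this
        exact this.le
      · rw [hm]
        congr 2
        field_simp
        norm_num) T hZ hsmall
  refine le_trans ?_ (le_iSup₂_of_le _ (hF z hz) le_rfl)
  rwa [ENNReal.le_div_iff_mul_le (Or.inl (by simpa using hT.ne')) (Or.inl (by simp))]

end Bandit

end

/-! ### The main theorem: scale as a function of the horizon -/

theorem theorem3 {d : ℕ} (hd : 0 < d) (S : Set (Bandit.Pt d)) (hS : IsCompact S)
    (A M α β : ℝ) (hA : 0 < A) (hM : 0 < M) (hα : 0 < α) (hα2 : α ≤ 2)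
    (hβ : 0 ≤ β) (hαβ : α * β ≤ d)
    (f₀ : Bandit.Pt d → ℝ) (hmeas : Measurable f₀)
    (hopt : Bandit.HasOptimizer S A f₀)
    (ha : Bandit.BoundedGap S A f₀ (M / 2))
    (hb : Bandit.MeanSmooth S A f₀ (M / 2) α)
    (hc : Bandit.SublevelLower S A f₀ β)
    (hreg : ∃ δ K : ℝ, 0 < δ ∧ δ ≤ A / 2 ∧
      ∀ x₀ ∈ S, f₀ x₀ = Bandit.minValue S A f₀ →
        ∀ y ∈ Bandit.cube x₀ δ, ∀ a ∈ Set.Ioo 0 δ, Bandit.MeanClose f₀ K α y a) :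
    ∃ ε : ℕ → ℝ, (∀ T, 0 < ε T) ∧ Antitone ε ∧
      Filter.Tendsto ε Filter.atTop (nhds 0) ∧
      Bandit.IsOmegaRate
        (fun T => Bandit.minimaxAvgRegret S A
          (⋃ C₀ : ℝ, Bandit.nbhd S A M C₀ α β f₀ (ε T)) T)
        (α / (d + 2 * α - α * β)) ∧
      ∀ C₁ : ℝ, Bandit.SublevelUpper S A f₀ C₁ β →
        ∃ C₀ : ℝ, Bandit.IsOmegaRate
          (fun T => Bandit.minimaxAvgRegret S A (Bandit.nbhd S A M C₀ α β f₀ (ε T)) T)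
          (α / (d + 2 * α - α * β)) := by
  obtain ⟨χ, L, G, η, c', c₀, n, hG, hη, hc', hc'1, hc₀, hev⟩ :=
    Bandit.exists_pertSetup hd hS hA hM hα hα2 hαβ hmeas hopt ha hb hc hreg
  set D : ℝ := d + 2 * α - α * β with hD
  have hD0 : 0 < D := by linarith
  set Γ := G * (8 ^ n) ^ α + η with hΓ
  have hΓ0 : 0 < Γ := by positivity
  set m := (1 + (8 : ℝ) ^ n / (2 * c')) ^ d with hm
  have hm0 : 0 < m := by positivity
  -- The largest value of `r ^ D * T` permitted by the information condition of
  -- `le_minimaxAvgRegret`.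
  set q := c₀ / (20 * (Γ ^ 2 * m) * (12 * c') ^ d) with hq
  have hq0 : 0 < q := by positivity
  set γ := q ^ (1 / D) with hγ
  have hγ0 : 0 < γ := Real.rpow_pos_of_pos hq0 _
  -- Solves `r ^ D * (T + 1) = q`. Using `T + 1` keeps the scale positive and monotone from `T = 0`
  -- on; it costs the factor `2 ^ (-(α / D))` in the rate.
  set r : ℕ → ℝ := fun T => γ * ((T : ℝ) + 1) ^ (-(1 / D)) with hr
  have hr0 : ∀ T, 0 < r T := fun T => by positivity
  have hrlim : Filter.Tendsto r Filter.atTop (nhds 0) := by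
    have h1 := (tendsto_rpow_neg_atTop (by positivity : 0 < 1 / D)).comp
      (Filter.tendsto_atTop_add_const_right _ (1 : ℝ) tendsto_natCast_atTop_atTop)
    have h2 := h1.const_mul γ
    rwa [mul_zero] at h2
  have hrT : Filter.Tendsto r Filter.atTop (𝓝[>] 0) :=
    tendsto_nhdsWithin_iff.2 ⟨hrlim, Filter.Eventually.of_forall hr0⟩
  have hrD : ∀ T : ℕ, r T ^ D * T ≤ q := by
    intro T
    have hT : (0 : ℝ) < T + 1 := by positivity
    have e : r T ^ D = q * ((T : ℝ) + 1)⁻¹ := by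
      rw [hr, Real.mul_rpow hγ0.le (by positivity), hγ, ← Real.rpow_mul hq0.le,
        ← Real.rpow_mul hT.le, one_div_mul_cancel hD0.ne', Real.rpow_one, neg_mul,
        one_div_mul_cancel hD0.ne', Real.rpow_neg_one]
    rw [e, mul_assoc]
    refine mul_le_of_le_one_right hq0.le ?_
    rw [inv_mul_le_iff₀ hT]
    linarith
  have hrα : ∀ T : ℕ, 0 < r T ^ α := fun T => Real.rpow_pos_of_pos (hr0 T) α
  have hrate : ∀ T : ℕ, 0 < T → η * c' ^ α * γ ^ α * 2 ^ (-(α / D)) / (8 * Real.exp 1) *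
      (T : ℝ) ^ (-(α / D)) ≤ η * (c' * r T) ^ α / (8 * Real.exp 1) := by
    intro T hT
    have hT1 : (1 : ℝ) ≤ T := by exact_mod_cast hT
    have e : r T ^ α = γ ^ α * ((T : ℝ) + 1) ^ (-(α / D)) := by
      rw [hr, Real.mul_rpow hγ0.le (by positivity),
        ← Real.rpow_mul (by positivity : (0 : ℝ) ≤ T + 1)]
      congr 2
      ring
    have h1 : (2 * (T : ℝ)) ^ (-(α / D)) ≤ ((T : ℝ) + 1) ^ (-(α / D)) :=
      Real.rpow_le_rpow_of_nonpos (by positivity) (by linarith)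
        (neg_nonpos.2 (by positivity))
    rw [Real.mul_rpow (by norm_num) (by linarith)] at h1
    rw [Real.mul_rpow hc'.le (hr0 T).le, e, div_mul_eq_mul_div]
    refine div_le_div_of_nonneg_right ?_ (by positivity)
    calc η * c' ^ α * γ ^ α * 2 ^ (-(α / D)) * (T : ℝ) ^ (-(α / D)) =
          η * c' ^ α * γ ^ α * (2 ^ (-(α / D)) * (T : ℝ) ^ (-(α / D))) := by ring
      _ ≤ η * c' ^ α * γ ^ α * ((T : ℝ) + 1) ^ (-(α / D)) := by gcongr
      _ = _ := by ring
  have main : ∀ F : ℕ → Set (Bandit.Pt d → ℝ),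
      (∀ T z, 8 ^ n * r T ≤ 1 →
        Bandit.PertSetup S A M α L G η (Bandit.minValue S A f₀) n (r T) (c' * r T) χ f₀ z →
        Bandit.perturbed χ f₀ α η (Bandit.minValue S A f₀) n (r T) (c' * r T) z ∈ F T) →
      Bandit.IsOmegaRate (fun T => Bandit.minimaxAvgRegret S A (F T) T) (α / D) := by
    intro F hF
    refine ⟨η * c' ^ α * γ ^ α * 2 ^ (-(α / D)) / (8 * Real.exp 1), by positivity, ?_⟩
    filter_upwards [hrT.eventually hev, Filter.eventually_gt_atTop 0] with T hT hT0
    obtain ⟨h1, Z, hZ, hs, hcount, hp⟩ := hT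
    refine (ENNReal.ofReal_le_ofReal (hrate T hT0)).trans ?_
    refine Bandit.le_minimaxAvgRegret hA hc' (hr0 T) hZ hs hcount hp hmeas hT0 ?_
      fun z hz => hF T z h1 (hp z hz)
    rw [← hΓ, ← hm, ← hD]
    calc _ ≤ 20 * (Γ ^ 2 * m) * (12 * c') ^ d * q := by gcongr; exact hrD T
      _ = c₀ := by rw [hq]; field_simp
  have hadm : ∀ T z C₀,
      Bandit.PertSetup S A M α L G η (Bandit.minValue S A f₀) n (r T) (c' * r T) χ f₀ z →
      Bandit.SublevelUpper S A
        (Bandit.perturbed χ f₀ α η (Bandit.minValue S A f₀) n (r T) (c' * r T) z) C₀ β →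
      Bandit.perturbed χ f₀ α η (Bandit.minValue S A f₀) n (r T) (c' * r T) z ∈
        Bandit.nbhd S A M C₀ α β f₀ (2 * Γ * r T ^ α) := by
    intro T z C₀ h hu
    refine ⟨⟨h.measurable, h.hasOptimizer, h.boundedGap hA, h.meanSmooth, hu⟩,
      Γ * r T ^ α, ?_, fun x _ => h.abs_perturbed_sub_le x⟩
    have := mul_pos hΓ0 (hrα T)
    linarith
  -- The perturbations are within `Γ * r T ^ α` of `f₀`; the factor `2` provides strict inequality.
  refine ⟨fun T => 2 * Γ * r T ^ α, fun T => by have := hrα T; positivity, ?_, ?_, ?_, ?_⟩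
  · intro T T' hTT'
    have h1 : (T : ℝ) ≤ T' := by exact_mod_cast hTT'
    have h2 : r T' ≤ r T := by
      refine mul_le_mul_of_nonneg_left ?_ hγ0.le
      exact Real.rpow_le_rpow_of_nonpos (by positivity) (by linarith)
        (neg_nonpos.2 (by positivity))
    exact mul_le_mul_of_nonneg_left (Real.rpow_le_rpow (hr0 T').le h2 hα.le) (by positivity)
  · have h1 := (hrlim.rpow_const (Or.inr hα.le)).const_mul (2 * Γ)
    rwa [Real.zero_rpow hα.ne', mul_zero] at h1
  -- Without an upper packing bound for `f₀`, boundedness of `S` supplies one at levels above the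
  -- dip. Its constant depends on `T`, which the union over `C₀` tolerates.
  · refine main _ fun T z h8 h => ?_
    obtain ⟨C₁, hC₁⟩ := Bandit.exists_packing_sublevel_le hS.isBounded A f₀ hβ
      (mul_pos hη (Real.rpow_pos_of_pos (mul_pos hc' (hr0 T)) α))
    exact Set.mem_iUnion.2 ⟨_, hadm T z _ h (h.sublevelUpper hA hc' hβ hαβ h8 hC₁)⟩
  -- With `C₁` given for `f₀`, the constant from `sublevelUpper` involves only `C₁`, `d`, `α`, `η`,
  -- `c'` and `n`, so one `C₀` serves all `T` and `z`.
  · intro C₁ hC₁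
    exact ⟨_, main _ fun T z h8 h => hadm T z _ h
      (h.sublevelUpper hA hc' hβ hαβ h8 fun a ha' ε hε _ => hC₁ a ha' ε hε)⟩
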